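/- **Theorem 6.5.** Let $q>1$ be a real number and let $0\le i\le n$ be integers. *Algebras.* Let $\mathcal H_n$ be the complex algebra generated by the Laurent polynomial algebra $\mathcal A_n=\mathbb C[x_1^{\pm1},\dots,x_n^{\pm1}]$ and elements $T_1,\dots,T_{n-1}$ satisfying the braid relations, $(T_j+1)(T_j-q)=0$ and $T_jf-f^{s_j}T_j=(q-1)\,x_j\,\frac{f-f^{s_j}}{x_j-x_{j+1}}$ for $f\in\mathcal A_n$, where $s_j=(j,j+1)$. Let $\mathbb H_n$ be the complex algebra generated by the group algebra $\mathbb C[S_n]$ (basis $t_w$) and the polynomial algebra $\mathbb A_n=\mathbb C[\epsilon_1,\dots,\epsilon_n]$ with $v\,t_{s_j}-t_{s_j}s_j(v)=\log q\cdot\langle v,\alpha_j^\vee\rangle$ for $v\in\bigoplus_k\mathbb C\epsilon_k$, where $\alpha_j=\epsilon_j-\epsilon_{j+1}$ and $\langle\epsilon_k,\alpha_j^\vee\rangle=\delta_{k,j}-\delta_{k,j+1}$. For $\zeta\in\mathbb C^n$ let $\mathbb J_{S_n\zeta}$ be the ideal of the symmetric polynomials in $\mathbb A_n^{S_n}$ that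 vanish at $\zeta$; call $\zeta$ *real* if $\zeta_k-\zeta_l\in\mathbb R$ for all $k,l$. *The functor $\Lambda$.* Let $\pi$ be a finite-dimensional $\mathbb H_n$-module that is a sum of submodules, each annihilated by a power of $\mathbb J_{S_n\zeta}$ for some real $\zeta$. Then $\Lambda(\pi)$ is the $\mathcal H_n$-module with the same underlying space as $\pi$ on which $x_k$ acts by $e^{\epsilon_k}$ and $T_j$ acts by $$(t_{s_j}+1)\,\frac{\mathcal G(\alpha_j)}{g(\alpha_j)}-1,\qquad \mathcal G(\alpha)=\frac{q\,e^{\alpha}-1}{e^{\alpha}-1},\quad g(\alpha)=\frac{\alpha+\log q}{\alpha},$$ where $e^{\epsilon_k}$ and $\mathcal G(\alpha_j)/g(\alpha_j)$ are evaluated by holomorphic functional calculus ($\mathcal G/g$ is holomorphic at all real numbers after removing singularities); $\Lambda$ is the identity on the underlying linear maps of morphisms. *Derivatives.* Let $\mathbf S_i=\bigl(\sum_{w\in S_i}q^{-l(w)}\bigr)^{-1}\sum_{w\in S_i}(-1/q)^{l(w)}T_w\in\mathcal H_i$ and $\mathbf s_i=\frac1{i!}\sum_{w\in S_i}(-1)^{l(w)}t_w\in\mathbb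 H_i$ be the sign projectors, and let $\mathbf S_i^n\in\mathcal H_n$, $\mathbf s_i^n\in\mathbb H_n$ be the images of $1\otimes\mathbf S_i$, $1\otimes\mathbf s_i$ under the standard embeddings $\mathcal H_{n-i}\otimes\mathcal H_i\to\mathcal H_n$ and $\mathbb H_{n-i}\otimes\mathbb H_i\to\mathbb H_n$ (the first factor on the first $n-i$ indices, the second on the last $i$). For an $\mathcal H_n$-module $\sigma$ let $\mathbf{BZ}_i(\sigma)=\mathbf S_i^n(\sigma)$, an $\mathcal H_{n-i}$-module; for an $\mathbb H_n$-module $\pi$ let $\mathbf{gBZ}_i(\pi)=\mathbf s_i^n(\pi)$, an $\mathbb H_{n-i}$-module. *Claim.* Let $\zeta\in\mathbb C^n$ be real. For finite-dimensional $\mathbb H_n$-modules $\pi$ annihilated by a power of $\mathbb J_{S_n\zeta}$ there is an isomorphism of $\mathcal H_{n-i}$-modules $$\mathbf{BZ}_i(\Lambda(\pi))\;\cong\;\Lambda(\mathbf{gBZ}_i(\pi)),$$ natural in $\pi$; that is, the functors $\mathbf{BZ}_i\circ\Lambda$ and $\Lambda\circ\mathbf{gBZ}_i$ on the category of such modules are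 naturally isomorphic. -/

import Mathlib

open CategoryTheory

universe u

noncomputable section

namespace BZ

/-- The first of the two indices exchanged by the `j`-th simple reflection. -/
def lo {n : ℕ} (j : Fin (n - 1)) : Fin n := ⟨j.1, by have := j.2; omega⟩

/-- The second of the two indices exchanged by the `j`-th simple reflection. -/
def hi {n : ℕ} (j : Fin (n - 1)) : Fin n := ⟨j.1 + 1, by have := j.2; omega⟩

/-- The simple reflection `s_j`, exchanging `j` and `j + 1`. -/
def simpleRefl {n : ℕ} (j : Fin (n - 1)) : Equiv.Perm (Fin n) := Equiv.swap (lo j) (hi j)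

lemma lo_ne_hi {n : ℕ} (j : Fin (n - 1)) : lo j ≠ hi j := by
  simp [lo, hi, Fin.ext_iff]

lemma exists_word {n : ℕ} (w : Equiv.Perm (Fin n)) :
    ∃ L : List (Fin (n - 1)), (L.map simpleRefl).prod = w := by
  rcases n with _ | n
  · exact ⟨[], Subsingleton.elim _ _⟩
  · have hw : w ∈ Submonoid.closure
        (Set.range fun i : Fin n => Equiv.swap i.castSucc i.succ) := by
      rw [Equiv.Perm.mclosure_swap_castSucc_succ]; trivial
    induction hw using Submonoid.closure_induction with
    | mem x hx =>
      obtain ⟨i, rfl⟩ := hx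
      exact ⟨[i], by simp [simpleRefl]; rfl⟩
    | one => exact ⟨[], by simp⟩
    | mul x y _ _ hx hy =>
      obtain ⟨L, rfl⟩ := hx
      obtain ⟨L', rfl⟩ := hy
      exact ⟨L ++ L', by simp⟩

lemma exists_shortest_word {n : ℕ} (w : Equiv.Perm (Fin n)) :
    ∃ L : List (Fin (n - 1)), (L.map simpleRefl).prod = w ∧
      ∀ L' : List (Fin (n - 1)), (L'.map simpleRefl).prod = w → L.length ≤ L'.length := by
  classical
  have h : ∃ l : ℕ, ∃ L : List (Fin (n - 1)), L.length = l ∧ (L.map simpleRefl).prod = w := by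
    obtain ⟨L, hL⟩ := exists_word w
    exact ⟨_, L, rfl, hL⟩
  obtain ⟨L, h1, h2⟩ := Nat.find_spec h
  exact ⟨L, h2, fun L' hL' => h1 ▸ Nat.find_min' h ⟨L', rfl, hL'⟩⟩

/-- A shortest expression of `w` as a product of simple reflections. -/
def shortestWord {n : ℕ} (w : Equiv.Perm (Fin n)) : List (Fin (n - 1)) :=
  (exists_shortest_word w).choose

/-- The length `l(w)`. -/
def len {n : ℕ} (w : Equiv.Perm (Fin n)) : ℕ := (shortestWord w).length

/-- The ring of Laurent polynomials, as the group algebra of the lattice `ℤ^n`. -/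
abbrev Laurent (n : ℕ) : Type := AddMonoidAlgebra ℂ (Fin n →₀ ℤ)

/-- The variable `x_k` of the ring of Laurent polynomials. -/
def lx {n : ℕ} (k : Fin n) : Laurent n := AddMonoidAlgebra.single (Finsupp.single k 1) 1

/-- The map of Laurent polynomial rings given by `x_k ↦ x_{g k}`. -/
def lrename {n m : ℕ} (g : Fin n → Fin m) : Laurent n →ₐ[ℂ] Laurent m :=
  AddMonoidAlgebra.mapDomainAlgHom ℂ ℂ (Finsupp.mapDomain.addMonoidHom g)

lemma lrename_comp {n m k : ℕ} (g : Fin n → Fin m) (h : Fin m → Fin k) (f : Laurent n) :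
    lrename h (lrename g f) = lrename (h ∘ g) f := by
  have : (lrename h).comp (lrename g) = lrename (h ∘ g) := by
    rw [lrename, lrename, lrename, ← AddMonoidAlgebra.mapDomainAlgHom_comp]
    congr 1
    ext; simp
  exact DFunLike.congr_fun this f

lemma lrename_lx {n m : ℕ} (g : Fin n → Fin m) (k : Fin n) : lrename g (lx k) = lx (g k) := by
  simp [lrename, lx]

/-! ### The affine Hecke algebra of `GL(n)` -/

/-- The defining relations of the affine Hecke algebra `H_n`, on generators `T_j` and the Laurent
polynomials `f`: the quadratic and braid relations, the relations of the algebra of Laurent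
polynomials, and
`T_j f - f^{s_j} T_j = (q - 1) x_j (f - f^{s_j}) / (x_j - x_{j+1})`. -/
inductive AffineRel (q : ℝ) (n : ℕ) :
    FreeAlgebra ℂ (Fin (n - 1) ⊕ Laurent n) → FreeAlgebra ℂ (Fin (n - 1) ⊕ Laurent n) → Prop
  | quad (j : Fin (n - 1)) : AffineRel q n
      ((FreeAlgebra.ι ℂ (Sum.inl j) + 1) *
        (FreeAlgebra.ι ℂ (Sum.inl j) - algebraMap ℂ _ (q : ℂ))) 0
  | braid (j k : Fin (n - 1)) (h : j.1 + 1 = k.1) : AffineRel q n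
      (FreeAlgebra.ι ℂ (Sum.inl j) * FreeAlgebra.ι ℂ (Sum.inl k) * FreeAlgebra.ι ℂ (Sum.inl j))
      (FreeAlgebra.ι ℂ (Sum.inl k) * FreeAlgebra.ι ℂ (Sum.inl j) * FreeAlgebra.ι ℂ (Sum.inl k))
  | comm (j k : Fin (n - 1)) (h : j.1 + 1 < k.1) : AffineRel q n
      (FreeAlgebra.ι ℂ (Sum.inl j) * FreeAlgebra.ι ℂ (Sum.inl k))
      (FreeAlgebra.ι ℂ (Sum.inl k) * FreeAlgebra.ι ℂ (Sum.inl j))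
  | scalar (c : ℂ) : AffineRel q n
      (FreeAlgebra.ι ℂ (Sum.inr (algebraMap ℂ (Laurent n) c))) (algebraMap ℂ _ c)
  | add (f g : Laurent n) : AffineRel q n
      (FreeAlgebra.ι ℂ (Sum.inr (f + g)))
      (FreeAlgebra.ι ℂ (Sum.inr f) + FreeAlgebra.ι ℂ (Sum.inr g))
  | mul (f g : Laurent n) : AffineRel q n
      (FreeAlgebra.ι ℂ (Sum.inr (f * g)))
      (FreeAlgebra.ι ℂ (Sum.inr f) * FreeAlgebra.ι ℂ (Sum.inr g))
  | cross (j : Fin (n - 1)) (f g : Laurent n)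
      (h : (lx (lo j) - lx (hi j)) * g = f - lrename (simpleRefl j) f) : AffineRel q n
      (FreeAlgebra.ι ℂ (Sum.inl j) * FreeAlgebra.ι ℂ (Sum.inr f) -
        FreeAlgebra.ι ℂ (Sum.inr (lrename (simpleRefl j) f)) * FreeAlgebra.ι ℂ (Sum.inl j))
      (((q : ℂ) - 1) • FreeAlgebra.ι ℂ (Sum.inr (lx (lo j) * g)))

/-- The affine Hecke algebra `H_n` of `GL(n)` with parameter `q`. -/
def AffineHecke (q : ℝ) (n : ℕ) : Type := RingQuot (AffineRel q n)

instance (q : ℝ) (n : ℕ) : Ring (AffineHecke q n) :=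
  inferInstanceAs (Ring (RingQuot (AffineRel q n)))

instance (q : ℝ) (n : ℕ) : Algebra ℂ (AffineHecke q n) :=
  inferInstanceAs (Algebra ℂ (RingQuot (AffineRel q n)))

namespace AffineHecke

variable {q : ℝ} {n : ℕ}

/-- The generator `T_j`. -/
def T (j : Fin (n - 1)) : AffineHecke q n :=
  RingQuot.mkAlgHom ℂ (AffineRel q n) (FreeAlgebra.ι ℂ (Sum.inl j))

/-- A Laurent polynomial, as an element of `H_n`. -/
def poly (f : Laurent n) : AffineHecke q n :=
  RingQuot.mkAlgHom ℂ (AffineRel q n) (FreeAlgebra.ι ℂ (Sum.inr f))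

lemma T_quad (j : Fin (n - 1)) :
    (T j + 1) * (T j - algebraMap ℂ (AffineHecke q n) (q : ℂ)) = 0 := by
  have h := RingQuot.mkAlgHom_rel ℂ (AffineRel.quad (q := q) j)
  simp only [map_mul, map_add, map_sub, map_one, map_zero, AlgHom.commutes] at h
  exact h

lemma T_braid (j k : Fin (n - 1)) (h : j.1 + 1 = k.1) :
    (T j * T k * T j : AffineHecke q n) = T k * T j * T k := by
  have h := RingQuot.mkAlgHom_rel ℂ (AffineRel.braid (q := q) j k h)
  simp only [map_mul] at h
  exact h

lemma T_comm (j k : Fin (n - 1)) (h : j.1 + 1 < k.1) :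
    (T j * T k : AffineHecke q n) = T k * T j := by
  have h := RingQuot.mkAlgHom_rel ℂ (AffineRel.comm (q := q) j k h)
  simp only [map_mul] at h
  exact h

lemma poly_scalar (c : ℂ) :
    poly (algebraMap ℂ (Laurent n) c) = algebraMap ℂ (AffineHecke q n) c := by
  have h := RingQuot.mkAlgHom_rel ℂ (AffineRel.scalar (q := q) (n := n) c)
  rwa [AlgHom.commutes] at h

lemma poly_add (f g : Laurent n) :
    (poly (f + g) : AffineHecke q n) = poly f + poly g := by
  have h := RingQuot.mkAlgHom_rel ℂ (AffineRel.add (q := q) f g)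
  rwa [map_add] at h

lemma poly_mul (f g : Laurent n) :
    (poly (f * g) : AffineHecke q n) = poly f * poly g := by
  have h := RingQuot.mkAlgHom_rel ℂ (AffineRel.mul (q := q) f g)
  rwa [map_mul] at h

lemma T_cross (j : Fin (n - 1)) (f g : Laurent n)
    (h : (lx (lo j) - lx (hi j)) * g = f - lrename (simpleRefl j) f) :
    (T j * poly f - poly (lrename (simpleRefl j) f) * T j : AffineHecke q n) =
      ((q : ℂ) - 1) • poly (lx (lo j) * g) := by
  have h := RingQuot.mkAlgHom_rel ℂ (AffineRel.cross (q := q) j f g h)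
  rwa [map_sub, map_mul, map_mul, map_smul] at h

/-- Operators that satisfy the defining relations define a representation of `H_n`. -/
def lift {B : Type*} [Ring B] [Algebra ℂ B] (t : Fin (n - 1) → B) (a : Laurent n →ₐ[ℂ] B)
    (quad : ∀ j, (t j + 1) * (t j - algebraMap ℂ B (q : ℂ)) = 0)
    (braid : ∀ j k : Fin (n - 1), j.1 + 1 = k.1 → t j * t k * t j = t k * t j * t k)
    (comm : ∀ j k : Fin (n - 1), j.1 + 1 < k.1 → t j * t k = t k * t j)
    (cross : ∀ (j : Fin (n - 1)) (f g : Laurent n),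
      (lx (lo j) - lx (hi j)) * g = f - lrename (simpleRefl j) f →
      t j * a f - a (lrename (simpleRefl j) f) * t j = ((q : ℂ) - 1) • a (lx (lo j) * g)) :
    AffineHecke q n →ₐ[ℂ] B :=
  RingQuot.liftAlgHom ℂ ⟨FreeAlgebra.lift ℂ (Sum.elim t a), by
    intro x y h
    induction h with
    | quad j => simpa using quad j
    | braid j k h => simpa using braid j k h
    | comm j k h => simpa using comm j k h
    | scalar c =>
      simp only [FreeAlgebra.lift_ι_apply, Sum.elim_inr, AlgHom.commutes]
    | add f g => simp
    | mul f g => simp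
    | cross j f g h =>
      simp only [map_sub, map_mul, map_smul, FreeAlgebra.lift_ι_apply, Sum.elim_inr, Sum.elim_inl]
      rw [← map_mul]
      exact cross j f g h⟩

section lift

variable {B : Type*} [Ring B] [Algebra ℂ B] (t : Fin (n - 1) → B) (a : Laurent n →ₐ[ℂ] B)
    (quad : ∀ j, (t j + 1) * (t j - algebraMap ℂ B (q : ℂ)) = 0)
    (braid : ∀ j k : Fin (n - 1), j.1 + 1 = k.1 → t j * t k * t j = t k * t j * t k)
    (comm : ∀ j k : Fin (n - 1), j.1 + 1 < k.1 → t j * t k = t k * t j)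
    (cross : ∀ (j : Fin (n - 1)) (f g : Laurent n),
      (lx (lo j) - lx (hi j)) * g = f - lrename (simpleRefl j) f →
      t j * a f - a (lrename (simpleRefl j) f) * t j = ((q : ℂ) - 1) • a (lx (lo j) * g))

lemma lift_T (j : Fin (n - 1)) : lift t a quad braid comm cross (T j) = t j := by
  unfold lift T
  erw [RingQuot.liftAlgHom_mkAlgHom_apply]
  simp

lemma lift_poly (f : Laurent n) : lift t a quad braid comm cross (poly f) = a f := by
  unfold lift poly
  erw [RingQuot.liftAlgHom_mkAlgHom_apply]
  simp

end lift

/-- The elements `T_j` and the Laurent polynomials generate `H_n`. -/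
lemma induction {P : AffineHecke q n → Prop} (hT : ∀ j, P (T j)) (hp : ∀ f, P (poly f))
    (hadd : ∀ x y, P x → P y → P (x + y)) (hmul : ∀ x y, P x → P y → P (x * y)) (x) : P x := by
  obtain ⟨y, rfl⟩ := RingQuot.mkAlgHom_surjective ℂ (AffineRel q n) x
  induction y using FreeAlgebra.induction with
  | grade0 c =>
    have := hp (algebraMap ℂ (Laurent n) c)
    rw [poly_scalar] at this
    rw [AlgHom.commutes]
    exact this
  | grade1 s =>
    rcases s with j | f
    · exact hT j
    · exact hp f
  | mul a b ha hb => rw [map_mul]; exact hmul _ _ ha hb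
  | add a b ha hb => rw [map_add]; exact hadd _ _ ha hb

/-- The inclusion of Laurent polynomials, as a homomorphism of algebras. -/
def polyHom : Laurent n →ₐ[ℂ] AffineHecke q n :=
  AlgHom.ofLinearMap
    { toFun := poly
      map_add' := poly_add
      map_smul' := fun c f => by
        rw [Algebra.smul_def, poly_mul, poly_scalar, ← Algebra.smul_def]; rfl }
    (by
      have h := poly_scalar (q := q) (n := n) 1
      rw [map_one, map_one] at h
      exact h)
    poly_mul

lemma polyHom_apply (f : Laurent n) : (polyHom f : AffineHecke q n) = poly f := rfl

/-- The element `T_w`, the product of the `T_j` along a shortest expression of `w`. -/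
def Tw (w : Equiv.Perm (Fin n)) : AffineHecke q n := ((shortestWord w).map T).prod

/-- The sign projector of `H_n`. -/
def signProj (q : ℝ) (n : ℕ) : AffineHecke q n :=
  (∑ w : Equiv.Perm (Fin n), (1 / (q : ℂ)) ^ len w)⁻¹ •
    ∑ w : Equiv.Perm (Fin n), (-1 / (q : ℂ)) ^ len w • Tw w

end AffineHecke

/-! ### Blocks of indices -/

/-- The block of `k` consecutive indices that starts at `a`, inside `n` indices. -/
def block {k a n : ℕ} (h : a + k ≤ n) : Fin k ↪ Fin n where
  toFun j := ⟨a + j.1, by have := j.2; omega⟩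
  inj' i j hij := by
    simp only [Fin.mk.injEq] at hij
    exact Fin.ext (by omega)

/-- The simple reflections of a block of consecutive indices. -/
def blockRefl {k a n : ℕ} (h : a + k ≤ n) (j : Fin (k - 1)) : Fin (n - 1) :=
  ⟨a + j.1, by have := j.2; omega⟩

lemma block_lo {k a n : ℕ} (h : a + k ≤ n) (j : Fin (k - 1)) :
    lo (blockRefl h j) = block h (lo j) := rfl

lemma block_hi {k a n : ℕ} (h : a + k ≤ n) (j : Fin (k - 1)) :
    hi (blockRefl h j) = block h (hi j) := rfl

lemma simpleRefl_block {k a n : ℕ} (h : a + k ≤ n) (j : Fin (k - 1)) :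
    simpleRefl (blockRefl h j) ∘ block h = block h ∘ simpleRefl j := by
  funext x
  simp only [simpleRefl, block_lo, block_hi, Function.comp_apply]
  rw [Equiv.swap_apply_def, Equiv.swap_apply_def]
  simp only [(block h).injective.eq_iff]
  split_ifs <;> rfl

/-- The embedding `H_k → H_n` on the block of `k` indices starting at `a`:
`T_j ↦ T_{a + j}`, `x_j ↦ x_{a + j}`. -/
def AffineHecke.levi (q : ℝ) {k a n : ℕ} (h : a + k ≤ n) :
    AffineHecke q k →ₐ[ℂ] AffineHecke q n :=
  AffineHecke.lift (fun j => AffineHecke.T (blockRefl h j))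
    (AffineHecke.polyHom.comp (lrename (block h)))
    (fun j => AffineHecke.T_quad _)
    (fun j k hjk => AffineHecke.T_braid _ _ (by simp only [blockRefl]; omega))
    (fun j k hjk => AffineHecke.T_comm _ _ (by simp only [blockRefl]; omega))
    (fun j f g hfg => by
      have e : lrename (block h) (lrename (simpleRefl j) f) =
          lrename (simpleRefl (blockRefl h j)) (lrename (block h) f) := by
        rw [lrename_comp, lrename_comp, simpleRefl_block]
      simp only [AlgHom.comp_apply, AffineHecke.polyHom_apply, e, map_mul, lrename_lx]
      rw [← AffineHecke.poly_mul]
      refine AffineHecke.T_cross (blockRefl h j) _ _ ?_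
      rw [← e, ← map_sub, ← hfg, map_mul, map_sub, lrename_lx, lrename_lx]
      rfl)

/-! ### The graded Hecke algebra -/

/-- The defining relations of the graded Hecke algebra, on generators `t_w` (for `w` in the
symmetric group) and the elements `p` of the symmetric algebra of `ℂ^n`, that is, of the polynomial
ring in the standard basis `ε_1, …, ε_n`: the relations of the group algebra, those of the
polynomial ring, and `v t_s - t_s s(v) = log q ⟨v, α^∨⟩` for a simple root `α = ε_j - ε_{j+1}`. As
both sides of the last relation are linear in `v`, it is written for `v = ε_k`. -/
inductive GradedRel (q : ℝ) (n : ℕ) :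
    FreeAlgebra ℂ (Equiv.Perm (Fin n) ⊕ MvPolynomial (Fin n) ℂ) →
      FreeAlgebra ℂ (Equiv.Perm (Fin n) ⊕ MvPolynomial (Fin n) ℂ) → Prop
  | group_one : GradedRel q n (FreeAlgebra.ι ℂ (Sum.inl 1)) 1
  | group_mul (v w : Equiv.Perm (Fin n)) : GradedRel q n
      (FreeAlgebra.ι ℂ (Sum.inl (v * w)))
      (FreeAlgebra.ι ℂ (Sum.inl v) * FreeAlgebra.ι ℂ (Sum.inl w))
  | scalar (c : ℂ) : GradedRel q n
      (FreeAlgebra.ι ℂ (Sum.inr (MvPolynomial.C c))) (algebraMap ℂ _ c)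
  | add (f g : MvPolynomial (Fin n) ℂ) : GradedRel q n
      (FreeAlgebra.ι ℂ (Sum.inr (f + g)))
      (FreeAlgebra.ι ℂ (Sum.inr f) + FreeAlgebra.ι ℂ (Sum.inr g))
  | mul (f g : MvPolynomial (Fin n) ℂ) : GradedRel q n
      (FreeAlgebra.ι ℂ (Sum.inr (f * g)))
      (FreeAlgebra.ι ℂ (Sum.inr f) * FreeAlgebra.ι ℂ (Sum.inr g))
  | cross (j : Fin (n - 1)) (k : Fin n) : GradedRel q n
      (FreeAlgebra.ι ℂ (Sum.inr (MvPolynomial.X k)) * FreeAlgebra.ι ℂ (Sum.inl (simpleRefl j)) -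
        FreeAlgebra.ι ℂ (Sum.inl (simpleRefl j)) *
          FreeAlgebra.ι ℂ (Sum.inr (MvPolynomial.X (simpleRefl j k))))
      (algebraMap ℂ _ ((Real.log q : ℂ) *
        ((if k = lo j then 1 else 0) - (if k = hi j then 1 else 0))))

/-- The graded Hecke algebra `ℍ_n` of type `GL(n)` with parameter `log q`. -/
def GradedHecke (q : ℝ) (n : ℕ) : Type := RingQuot (GradedRel q n)

instance (q : ℝ) (n : ℕ) : Ring (GradedHecke q n) :=
  inferInstanceAs (Ring (RingQuot (GradedRel q n)))

instance (q : ℝ) (n : ℕ) : Algebra ℂ (GradedHecke q n) :=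
  inferInstanceAs (Algebra ℂ (RingQuot (GradedRel q n)))

namespace GradedHecke

variable {q : ℝ} {n : ℕ}

/-- The generator `t_w`. -/
def t (w : Equiv.Perm (Fin n)) : GradedHecke q n :=
  RingQuot.mkAlgHom ℂ (GradedRel q n) (FreeAlgebra.ι ℂ (Sum.inl w))

/-- An element of the symmetric algebra of `ℂ^n`, as an element of `ℍ_n`. -/
def poly (f : MvPolynomial (Fin n) ℂ) : GradedHecke q n :=
  RingQuot.mkAlgHom ℂ (GradedRel q n) (FreeAlgebra.ι ℂ (Sum.inr f))

lemma t_one : (t 1 : GradedHecke q n) = 1 := by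
  have h := RingQuot.mkAlgHom_rel ℂ (GradedRel.group_one (q := q) (n := n))
  rwa [map_one] at h

lemma t_mul (v w : Equiv.Perm (Fin n)) : (t (v * w) : GradedHecke q n) = t v * t w := by
  have h := RingQuot.mkAlgHom_rel ℂ (GradedRel.group_mul (q := q) v w)
  rwa [map_mul] at h

lemma poly_scalar (c : ℂ) :
    poly (MvPolynomial.C c) = algebraMap ℂ (GradedHecke q n) c := by
  have h := RingQuot.mkAlgHom_rel ℂ (GradedRel.scalar (q := q) (n := n) c)
  rwa [AlgHom.commutes] at h

lemma poly_add (f g : MvPolynomial (Fin n) ℂ) :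
    (poly (f + g) : GradedHecke q n) = poly f + poly g := by
  have h := RingQuot.mkAlgHom_rel ℂ (GradedRel.add (q := q) f g)
  rwa [map_add] at h

lemma poly_mul (f g : MvPolynomial (Fin n) ℂ) :
    (poly (f * g) : GradedHecke q n) = poly f * poly g := by
  have h := RingQuot.mkAlgHom_rel ℂ (GradedRel.mul (q := q) f g)
  rwa [map_mul] at h

lemma t_cross (j : Fin (n - 1)) (k : Fin n) :
    (poly (MvPolynomial.X k) * t (simpleRefl j) -
        t (simpleRefl j) * poly (MvPolynomial.X (simpleRefl j k)) : GradedHecke q n) =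
      algebraMap ℂ _ ((Real.log q : ℂ) *
        ((if k = lo j then 1 else 0) - (if k = hi j then 1 else 0))) := by
  have h := RingQuot.mkAlgHom_rel ℂ (GradedRel.cross (q := q) j k)
  rwa [map_sub, map_mul, map_mul, AlgHom.commutes] at h

/-- Operators that satisfy the defining relations define a representation of `ℍ_n`. -/
def lift {B : Type*} [Ring B] [Algebra ℂ B] (u : Equiv.Perm (Fin n) →* B)
    (a : MvPolynomial (Fin n) ℂ →ₐ[ℂ] B)
    (cross : ∀ (j : Fin (n - 1)) (k : Fin n),
      a (MvPolynomial.X k) * u (simpleRefl j) -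
          u (simpleRefl j) * a (MvPolynomial.X (simpleRefl j k)) =
        algebraMap ℂ B ((Real.log q : ℂ) *
          ((if k = lo j then 1 else 0) - (if k = hi j then 1 else 0)))) :
    GradedHecke q n →ₐ[ℂ] B :=
  RingQuot.liftAlgHom ℂ ⟨FreeAlgebra.lift ℂ (Sum.elim u a), by
    intro x y h
    induction h with
    | group_one => simp
    | group_mul v w => simp
    | scalar c =>
      simp only [FreeAlgebra.lift_ι_apply, Sum.elim_inr, AlgHom.commutes]
      exact a.commutes c
    | add f g => simp
    | mul f g => simp
    | cross j k =>
      simp only [map_sub, map_mul (FreeAlgebra.lift ℂ (Sum.elim u a)), FreeAlgebra.lift_ι_apply,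
        Sum.elim_inr, Sum.elim_inl, AlgHom.commutes]
      exact cross j k⟩

section lift

variable {B : Type*} [Ring B] [Algebra ℂ B] (u : Equiv.Perm (Fin n) →* B)
    (a : MvPolynomial (Fin n) ℂ →ₐ[ℂ] B)
    (cross : ∀ (j : Fin (n - 1)) (k : Fin n),
      a (MvPolynomial.X k) * u (simpleRefl j) -
          u (simpleRefl j) * a (MvPolynomial.X (simpleRefl j k)) =
        algebraMap ℂ B ((Real.log q : ℂ) *
          ((if k = lo j then 1 else 0) - (if k = hi j then 1 else 0))))

lemma lift_t (w : Equiv.Perm (Fin n)) : lift u a cross (t w) = u w := by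
  unfold lift t
  erw [RingQuot.liftAlgHom_mkAlgHom_apply]
  simp

lemma lift_poly (f : MvPolynomial (Fin n) ℂ) : lift u a cross (poly f) = a f := by
  unfold lift poly
  erw [RingQuot.liftAlgHom_mkAlgHom_apply]
  simp

end lift

/-- The elements `t_w` and the polynomials generate `ℍ_n`. -/
lemma induction {P : GradedHecke q n → Prop} (ht : ∀ w, P (t w)) (hp : ∀ f, P (poly f))
    (hadd : ∀ x y, P x → P y → P (x + y)) (hmul : ∀ x y, P x → P y → P (x * y)) (x) : P x := by
  obtain ⟨y, rfl⟩ := RingQuot.mkAlgHom_surjective ℂ (GradedRel q n) x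
  induction y using FreeAlgebra.induction with
  | grade0 c =>
    have := hp (MvPolynomial.C c)
    rw [poly_scalar] at this
    rw [AlgHom.commutes]
    exact this
  | grade1 s =>
    rcases s with j | f
    · exact ht j
    · exact hp f
  | mul a b ha hb => rw [map_mul]; exact hmul _ _ ha hb
  | add a b ha hb => rw [map_add]; exact hadd _ _ ha hb

/-- The inclusion of the polynomial ring, as a homomorphism of algebras. -/
def polyHom : MvPolynomial (Fin n) ℂ →ₐ[ℂ] GradedHecke q n :=
  AlgHom.ofLinearMap
    { toFun := poly
      map_add' := poly_add
      map_smul' := fun c f => by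
        rw [MvPolynomial.smul_eq_C_mul, poly_mul, poly_scalar, ← Algebra.smul_def]; rfl }
    (by
      have h := poly_scalar (q := q) (n := n) 1
      rw [map_one, map_one] at h
      exact h)
    poly_mul

lemma polyHom_apply (f : MvPolynomial (Fin n) ℂ) : (polyHom f : GradedHecke q n) = poly f := rfl

/-- The inclusion of the symmetric group, as a homomorphism of monoids. -/
def tHom : Equiv.Perm (Fin n) →* GradedHecke q n where
  toFun := t
  map_one' := t_one
  map_mul' := t_mul

/-- The sign projector of `ℍ_n`; the sign of `w` is `(-1)^{l(w)}`. -/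
def signProj (q : ℝ) (n : ℕ) : GradedHecke q n :=
  (Fintype.card (Equiv.Perm (Fin n)) : ℂ)⁻¹ •
    ∑ w : Equiv.Perm (Fin n), ((Equiv.Perm.sign w : ℤ) : ℂ) • t w

end GradedHecke

lemma viaEmbedding_simpleRefl {k a n : ℕ} (h : a + k ≤ n) (j : Fin (k - 1)) :
    (simpleRefl j).viaEmbedding (block h) = simpleRefl (blockRefl h j) := by
  ext1 x
  by_cases hx : x ∈ Set.range (block h)
  · obtain ⟨y, rfl⟩ := hx
    rw [Equiv.Perm.viaEmbedding_apply]
    exact (congrFun (simpleRefl_block h j) y).symm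
  · rw [Equiv.Perm.viaEmbedding_apply_of_notMem _ _ _ hx, simpleRefl, Equiv.swap_apply_of_ne_of_ne]
    · rintro rfl; exact hx ⟨lo j, rfl⟩
    · rintro rfl; exact hx ⟨hi j, rfl⟩

/-- The embedding `ℍ_k → ℍ_n` on the block of `k` indices starting at `a`. -/
def GradedHecke.levi (q : ℝ) {k a n : ℕ} (h : a + k ≤ n) :
    GradedHecke q k →ₐ[ℂ] GradedHecke q n :=
  GradedHecke.lift (GradedHecke.tHom.comp (Equiv.Perm.viaEmbeddingHom (block h)))
    (GradedHecke.polyHom.comp (MvPolynomial.rename (block h)))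
    (fun j k => by
      have := GradedHecke.t_cross (q := q) (blockRefl h j) (block h k)
      simp only [block_lo, block_hi, (block h).injective.eq_iff] at this
      simp only [MonoidHom.comp_apply, Equiv.Perm.viaEmbeddingHom_apply, viaEmbedding_simpleRefl,
        AlgHom.comp_apply, MvPolynomial.rename_X, GradedHecke.polyHom_apply]
      rw [← this]
      have e := congrFun (simpleRefl_block h j) k
      simp only [Function.comp_apply] at e
      rw [e]
      rfl)

open Filter Topology Asymptotics

/-! ### Functions of operators -/

/-- The polynomial `p` agrees with `f` to order `N` at `z`; the value of `f` at `z` is not used, so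
that removable singularities of `f` are allowed. -/
def Agrees (N : ℕ) (f : ℂ → ℂ) (p : Polynomial ℂ) (z : ℂ) : Prop :=
  (fun w => f w - p.eval w) =O[𝓝[≠] z] fun w => (w - z) ^ N

open Classical in
/-- The operator `f(A)`, for an operator `A` of a finite-dimensional space and a function `f` that is
holomorphic, up to removable singularities, at the eigenvalues of `A`: it is `p(A)` for any
polynomial `p` that agrees with `f`, at every eigenvalue, to an order at least the dimension of the
space (so the Taylor series of `f` acts through its truncations). -/
def opFun {E : Type*} [AddCommGroup E] [Module ℂ E] (f : ℂ → ℂ) (A : Module.End ℂ E) :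
    Module.End ℂ E :=
  if h : ∃ p : Polynomial ℂ, ∀ z, A.HasEigenvalue z → Agrees (Module.finrank ℂ E) f p z then
    Polynomial.aeval A h.choose
  else 0

lemma pow_dvd_of_isBigO {r : Polynomial ℂ} {z : ℂ} {N : ℕ}
    (h : (fun w => r.eval w) =O[𝓝[≠] z] fun w => (w - z) ^ N) :
    (Polynomial.X - Polynomial.C z) ^ N ∣ r := by
  by_cases hr : r = 0
  · simp [hr]
  obtain ⟨u, hu, hz⟩ := Polynomial.exists_eq_pow_rootMultiplicity_mul_and_not_dvd r hr z
  set m := r.rootMultiplicity z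
  by_cases hm : N ≤ m
  · rw [hu]
    exact (pow_dvd_pow _ hm).mul_right _
  exfalso
  push Not at hm
  apply hz
  rw [Polynomial.dvd_iff_isRoot, Polynomial.IsRoot]
  have h1 : (fun w => u.eval w) =O[𝓝[≠] z] fun w => (w - z) ^ (N - m) := by
    have h2 : (fun w => (w - z) ^ m * u.eval w) =O[𝓝[≠] z]
        fun w => (w - z) ^ m * (w - z) ^ (N - m) := by
      refine h.congr (fun w => ?_) (fun w => ?_)
      · conv_lhs => rw [hu]
        simp
      · rw [← pow_add, Nat.add_sub_cancel' hm.le]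
    have h3 := (isBigO_refl (fun w : ℂ => ((w - z) ^ m)⁻¹) (𝓝[≠] z)).mul h2
    refine h3.congr' ?_ ?_
    · filter_upwards [self_mem_nhdsWithin] with w hw
      have : (w - z) ^ m ≠ 0 := pow_ne_zero _ (sub_ne_zero.2 hw)
      field_simp
    · filter_upwards [self_mem_nhdsWithin] with w hw
      have : (w - z) ^ m ≠ 0 := pow_ne_zero _ (sub_ne_zero.2 hw)
      field_simp
  have h4 : Tendsto (fun w : ℂ => (w - z) ^ (N - m)) (𝓝[≠] z) (𝓝 0) := by
    have : Continuous fun w : ℂ => (w - z) ^ (N - m) := by fun_prop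
    have h5 := this.tendsto z
    simp only [sub_self, zero_pow (Nat.sub_pos_of_lt hm).ne'] at h5
    exact h5.mono_left nhdsWithin_le_nhds
  have h6 := h1.trans_tendsto h4
  have h7 : Tendsto (fun w : ℂ => u.eval w) (𝓝[≠] z) (𝓝 (u.eval z)) :=
    (u.continuous.tendsto z).mono_left nhdsWithin_le_nhds
  exact tendsto_nhds_unique h7 h6

section opFun

variable {E : Type*} [AddCommGroup E] [Module ℂ E]

lemma pow_finrank_apply [FiniteDimensional ℂ E] {A : Module.End ℂ E} {z : ℂ} {x : E} (hx : x ∈ A.maxGenEigenspace z) :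
    ((A - algebraMap ℂ _ z) ^ Module.finrank ℂ E) x = 0 := by
  rw [Module.End.maxGenEigenspace_eq_genEigenspace_finrank, Module.End.mem_genEigenspace_nat,
    LinearMap.mem_ker] at hx
  exact hx

lemma hasEigenvalue_of_mem {A : Module.End ℂ E} {z : ℂ} {x : E} (h0 : x ≠ 0) (N : ℕ)
    (hx : ((A - algebraMap ℂ _ z) ^ N) x = 0) : A.HasEigenvalue z := by
  by_contra hA
  have h1 : Function.Injective (A - algebraMap ℂ _ z : Module.End ℂ E) := by
    rw [← LinearMap.ker_eq_bot]
    by_contra h2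
    exact hA ((Module.End.hasEigenvalue_iff).2 (by rwa [Module.End.eigenspace_def]))
  have h3 : Function.Injective ((A - algebraMap ℂ _ z : Module.End ℂ E) ^ N) := by
    rw [Module.End.coe_pow]
    exact h1.iterate N
  exact h0 (h3 (by rw [hx, map_zero]))

variable [FiniteDimensional ℂ E]

lemma opFun_eq {f : ℂ → ℂ} {A : Module.End ℂ E} {p : Polynomial ℂ} {N : ℕ}
    (hN : Module.finrank ℂ E ≤ N) (hp : ∀ z, A.HasEigenvalue z → Agrees N f p z) :
    opFun f A = Polynomial.aeval A p := by
  have hp' : ∀ z, A.HasEigenvalue z → Agrees (Module.finrank ℂ E) f p z := by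
    intro z hz
    refine (hp z hz).trans ?_
    obtain ⟨k, rfl⟩ := Nat.exists_eq_add_of_le hN
    have h1 : (fun w : ℂ => (w - z) ^ k) =O[𝓝[≠] z] fun _ => (1 : ℂ) := by
      have : Continuous fun w : ℂ => (w - z) ^ k := by fun_prop
      exact ((this.tendsto z).mono_left nhdsWithin_le_nhds).isBigO_one ℂ
    simpa [pow_add] using
      (isBigO_refl (fun w : ℂ => (w - z) ^ Module.finrank ℂ E) (𝓝[≠] z)).mul h1
  have hex : ∃ p : Polynomial ℂ, ∀ z, A.HasEigenvalue z → Agrees (Module.finrank ℂ E) f p z :=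
    ⟨p, hp'⟩
  rw [opFun, dif_pos hex]
  set p' := hex.choose
  have hp'' := hex.choose_spec
  rw [← sub_eq_zero, ← map_sub]
  have key : ∀ z, A.HasEigenvalue z →
      (Polynomial.X - Polynomial.C z) ^ Module.finrank ℂ E ∣ p' - p := by
    intro z hz
    apply pow_dvd_of_isBigO
    refine ((hp' z hz).sub (hp'' z hz)).congr_left fun w => ?_
    simp only [Polynomial.eval_sub]
    ring
  rw [← LinearMap.ker_eq_top, ← top_le_iff, ← Module.End.iSup_maxGenEigenspace_eq_top A]
  refine iSup_le fun z x hx => ?_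
  rw [LinearMap.mem_ker]
  by_cases h0 : x = 0
  · rw [h0, map_zero]
  have h1 := pow_finrank_apply hx
  obtain ⟨u, hu⟩ := key z (hasEigenvalue_of_mem h0 _ h1)
  rw [hu, mul_comm, map_mul, Module.End.mul_apply, map_pow, map_sub, Polynomial.aeval_X,
    Polynomial.aeval_C, h1, map_zero]

lemma finite_eigenvalues (A : Module.End ℂ E) : {z | A.HasEigenvalue z}.Finite :=
  Module.End.finite_hasEigenvalue A

end opFun

/-- Interpolation of a holomorphic function at finitely many points, to a given order. -/
lemma exists_interpolation (D : Finset ℂ) (N : ℕ) (f : ℂ → ℂ) (hf : ∀ z ∈ D, AnalyticAt ℂ f z) :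
    ∃ p : Polynomial ℂ, ∀ z ∈ D, (fun w => f w - p.eval w) =O[𝓝 z] fun w => (w - z) ^ N := by
  have h1 : ∀ z : D, ∃ p : Polynomial ℂ,
      (fun w => f w - p.eval w) =O[𝓝 z.1] fun w => (w - z.1) ^ N := by
    intro z
    obtain ⟨F, hF⟩ := hf z.1 z.2
    refine ⟨∑ k ∈ Finset.range N, Polynomial.C (F.coeff k) *
      (Polynomial.X - Polynomial.C z.1) ^ k, ?_⟩
    have h2 := hF.isBigO_sub_partialSum_pow N
    have h3 : Tendsto (fun w => w - z.1) (𝓝 z.1) (𝓝 0) := by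
      have : Continuous fun w : ℂ => w - z.1 := by fun_prop
      simpa using this.tendsto z.1
    have h4 := h2.comp_tendsto h3
    refine IsBigO.trans (h4.congr_left fun w => ?_) ?_
    · simp only [Function.comp_apply, add_sub_cancel, FormalMultilinearSeries.partialSum,
        Polynomial.eval_finsetSum]
      congr 1
      refine Finset.sum_congr rfl fun k _ => ?_
      simp [mul_comm]
    · exact IsBigO.of_norm_right (by simpa [Function.comp_def] using isBigO_refl _ _)
  choose p hp using h1
  have h2 : Pairwise fun i j : D => IsCoprime
      (Ideal.span {(Polynomial.X - Polynomial.C i.1) ^ N})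
      (Ideal.span {(Polynomial.X - Polynomial.C j.1) ^ N}) := by
    intro i j hij
    rw [Ideal.isCoprime_span_singleton_iff]
    refine IsCoprime.pow ?_
    exact Polynomial.pairwise_coprime_X_sub_C Function.injective_id
      (fun h => hij (Subtype.ext h))
  obtain ⟨r, hr⟩ := Ideal.exists_forall_sub_mem_ideal h2 p
  refine ⟨r, fun z hz => ?_⟩
  have h3 := hr ⟨z, hz⟩
  rw [Ideal.mem_span_singleton] at h3
  obtain ⟨u, hu⟩ := h3
  have h4 : (fun w => (r - p ⟨z, hz⟩).eval w) =O[𝓝 z] fun w => (w - z) ^ N := by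
    rw [hu]
    have h5 : (fun w : ℂ => u.eval w) =O[𝓝 z] fun _ => (1 : ℂ) :=
      (u.continuous.tendsto z).isBigO_one ℂ
    simpa using (isBigO_refl (fun w : ℂ => (w - z) ^ N) (𝓝 z)).mul h5
  refine ((hp ⟨z, hz⟩).sub h4).congr_left fun w => ?_
  simp

/-- The function `𝒢 / g`, where `𝒢 = (e^z q - 1) / (e^z - 1)` and `g = (z + log q) / z`. Its
singularities `0` and `-log q` on the real line are removable. -/
def lusztigFactor (q : ℝ) (z : ℂ) : ℂ :=
  ((Complex.exp z * q - 1) / (Complex.exp z - 1)) / ((z + Real.log q) / z)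

lemma exp_ne_one {z : ℂ} (h0 : z ≠ 0) (hz : z.im = 0) : Complex.exp z ≠ 1 := by
  intro h
  obtain ⟨x, rfl⟩ : ∃ x : ℝ, (x : ℂ) = z := ⟨z.re, Complex.ext (by simp) (by simp [hz])⟩
  have h2 : Real.exp x = 1 := by exact_mod_cast h
  rw [Real.exp_eq_one_iff] at h2
  exact h0 (by simp [h2])

/-- The entire function `(e^z - 1) / z`. -/
def expQuot : ℂ → ℂ := dslope Complex.exp 0

lemma expQuot_of_ne {z : ℂ} (h : z ≠ 0) : expQuot z = (Complex.exp z - 1) / z := by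
  rw [expQuot, dslope_of_ne _ h, slope_def_field]
  simp

lemma expQuot_ne_zero {z : ℂ} (hz : z.im = 0) : expQuot z ≠ 0 := by
  by_cases h0 : z = 0
  · subst h0
    rw [expQuot, dslope_same]
    simp
  · rw [expQuot_of_ne h0]
    exact div_ne_zero (sub_ne_zero.2 (exp_ne_one h0 hz)) h0

lemma expQuot_analytic (z : ℂ) : AnalyticAt ℂ expQuot z := by
  have h : Differentiable ℂ expQuot := by
    rw [← differentiableOn_univ]
    rw [expQuot, Complex.differentiableOn_dslope (by simp)]
    exact Complex.differentiable_exp.differentiableOn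
  exact h.analyticAt z

lemma lusztigFactor_eq {q : ℝ} (hq : 1 < q) {z : ℂ} (h0 : z ≠ 0) (h1 : z + Real.log q ≠ 0) :
    lusztigFactor q z = expQuot (z + Real.log q) / expQuot z := by
  rw [expQuot_of_ne h0, expQuot_of_ne h1, lusztigFactor, Complex.exp_add, ← Complex.ofReal_exp,
    Real.exp_log (by linarith)]
  by_cases h2 : Complex.exp z - 1 = 0
  · simp [h2]
  · field_simp

lemma exists_factor_interpolation {q : ℝ} (hq : 1 < q) (D : Finset ℂ) (hD : ∀ z ∈ D, z.im = 0)
    (N : ℕ) : ∃ p : Polynomial ℂ, ∀ z ∈ D, Agrees N (lusztigFactor q) p z := by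
  obtain ⟨p, hp⟩ := exists_interpolation D N
    (fun z => expQuot (z + Real.log q) / expQuot z) (fun z hz => by
      refine AnalyticAt.div ?_ (expQuot_analytic z) (expQuot_ne_zero (hD z hz))
      exact AnalyticAt.fun_comp (f := fun w : ℂ => w + Real.log q) (expQuot_analytic _) (by fun_prop))
  refine ⟨p, fun z hz => ?_⟩
  refine ((hp z hz).mono nhdsWithin_le_nhds).congr' ?_ EventuallyEq.rfl
  have h1 : ∀ a : ℂ, ∀ᶠ w in 𝓝[≠] z, w ≠ a := by
    intro a
    by_cases ha : a = z
    · rw [ha]; exact self_mem_nhdsWithin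
    · exact nhdsWithin_le_nhds (isOpen_ne.mem_nhds (Ne.symm ha))
  filter_upwards [h1 0, h1 (-Real.log q)] with w hw hw'
  rw [lusztigFactor_eq hq hw (fun h => hw' (eq_neg_of_add_eq_zero_left h))]
/-! ### Polynomials in commuting operators -/

section vanish

variable {n : ℕ}

/-- Some nonzero polynomial is zero at all points whose coordinates are not distinct. -/
lemma exists_distinct (n : ℕ) : ∃ Δ : MvPolynomial (Fin n) ℂ, Δ ≠ 0 ∧
    ∀ v : Fin n → ℂ, MvPolynomial.eval v Δ ≠ 0 → Function.Injective v := by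
  refine ⟨∏ p ∈ (Finset.univ : Finset (Fin n × Fin n)).filter (fun p => p.1 ≠ p.2),
    (MvPolynomial.X p.1 - MvPolynomial.X p.2), ?_, ?_⟩
  · rw [Finset.prod_ne_zero_iff]
    intro p hp
    rw [sub_ne_zero]
    exact fun h => (Finset.mem_filter.1 hp).2 (MvPolynomial.X_injective h)
  · intro v hv k l hkl
    by_contra hne
    rw [map_prod, Finset.prod_ne_zero_iff] at hv
    exact hv (k, l) (by simp [hne]) (by simp [hkl])

lemma eval_smul_of_isHomogeneous {H : MvPolynomial (Fin n) ℂ} {D : ℕ} (hH : H.IsHomogeneous D)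
    (s : ℂ) (v : Fin n → ℂ) :
    MvPolynomial.eval (s • v) H = s ^ D * MvPolynomial.eval v H := by
  rw [MvPolynomial.eval_eq', MvPolynomial.eval_eq', Finset.mul_sum]
  refine Finset.sum_congr rfl fun m hm => ?_
  have h1 : ∑ i, m i = D := by
    rw [← Finsupp.degree_eq_sum]
    have := hH (MvPolynomial.mem_support_iff.1 hm)
    rw [Finsupp.degree_eq_weight_one]
    exact this
  simp only [Pi.smul_apply, smul_eq_mul, mul_pow, Finset.prod_mul_distrib,
    Finset.prod_pow_eq_pow_sum, h1]
  ring

lemma coeff_eq_zero_of_isBigO {R : MvPolynomial (Fin n) ℂ} {N : ℕ}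
    (h : ∀ v : Fin n → ℂ, Function.Injective v →
      (fun s : ℂ => MvPolynomial.eval (s • v) R) =O[𝓝[≠] 0] fun s => s ^ N)
    (m : Fin n →₀ ℕ) (hm : m.degree < N) : MvPolynomial.coeff m R = 0 := by
  have key : ∀ v : Fin n → ℂ, Function.Injective v →
      MvPolynomial.eval v (MvPolynomial.homogeneousComponent m.degree R) = 0 := by
    intro v hv
    set r : Polynomial ℂ := ∑ D ∈ Finset.range (R.totalDegree + 1),
      Polynomial.C (MvPolynomial.eval v (MvPolynomial.homogeneousComponent D R)) *
        Polynomial.X ^ D with hr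
    have h1 : ∀ s : ℂ, r.eval s = MvPolynomial.eval (s • v) R := by
      intro s
      conv_rhs => rw [← MvPolynomial.sum_homogeneousComponent R]
      rw [hr, Polynomial.eval_finsetSum, map_sum]
      refine Finset.sum_congr rfl fun D _ => ?_
      rw [eval_smul_of_isHomogeneous (MvPolynomial.homogeneousComponent_isHomogeneous D R)]
      rw [Polynomial.eval_mul, Polynomial.eval_C, Polynomial.eval_pow, Polynomial.eval_X, mul_comm]
    have h2 := pow_dvd_of_isBigO (r := r) (z := 0) (N := N) (by simpa [h1] using h v hv)
    rw [Polynomial.C_0, sub_zero, Polynomial.X_pow_dvd_iff] at h2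
    have h3 := h2 _ hm
    rw [hr, Polynomial.finsetSum_coeff] at h3
    simp only [Polynomial.coeff_C_mul, Polynomial.coeff_X_pow, mul_ite, mul_one, mul_zero,
      Finset.sum_ite_eq, Finset.mem_range] at h3
    split_ifs at h3 with h4
    · exact h3
    · rw [MvPolynomial.homogeneousComponent_eq_zero _ _ (by omega), map_zero]
  obtain ⟨Δ, h0, hΔ⟩ := exists_distinct n
  have h1 : MvPolynomial.homogeneousComponent m.degree R * Δ = 0 := by
    refine MvPolynomial.funext fun v => ?_
    rw [map_mul, map_zero]
    by_cases hv : MvPolynomial.eval v Δ = 0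
    · rw [hv, mul_zero]
    · rw [key v (hΔ v hv), zero_mul]
  have h2 := (mul_eq_zero.1 h1).resolve_right h0
  have h3 := MvPolynomial.coeff_homogeneousComponent m.degree R m
  rw [h2, if_pos rfl] at h3
  simpa using h3.symm

variable {E : Type*} [AddCommGroup E] [Module ℂ E] [FiniteDimensional ℂ E]

/-- A polynomial in the commuting operators given by `a` is zero if it vanishes to a high order at
all the joint generalized eigenvalues of these operators. -/
lemma vanish (a : MvPolynomial (Fin n) ℂ →ₐ[ℂ] Module.End ℂ E) (R : MvPolynomial (Fin n) ℂ)
    (h : ∀ ζ : Fin n → ℂ,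
      (∃ x ≠ 0, ∀ k, x ∈ (a (MvPolynomial.X k)).maxGenEigenspace (ζ k)) →
      ∀ v : Fin n → ℂ, Function.Injective v →
      (fun s : ℂ => MvPolynomial.eval (ζ + s • v) R) =O[𝓝[≠] 0]
        fun s => s ^ (n * Module.finrank ℂ E + 1)) : a R = 0 := by
  have htop := Module.End.iSup_iInf_maxGenEigenspace_eq_top_of_forall_mapsTo
    (fun k : Fin n => a (MvPolynomial.X k))
    (fun i j φ => Module.End.mapsTo_maxGenEigenspace_of_comm
      ((Commute.all (MvPolynomial.X j : MvPolynomial (Fin n) ℂ) (MvPolynomial.X i)).map a) φ)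
    (fun i => Module.End.iSup_maxGenEigenspace_eq_top _)
  rw [← LinearMap.ker_eq_top, ← top_le_iff, ← htop]
  refine iSup_le fun ζ x hx => ?_
  rw [LinearMap.mem_ker]
  rw [Submodule.mem_iInf] at hx
  by_cases h0 : x = 0
  · rw [h0, map_zero]
  have hO := h ζ ⟨x, h0, hx⟩
  set R' : MvPolynomial (Fin n) ℂ :=
    MvPolynomial.aeval (fun k => MvPolynomial.X k + MvPolynomial.C (ζ k)) R with hR'
  have hev : ∀ w, MvPolynomial.eval w R' = MvPolynomial.eval (ζ + w) R := by
    intro w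
    rw [hR', MvPolynomial.aeval_def, ← MvPolynomial.coe_eval₂Hom, ← RingHom.comp_apply]
    congr 1
    refine MvPolynomial.ringHom_ext (fun c => ?_) (fun k => ?_)
    · simp
    · simp [add_comm]
  have hR : R = MvPolynomial.aeval (fun k => MvPolynomial.X k - MvPolynomial.C (ζ k)) R' := by
    rw [hR', ← AlgHom.comp_apply]
    have : (MvPolynomial.aeval (fun k => MvPolynomial.X k - MvPolynomial.C (ζ k))).comp
        (MvPolynomial.aeval (fun k => MvPolynomial.X k + MvPolynomial.C (ζ k))) =
        AlgHom.id ℂ (MvPolynomial (Fin n) ℂ) := by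
      refine MvPolynomial.algHom_ext fun k => ?_
      simp [MvPolynomial.algHom_C]
    rw [this]; rfl
  have hcoeff := coeff_eq_zero_of_isBigO (R := R') (N := n * Module.finrank ℂ E + 1)
    (fun v hv => by simpa only [hev] using hO v hv)
  rw [hR, MvPolynomial.as_sum R', map_sum, map_sum, LinearMap.sum_apply]
  refine Finset.sum_eq_zero fun m hm => ?_
  have hdeg : n * Module.finrank ℂ E < m.degree := by
    by_contra hlt
    exact (MvPolynomial.mem_support_iff.1 hm) (hcoeff m (by omega))
  obtain ⟨k, hk⟩ : ∃ k, Module.finrank ℂ E ≤ m k := by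
    by_contra hall
    push Not at hall
    have : m.degree ≤ n * Module.finrank ℂ E := by
      rw [Finsupp.degree_eq_sum]
      calc ∑ i, m i ≤ ∑ _i : Fin n, Module.finrank ℂ E :=
            Finset.sum_le_sum fun i _ => (hall i).le
        _ = _ := by simp
    omega
  rw [MvPolynomial.aeval_monomial, Finsupp.prod_fintype _ _ (by simp),
    ← Finset.mul_prod_erase _ _ (Finset.mem_univ k)]
  obtain ⟨e, he⟩ := Nat.exists_eq_add_of_le hk
  rw [he, pow_add, mul_assoc, mul_left_comm, mul_comm, map_mul, Module.End.mul_apply, map_pow]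
  have := pow_finrank_apply (hx k)
  rw [map_sub]
  have e2 : a (MvPolynomial.C (ζ k)) = algebraMap ℂ _ (ζ k) := a.commutes _
  rw [e2, this, map_zero]

end vanish
/-! ### The operators of the affine Hecke algebra on a module of the graded Hecke algebra -/

namespace GradedHecke

variable {q : ℝ} {n : ℕ}

open MvPolynomial in
lemma poly_t_aux (j : Fin (n - 1)) (p : MvPolynomial (Fin n) ℂ) :
    ∃ d, (X (lo j) - X (hi j)) * d = p - rename (simpleRefl j) p ∧
      (poly p * t (simpleRefl j) - t (simpleRefl j) * poly (rename (simpleRefl j) p) :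
        GradedHecke q n) = (Real.log q : ℂ) • poly d := by
  induction p using MvPolynomial.induction_on with
  | C c =>
    refine ⟨0, by simp, ?_⟩
    rw [rename_C, poly_scalar, Algebra.commutes, sub_self]
    rw [← polyHom_apply, map_zero, smul_zero]
  | add p p' hp hp' =>
    obtain ⟨d, h1, h2⟩ := hp
    obtain ⟨d', h1', h2'⟩ := hp'
    refine ⟨d + d', ?_, ?_⟩
    · rw [map_add]; linear_combination h1 + h1'
    · rw [map_add, poly_add, poly_add, poly_add, smul_add, ← h2, ← h2']
      noncomm_ring
  | mul_X p k hp =>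
    obtain ⟨d, h1, h2⟩ := hp
    set e : ℂ := (if k = lo j then 1 else 0) - (if k = hi j then 1 else 0) with he
    have h3 := t_cross (q := q) j k
    rw [← he] at h3
    have h4 : (X (lo j) - X (hi j)) * C e = (X k - X (simpleRefl j k) : MvPolynomial (Fin n) ℂ) := by
      rw [he, simpleRefl]
      by_cases h5 : k = lo j
      · rw [h5, Equiv.swap_apply_left]; simp [lo_ne_hi]
      · by_cases h6 : k = hi j
        · rw [h6, Equiv.swap_apply_right]; simp [(lo_ne_hi j).symm]
        · rw [Equiv.swap_apply_of_ne_of_ne h5 h6]; simp [h5, h6]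
    refine ⟨d * X (simpleRefl j k) + p * C e, ?_, ?_⟩
    · rw [map_mul, rename_X]
      linear_combination h1 * X (simpleRefl j k) + p * h4
    · rw [map_mul, rename_X, poly_mul, poly_mul, poly_add, poly_mul, poly_mul, poly_scalar,
        smul_add, ← smul_mul_assoc, ← h2, ← mul_smul_comm, Algebra.smul_def, ← map_mul, ← h3]
      noncomm_ring

lemma X_sub_X_ne_zero (j : Fin (n - 1)) :
    (MvPolynomial.X (lo j) - MvPolynomial.X (hi j) : MvPolynomial (Fin n) ℂ) ≠ 0 :=
  sub_ne_zero.2 fun h => lo_ne_hi j (MvPolynomial.X_injective h)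

lemma poly_t (j : Fin (n - 1)) (p d : MvPolynomial (Fin n) ℂ)
    (h : (MvPolynomial.X (lo j) - MvPolynomial.X (hi j)) * d =
      p - MvPolynomial.rename (simpleRefl j) p) :
    (poly p * t (simpleRefl j) : GradedHecke q n) =
      t (simpleRefl j) * poly (MvPolynomial.rename (simpleRefl j) p) +
        (Real.log q : ℂ) • poly d := by
  obtain ⟨d', h1, h2⟩ := poly_t_aux (q := q) j p
  obtain rfl : d = d' := mul_left_cancel₀ (X_sub_X_ne_zero j) (h.trans h1.symm)
  rw [← h2]
  abel

end GradedHecke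

section core

open MvPolynomial (X C rename)

lemma transfer {m M : ℕ} (hM : 1 ≤ M) (K : (Fin m → ℂ) → ℂ) (hK : ContDiff ℂ 1 K)
    (f g : ℂ → Fin m → ℂ) (hf : ∀ i, Continuous fun s => f s i)
    (hfg : ∀ i, (fun s => g s i - f s i) =O[𝓝[≠] 0] fun s => s ^ M)
    (h0 : ∀ᶠ s in 𝓝[≠] 0, K (g s) = 0) :
    (fun s => K (f s)) =O[𝓝[≠] 0] fun s => s ^ M := by
  have hfc : Continuous f := continuous_pi hf
  have hft : Tendsto f (𝓝[≠] 0) (𝓝 (f 0)) := (hfc.tendsto 0).mono_left nhdsWithin_le_nhds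
  have hd : (fun s => g s - f s) =O[𝓝[≠] 0] fun s => s ^ M := by
    rw [isBigO_pi]
    exact hfg
  have hp : Tendsto (fun s : ℂ => s ^ M) (𝓝[≠] 0) (𝓝 0) := by
    have : Continuous fun s : ℂ => s ^ M := by fun_prop
    have h5 := this.tendsto 0
    simp only [zero_pow (by omega : M ≠ 0)] at h5
    exact h5.mono_left nhdsWithin_le_nhds
  have hgt : Tendsto g (𝓝[≠] 0) (𝓝 (f 0)) := by
    have := (hd.trans_tendsto hp).add hft
    simpa using this
  have hs := (hK.contDiffAt (x := f 0)).hasStrictFDerivAt (by simp)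
  have h1 := hs.isBigO_sub.comp_tendsto (hgt.prodMk_nhds hft)
  have h2 : (fun s => K (g s) - K (f s)) =O[𝓝[≠] 0] fun s => s ^ M := h1.trans hd
  refine (h2.neg_left).congr' ?_ EventuallyEq.rfl
  filter_upwards [h0] with s hs
  rw [hs]; ring

variable {n : ℕ}

lemma path_tendsto (ζ v : Fin n → ℂ) (k l : Fin n) :
    Tendsto (fun s : ℂ => (ζ + s • v) k - (ζ + s • v) l) (𝓝[≠] 0) (𝓝 (ζ k - ζ l)) := by
  have : Continuous fun s : ℂ => (ζ + s • v) k - (ζ + s • v) l := by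
    simp only [Pi.add_apply, Pi.smul_apply, smul_eq_mul]; fun_prop
  simpa using (this.tendsto 0).mono_left (nhdsWithin_le_nhds (s := {0}ᶜ))

lemma path_ne (ζ v : Fin n → ℂ) (hv : Function.Injective v) {k l : Fin n} (hkl : k ≠ l) (c : ℂ) :
    ∀ᶠ s in 𝓝[≠] (0 : ℂ), (ζ + s • v) k - (ζ + s • v) l ≠ c := by
  have hvkl : v k - v l ≠ 0 := sub_ne_zero.2 fun h => hkl (hv h)
  by_cases h : ζ k - ζ l = c
  · filter_upwards [self_mem_nhdsWithin] with s hs h1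
    simp only [Pi.add_apply, Pi.smul_apply, smul_eq_mul] at h1
    have h2 : s * (v k - v l) = 0 := by linear_combination h1 - h
    exact (mul_ne_zero hs hvkl) h2
  · exact (path_tendsto ζ v k l).eventually_ne h

lemma path_tendsto' (ζ v : Fin n → ℂ) (hv : Function.Injective v) {k l : Fin n} (hkl : k ≠ l) :
    Tendsto (fun s : ℂ => (ζ + s • v) k - (ζ + s • v) l) (𝓝[≠] 0) (𝓝[≠] (ζ k - ζ l)) :=
  tendsto_nhdsWithin_iff.2 ⟨path_tendsto ζ v k l, path_ne ζ v hv hkl _⟩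

lemma div_isBigO (ζ v : Fin n → ℂ) (hv : Function.Injective v) {k l : Fin n} (hkl : k ≠ l) {M : ℕ}
    {r : ℂ → ℂ} (h : (fun s => ((ζ + s • v) k - (ζ + s • v) l) * r s) =O[𝓝[≠] 0]
      fun s => s ^ (M + 1)) : r =O[𝓝[≠] 0] fun s => s ^ M := by
  have hvkl : v k - v l ≠ 0 := sub_ne_zero.2 fun h => hkl (hv h)
  have h1 : (fun s : ℂ => s) =O[𝓝[≠] 0] fun s => (ζ + s • v) k - (ζ + s • v) l := by
    by_cases hζ : ζ k - ζ l = 0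
    · have : (fun s : ℂ => (ζ + s • v) k - (ζ + s • v) l) = fun s => (v k - v l) * s := by
        funext s
        simp only [Pi.add_apply, Pi.smul_apply, smul_eq_mul]
        linear_combination hζ
      rw [this]
      exact (isBigO_self_const_mul hvkl _ _)
    · have h2 : (fun s : ℂ => s) =O[𝓝[≠] 0] fun _ => (1 : ℂ) :=
        ((continuous_id.tendsto (0 : ℂ)).mono_left nhdsWithin_le_nhds).isBigO_one ℂ
      have h3 : (fun _ : ℂ => (1 : ℂ)) =O[𝓝[≠] 0] fun s => (ζ + s • v) k - (ζ + s • v) l := by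
        have h4 := (((path_tendsto ζ v k l).inv₀ hζ).isBigO_one ℂ).mul (isBigO_refl
          (fun s : ℂ => (ζ + s • v) k - (ζ + s • v) l) (𝓝[≠] 0))
        refine h4.congr' ?_ ?_
        · filter_upwards [path_ne ζ v hv hkl 0] with s hs
          rw [inv_mul_cancel₀ hs]
        · exact Eventually.of_forall fun s => one_mul _
      exact h2.trans h3
  have h2 : (fun s => ((ζ + s • v) k - (ζ + s • v) l) * r s) =O[𝓝[≠] 0]
      fun s => ((ζ + s • v) k - (ζ + s • v) l) * s ^ M := by
    refine h.trans ?_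
    simp only [pow_succ']
    exact h1.mul (isBigO_refl _ _)
  have h3 := (isBigO_refl
    (fun s : ℂ => ((ζ + s • v) k - (ζ + s • v) l)⁻¹) (𝓝[≠] 0)).mul h2
  refine h3.congr' ?_ ?_
  · filter_upwards [path_ne ζ v hv hkl 0] with s hs
    rw [inv_mul_cancel_left₀ hs]
  · filter_upwards [path_ne ζ v hv hkl 0] with s hs
    rw [inv_mul_cancel_left₀ hs]

/-- The polynomial `P(ε_k - ε_l)`. -/
def diffPoly (P : Polynomial ℂ) (k l : Fin n) : MvPolynomial (Fin n) ℂ :=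
  Polynomial.aeval (X k - X l) P

lemma eval_aeval (P : Polynomial ℂ) (r : MvPolynomial (Fin n) ℂ) (z : Fin n → ℂ) :
    MvPolynomial.eval z (Polynomial.aeval r P) = P.eval (MvPolynomial.eval z r) := by
  have := Polynomial.aeval_algHom_apply (MvPolynomial.aeval z : MvPolynomial (Fin n) ℂ →ₐ[ℂ] ℂ) r P
  rw [Polynomial.coe_aeval_eq_eval] at this
  simpa [MvPolynomial.coe_aeval_eq_eval] using this.symm

lemma eval_diffPoly (P : Polynomial ℂ) (k l : Fin n) (z : Fin n → ℂ) :
    MvPolynomial.eval z (diffPoly P k l) = P.eval (z k - z l) := by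
  rw [diffPoly, eval_aeval]; simp

lemma rename_diffPoly (P : Polynomial ℂ) (g : Fin n → Fin n) (k l : Fin n) :
    rename g (diffPoly P k l) = diffPoly P (g k) (g l) := by
  rw [diffPoly, diffPoly, ← Polynomial.aeval_algHom_apply]
  simp

lemma continuous_path_eval (ζ v : Fin n → ℂ) (R : MvPolynomial (Fin n) ℂ) :
    Continuous fun s : ℂ => MvPolynomial.eval (ζ + s • v) R :=
  (MvPolynomial.continuous_eval R).comp (by fun_prop)

lemma diffPoly_isBigO {f : ℂ → ℂ} {P : Polynomial ℂ} {M : ℕ} (ζ v : Fin n → ℂ)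
    (hv : Function.Injective v) {k l : Fin n} (hkl : k ≠ l) (hP : Agrees M f P (ζ k - ζ l)) :
    (fun s : ℂ => f ((ζ + s • v) k - (ζ + s • v) l) -
      MvPolynomial.eval (ζ + s • v) (diffPoly P k l)) =O[𝓝[≠] 0] fun s => s ^ M := by
  simp only [eval_diffPoly]
  have h1 := hP.comp_tendsto (path_tendsto' ζ v hv hkl)
  refine h1.trans ?_
  have : ∀ s : ℂ, (ζ + s • v) k - (ζ + s • v) l - (ζ k - ζ l) = (v k - v l) * s := by
    intro s
    simp only [Pi.add_apply, Pi.smul_apply, smul_eq_mul]; ring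
  simp only [Function.comp_def, this, mul_pow]
  exact isBigO_const_mul_self _ _ _

end core
section rep

open MvPolynomial (X C rename)

variable {q : ℝ} {n : ℕ} {E : Type*} [AddCommGroup E] [Module ℂ E]

/-- The differences of the commuting operators have real eigenvalues. -/
def RealDiff (ρ : GradedHecke q n →ₐ[ℂ] Module.End ℂ E) : Prop :=
  ∀ (k l : Fin n) (z : ℂ), (ρ (GradedHecke.poly (X k - X l))).HasEigenvalue z → z.im = 0

/-- The operator `T_j` on a module of the graded Hecke algebra: `(t_j + 1) g⁻¹ 𝒢 - 1`, where
`g⁻¹ 𝒢` is the function `lusztigFactor` of the simple root `α_j = ε_j - ε_{j+1}`. -/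
def lusztigT (ρ : GradedHecke q n →ₐ[ℂ] Module.End ℂ E) (j : Fin (n - 1)) : Module.End ℂ E :=
  (ρ (GradedHecke.t (simpleRefl j)) + 1) *
    opFun (lusztigFactor q) (ρ (GradedHecke.poly (X (lo j) - X (hi j)))) - 1

/-- An element `x` of the lattice `ℤ^n`, as a linear polynomial in the basis `ε_1, …, ε_n`. -/
def linForm {n : ℕ} (x : Fin n →₀ ℤ) : MvPolynomial (Fin n) ℂ := ∑ k, C (x k : ℂ) * X k

/-- The operator `θ_x` on a module of the graded Hecke algebra: the exponential of `x`. -/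
def lusztigX (ρ : GradedHecke q n →ₐ[ℂ] Module.End ℂ E) (x : Fin n →₀ ℤ) : Module.End ℂ E :=
  opFun Complex.exp (ρ (GradedHecke.poly (linForm x)))

/-- A finite set of points, stable under permutations, that contains the joint eigenvalues. -/
def points (ρ : GradedHecke q n →ₐ[ℂ] Module.End ℂ E) : Set (Fin n → ℂ) :=
  {ζ | (∀ k, ∃ l, (ρ (GradedHecke.poly (X l))).HasEigenvalue (ζ k)) ∧
    ∀ k l, (ζ k - ζ l).im = 0}

variable (ρ : GradedHecke q n →ₐ[ℂ] Module.End ℂ E)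

lemma points_finite [FiniteDimensional ℂ E] : (points ρ).Finite := by
  have h : (⋃ l, {z | (ρ (GradedHecke.poly (X l))).HasEigenvalue z}).Finite :=
    Set.finite_iUnion fun l => finite_eigenvalues _
  refine (Set.Finite.pi' (fun _ : Fin n => h)).subset fun ζ hζ k => ?_
  exact Set.mem_iUnion.2 (hζ.1 k)

lemma points_comp {ζ : Fin n → ℂ} (hζ : ζ ∈ points ρ) (g : Fin n → Fin n) : ζ ∘ g ∈ points ρ :=
  ⟨fun k => hζ.1 (g k), fun k l => hζ.2 (g k) (g l)⟩

/-- Joint generalized eigenvectors for `ε_k` and `ε_l` are generalized eigenvectors for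
`ε_k - ε_l`. -/
lemma sub_pow_apply [FiniteDimensional ℂ E] (k l : Fin n) (z w : ℂ) {x : E}
    (hk : x ∈ (ρ (GradedHecke.poly (X k))).maxGenEigenspace z)
    (hl : x ∈ (ρ (GradedHecke.poly (X l))).maxGenEigenspace w) :
    ((ρ (GradedHecke.poly (X k - X l)) - algebraMap ℂ _ (z - w)) ^
      (Module.finrank ℂ E + Module.finrank ℂ E)) x = 0 := by
  set a := ρ.comp GradedHecke.polyHom
  have hC : ∀ c : ℂ, a (C c) = algebraMap ℂ _ c := fun c => a.commutes c
  have hk' := pow_finrank_apply hk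
  have hl' := pow_finrank_apply hl
  set d := Module.finrank ℂ E
  set I : Ideal (MvPolynomial (Fin n) ℂ) := Ideal.span {(X k - C z) ^ d, (C w - X l) ^ d}
  have hI : ∀ p ∈ I, a p x = 0 := by
    intro p hp
    obtain ⟨u, v, rfl⟩ := Ideal.mem_span_pair.1 hp
    have h1 : a ((X k - C z) ^ d) x = 0 := by
      rw [map_pow, map_sub, hC]; exact hk'
    have h2 : a ((C w - X l) ^ d) x = 0 := by
      have : (C w - X l : MvPolynomial (Fin n) ℂ) ^ d = (-1) ^ d * (X l - C w) ^ d := by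
        rw [← mul_pow]; congr 1; ring
      rw [this, map_mul, map_pow a (X l - C w), map_sub, hC, Module.End.mul_apply]
      erw [hl']
      rw [map_zero]
    rw [map_add, map_mul, map_mul, LinearMap.add_apply, Module.End.mul_apply, Module.End.mul_apply,
      h1, h2, map_zero, map_zero, add_zero]
  have h3 : ((X k - C z) + (C w - X l)) ^ (d + d) ∈ I :=
    Ideal.add_pow_mem_of_pow_mem_of_le I (m := d) (n := d) (Ideal.subset_span (by simp))
      (Ideal.subset_span (by simp)) (by omega)
  have h4 := hI _ h3
  rw [map_pow] at h4
  convert h4 using 3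
  have h5 : (X k - C z) + (C w - X l) = (X k - X l : MvPolynomial (Fin n) ℂ) - C (z - w) := by
    rw [map_sub]; ring
  rw [h5, map_sub a, hC]
  rfl

lemma mem_points [FiniteDimensional ℂ E] (hρ : RealDiff ρ) {ζ : Fin n → ℂ}
    (h : ∃ x ≠ 0, ∀ k, x ∈ (ρ (GradedHecke.poly (X k))).maxGenEigenspace (ζ k)) :
    ζ ∈ points ρ := by
  obtain ⟨x, h0, hx⟩ := h
  exact ⟨fun k => ⟨k, hasEigenvalue_of_mem h0 _ (pow_finrank_apply (hx k))⟩, fun k l =>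
    hρ k l _ (hasEigenvalue_of_mem h0 _ (sub_pow_apply ρ k l _ _ (hx k) (hx l)))⟩

/-- The order of vanishing that makes a polynomial act by zero. -/
def bigOrder (n : ℕ) (E : Type*) [AddCommGroup E] [Module ℂ E] : ℕ := n * Module.finrank ℂ E + 1

/-- `R` represents the function `F` near the points, to the order `M`. -/
def Represents (M : ℕ) (F : (Fin n → ℂ) → ℂ) (R : MvPolynomial (Fin n) ℂ) : Prop :=
  ∀ ζ ∈ points ρ, ∀ v : Fin n → ℂ, Function.Injective v →
    (fun s : ℂ => F (ζ + s • v) - MvPolynomial.eval (ζ + s • v) R) =O[𝓝[≠] 0] fun s => s ^ M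

lemma act_eq_zero [FiniteDimensional ℂ E] (hρ : RealDiff ρ) {R : MvPolynomial (Fin n) ℂ}
    (h : Represents ρ (bigOrder n E) (fun _ => 0) R) : ρ (GradedHecke.poly R) = 0 := by
  refine vanish (ρ.comp GradedHecke.polyHom) R fun ζ hζ v hv => ?_
  have h1 := h ζ (mem_points ρ hρ hζ) v hv
  simp only [zero_sub] at h1
  exact (isBigO_neg_left.1 h1)

lemma Represents.sub {M : ℕ} {F G : (Fin n → ℂ) → ℂ} {R S : MvPolynomial (Fin n) ℂ}
    (h : Represents ρ M F R) (h' : Represents ρ M G S) :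
    Represents ρ M (fun z => F z - G z) (R - S) := by
  intro ζ hζ v hv
  refine ((h ζ hζ v hv).sub (h' ζ hζ v hv)).congr_left fun s => ?_
  rw [map_sub]; ring

lemma Represents.add {M : ℕ} {F G : (Fin n → ℂ) → ℂ} {R S : MvPolynomial (Fin n) ℂ}
    (h : Represents ρ M F R) (h' : Represents ρ M G S) :
    Represents ρ M (fun z => F z + G z) (R + S) := by
  intro ζ hζ v hv
  refine ((h ζ hζ v hv).add (h' ζ hζ v hv)).congr_left fun s => ?_
  rw [map_add]; ring

lemma Represents.smul {M : ℕ} {F : (Fin n → ℂ) → ℂ} {R : MvPolynomial (Fin n) ℂ} (c : ℂ)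
    (h : Represents ρ M F R) : Represents ρ M (fun z => c * F z) (c • R) := by
  intro ζ hζ v hv
  refine ((h ζ hζ v hv).const_mul_left c).congr_left fun s => ?_
  rw [MvPolynomial.smul_eval]; ring

lemma Represents.rename {M : ℕ} {F : (Fin n → ℂ) → ℂ} {R : MvPolynomial (Fin n) ℂ}
    (h : Represents ρ M F R) (w : Equiv.Perm (Fin n)) :
    Represents ρ M (fun z => F (z ∘ w)) (MvPolynomial.rename w R) := by
  intro ζ hζ v hv
  refine (h (ζ ∘ w) (points_comp ρ hζ w) (v ∘ w) (hv.comp w.injective)).congr_left fun s => ?_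
  rw [MvPolynomial.eval_rename]
  rfl

/-- A polynomial that can be used to compute all the operators `T_j`. -/
structure GoodPoly (M : ℕ) (P : Polynomial ℂ) : Prop where
  pts : ∀ ζ ∈ points ρ, ∀ k l, Agrees M (lusztigFactor q) P (ζ k - ζ l)
  eig : ∀ k l z, (ρ (GradedHecke.poly (X k - X l))).HasEigenvalue z →
    Agrees M (lusztigFactor q) P z

lemma exists_goodPoly [FiniteDimensional ℂ E] (hq : 1 < q) (hρ : RealDiff ρ) (M : ℕ) : ∃ P, GoodPoly ρ M P := by
  have h1 : (⋃ k : Fin n, ⋃ l : Fin n, (fun ζ : Fin n → ℂ => ζ k - ζ l) '' points ρ).Finite :=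
    Set.finite_iUnion fun k => Set.finite_iUnion fun l => (points_finite ρ).image _
  have h2 : (⋃ k : Fin n, ⋃ l : Fin n,
      {z | (ρ (GradedHecke.poly (X k - X l))).HasEigenvalue z}).Finite :=
    Set.finite_iUnion fun k => Set.finite_iUnion fun l => finite_eigenvalues _
  obtain ⟨P, hP⟩ := exists_factor_interpolation hq (h1.union h2).toFinset (by
    intro z hz
    simp only [Set.Finite.mem_toFinset, Set.mem_union, Set.mem_iUnion, Set.mem_image,
      Set.mem_ofPred_eq] at hz
    rcases hz with ⟨k, l, ζ, hζ, rfl⟩ | ⟨k, l, hz⟩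
    · exact hζ.2 k l
    · exact hρ k l z hz) M
  refine ⟨P, fun ζ hζ k l => hP _ ?_, fun k l z hz => hP _ ?_⟩
  · simp only [Set.Finite.mem_toFinset, Set.mem_union, Set.mem_iUnion, Set.mem_image]
    exact Or.inl ⟨k, l, ζ, hζ, rfl⟩
  · simp only [Set.Finite.mem_toFinset, Set.mem_union, Set.mem_iUnion, Set.mem_ofPred_eq]
    exact Or.inr ⟨k, l, hz⟩

lemma finrank_le_bigOrder (j : Fin (n - 1)) : Module.finrank ℂ E ≤ bigOrder n E := by
  have := j.2
  have h : 1 ≤ n := by omega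
  unfold bigOrder
  nlinarith [Nat.zero_le (Module.finrank ℂ E)]

variable {ρ} in
lemma GoodPoly.opFun [FiniteDimensional ℂ E] {M : ℕ} {P : Polynomial ℂ} (h : GoodPoly ρ M P) (hM : bigOrder n E ≤ M)
    (j : Fin (n - 1)) :
    BZ.opFun (lusztigFactor q) (ρ (GradedHecke.poly (X (lo j) - X (hi j)))) =
      ρ (GradedHecke.poly (diffPoly P (lo j) (hi j))) := by
  rw [opFun_eq ((finrank_le_bigOrder j).trans hM) (h.eig (lo j) (hi j))]
  exact Polynomial.aeval_algHom_apply (ρ.comp GradedHecke.polyHom) _ _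

variable {ρ} in
lemma GoodPoly.represents {M : ℕ} {P : Polynomial ℂ} (h : GoodPoly ρ M P) {k l : Fin n}
    (hkl : k ≠ l) :
    Represents ρ M (fun z => lusztigFactor q (z k - z l)) (diffPoly P k l) := fun ζ hζ v hv =>
  diffPoly_isBigO ζ v hv hkl (h.pts ζ hζ k l)

end rep
/-! ### The defining relations of the affine Hecke algebra -/

section relations

open MvPolynomial (X C rename)

variable {q : ℝ} {n : ℕ} {E : Type*} [AddCommGroup E] [Module ℂ E]
  (ρ : GradedHecke q n →ₐ[ℂ] Module.End ℂ E)

/-- The action of polynomials. -/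
def act : MvPolynomial (Fin n) ℂ →ₐ[ℂ] Module.End ℂ E := ρ.comp GradedHecke.polyHom

/-- The operator `t_s` for a simple reflection. -/
def tOp (j : Fin (n - 1)) : Module.End ℂ E := ρ (GradedHecke.t (simpleRefl j))

lemma simpleRefl_mul_self (j : Fin (n - 1)) : simpleRefl j * simpleRefl j = 1 :=
  Equiv.swap_mul_self _ _

lemma tOp_mul_self (j : Fin (n - 1)) : tOp ρ j * tOp ρ j = 1 := by
  rw [tOp, ← map_mul, ← GradedHecke.t_mul, simpleRefl_mul_self, GradedHecke.t_one, map_one]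

lemma act_tOp (j : Fin (n - 1)) (p d : MvPolynomial (Fin n) ℂ)
    (h : (X (lo j) - X (hi j)) * d = p - rename (simpleRefl j) p) :
    act ρ p * tOp ρ j = tOp ρ j * act ρ (rename (simpleRefl j) p) +
      act ρ ((Real.log q : ℂ) • d) := by
  rw [map_smul]
  have := congrArg ρ (GradedHecke.poly_t (q := q) j p d h)
  rw [map_mul, map_add, map_mul, map_smul] at this
  exact this

lemma act_tOp_of_symm (j : Fin (n - 1)) (p : MvPolynomial (Fin n) ℂ)
    (h : rename (simpleRefl j) p = p) : act ρ p * tOp ρ j = tOp ρ j * act ρ p := by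
  have := act_tOp ρ j p 0 (by rw [h]; ring)
  rwa [h, smul_zero, map_zero, add_zero] at this

lemma sandwich (j : Fin (n - 1)) (p d : MvPolynomial (Fin n) ℂ)
    (h : (X (lo j) - X (hi j)) * d = p - rename (simpleRefl j) p) :
    (tOp ρ j + 1) * act ρ p * (tOp ρ j + 1) = (tOp ρ j + 1) *
      act ρ (p + rename (simpleRefl j) p + (Real.log q : ℂ) • d) := by
  have h1 := act_tOp ρ j p d h
  have h2 := tOp_mul_self ρ j
  rw [mul_assoc, mul_add, h1, mul_one, map_add, map_add, add_mul (tOp ρ j), add_mul (tOp ρ j)]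
  rw [mul_add (tOp ρ j), mul_add (tOp ρ j), ← mul_assoc, h2]
  noncomm_ring

lemma exists_divided_difference (j : Fin (n - 1)) (p : MvPolynomial (Fin n) ℂ) :
    ∃ d, (X (lo j) - X (hi j)) * d = p - rename (simpleRefl j) p := by
  obtain ⟨d, hd, -⟩ := GradedHecke.poly_t_aux (q := 1) j p
  exact ⟨d, hd⟩

lemma rename_simpleRefl_lo (j : Fin (n - 1)) : simpleRefl j (lo j) = hi j :=
  Equiv.swap_apply_left _ _

lemma rename_simpleRefl_hi (j : Fin (n - 1)) : simpleRefl j (hi j) = lo j :=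
  Equiv.swap_apply_right _ _

lemma log_ne_zero (hq : 1 < q) : (Real.log q : ℂ) ≠ 0 := by
  exact_mod_cast (Real.log_pos hq).ne'

/-- The identity behind the quadratic relation. -/
lemma factor_quad (y : ℂ) (h1 : Complex.exp y ≠ 1) (h2 : y + Real.log q ≠ 0)
    (h3 : -y + Real.log q ≠ 0) :
    y * (lusztigFactor q y + lusztigFactor q (-y) - (q + 1)) +
      Real.log q * (lusztigFactor q y - lusztigFactor q (-y)) = 0 := by
  unfold lusztigFactor
  rw [Complex.exp_neg]
  have h4 := Complex.exp_ne_zero y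
  generalize Complex.exp y = A at *
  generalize (Real.log q : ℂ) = c at *
  have h5 : A - 1 ≠ 0 := sub_ne_zero.2 h1
  have h6 : A⁻¹ - 1 ≠ 0 := by
    rw [sub_ne_zero]
    intro h
    exact h1 (by rw [← inv_inv A, h, inv_one])
  have h7 : A⁻¹ - 1 = -(A - 1) / A := by field_simp; ring
  rw [h7]
  have h8 : -(A - 1) ≠ 0 := neg_ne_zero.2 h5
  have h9 : c - y ≠ 0 := by intro h; apply h3; linear_combination h
  have h9' : (-y + c) = (c - y) := by ring
  rw [h9']
  field_simp
  ring

/-- The identity behind the braid relation. -/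
lemma factor_braid (x y : ℂ) (ex : Complex.exp x ≠ 1) (ey : Complex.exp y ≠ 1) (exy : Complex.exp (x + y) ≠ 1)
    (lx : x + Real.log q ≠ 0) (ly : y + Real.log q ≠ 0) (lxy : x + y + Real.log q ≠ 0)
    (lx' : -x + Real.log q ≠ 0) :
    x * y * (x + y) * (lusztigFactor q (x + y) * lusztigFactor q y - q) +
      (x + Real.log q) * (x + y) * (y + Real.log q) *
        (lusztigFactor q x - lusztigFactor q (x + y)) * lusztigFactor q y +
      (x - Real.log q) * y * (x + y + Real.log q) *
        (lusztigFactor q (-x) - lusztigFactor q y) * lusztigFactor q (x + y) = 0 := by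
  unfold lusztigFactor
  rw [Complex.exp_add] at *
  rw [Complex.exp_neg]
  have h4 := Complex.exp_ne_zero x
  have h4' := Complex.exp_ne_zero y
  generalize Complex.exp x = A at *
  generalize Complex.exp y = B at *
  generalize (Real.log q : ℂ) = c at *
  have h5 : A - 1 ≠ 0 := sub_ne_zero.2 ex
  have h5' : B - 1 ≠ 0 := sub_ne_zero.2 ey
  have h5'' : A * B - 1 ≠ 0 := sub_ne_zero.2 exy
  have h7 : A⁻¹ - 1 = -(A - 1) / A := by field_simp; ring
  rw [h7]
  have h9 : c - x ≠ 0 := by intro h; apply lx'; linear_combination h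
  have h9' : (-x + c) = (c - x) := by ring
  rw [h9']
  field_simp
  ring

/-- The identity behind the relation between `T_j` and Laurent polynomials. -/
lemma factor_cross (z w F F' g : ℂ) (h0 : z - w ≠ 0) (h1 : Complex.exp (z - w) ≠ 1)
    (h2 : (z - w) + Real.log q ≠ 0)
    (h : (Complex.exp z - Complex.exp w) * g = F - F') :
    (z - w) * ((lusztigFactor q (z - w) - 1) * (F - F') - (q - 1) * (Complex.exp z * g)) +
      Real.log q * ((F - F') * lusztigFactor q (z - w)) = 0 := by
  rw [← h]
  obtain ⟨y, rfl⟩ : ∃ y, z = y + w := ⟨z - w, by ring⟩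
  rw [add_sub_cancel_right] at *
  unfold lusztigFactor
  rw [Complex.exp_add]
  have h4 := Complex.exp_ne_zero w
  generalize Complex.exp y = A at *
  generalize Complex.exp w = B at *
  generalize (Real.log q : ℂ) = c at *
  have h5 : A - 1 ≠ 0 := sub_ne_zero.2 h1
  field_simp
  ring

lemma real_path_ne {ζ v : Fin n → ℂ} (hv : Function.Injective v) {k l : Fin n} (hkl : k ≠ l)
    (hζ : (ζ k - ζ l).im = 0) :
    ∀ᶠ s in 𝓝[≠] (0 : ℂ), Complex.exp ((ζ + s • v) k - (ζ + s • v) l) ≠ 1 := by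
  by_cases h : ζ k - ζ l = 0
  · have h1 : ∀ᶠ y in 𝓝[≠] (0 : ℂ), Complex.exp y ≠ 1 := by
      have h2 : Tendsto expQuot (𝓝[≠] 0) (𝓝 (expQuot 0)) :=
        (expQuot_analytic 0).continuousAt.tendsto.mono_left nhdsWithin_le_nhds
      filter_upwards [h2.eventually_ne (expQuot_ne_zero (by simp)), self_mem_nhdsWithin] with y hy h0
      rw [expQuot_of_ne h0] at hy
      intro h3
      exact hy (by rw [h3]; simp)
    have h2 := path_tendsto' ζ v hv hkl
    rw [h] at h2
    exact h2.eventually h1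
  · have h1 := (Complex.continuous_exp.tendsto _).comp (path_tendsto ζ v k l)
    exact h1.eventually_ne (exp_ne_one h hζ)

lemma tOp_braid (j k : Fin (n - 1))
    (h : j.1 + 1 = k.1) : tOp ρ j * tOp ρ k * tOp ρ j = tOp ρ k * tOp ρ j * tOp ρ k := by
  have h1 : hi j = lo k := Fin.ext h
  have h2 : lo j ≠ hi k := by simp [lo, hi, Fin.ext_iff]; omega
  have h3 : simpleRefl j * simpleRefl k * simpleRefl j =
      simpleRefl k * simpleRefl j * simpleRefl k := by
    have e1 := Equiv.swap_mul_swap_mul_swap (x := lo j) (y := hi j) (z := hi k) (lo_ne_hi j) h2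
    have e2 := Equiv.swap_mul_swap_mul_swap (x := hi k) (y := lo k) (z := lo j)
      (lo_ne_hi k).symm h2.symm
    rw [Equiv.swap_comm (hi k) (lo k), Equiv.swap_comm (lo k) (lo j), ← h1] at e2
    unfold simpleRefl
    rw [← h1, e1, e2, Equiv.swap_comm]
  simp only [tOp, ← map_mul, ← GradedHecke.t_mul, h3]

variable [FiniteDimensional ℂ E]

section T

variable {ρ} {M : ℕ} {P : Polynomial ℂ}

lemma lusztigT_eq (hP : GoodPoly ρ M P) (hM : bigOrder n E ≤ M) (j : Fin (n - 1)) :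
    lusztigT ρ j = (tOp ρ j + 1) * act ρ (diffPoly P (lo j) (hi j)) - 1 := by
  rw [lusztigT, hP.opFun hM]
  rfl

lemma act_congr (hρ : RealDiff ρ) {R : MvPolynomial (Fin n) ℂ}
    (h : ∀ ζ ∈ points ρ, ∀ v : Fin n → ℂ, Function.Injective v →
      (fun s : ℂ => MvPolynomial.eval (ζ + s • v) R) =O[𝓝[≠] 0] fun s => s ^ bigOrder n E) :
    act ρ R = 0 :=
  act_eq_zero ρ hρ fun ζ hζ v hv => by simpa using (h ζ hζ v hv).neg_left

/-- Elimination of the denominator `ε_k - ε_l`. -/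
lemma isBigO_of_mul {ζ v : Fin n → ℂ} (hv : Function.Injective v) {k l : Fin n} (hkl : k ≠ l)
    {N : ℕ} {R : MvPolynomial (Fin n) ℂ}
    (h : (fun s : ℂ => MvPolynomial.eval (ζ + s • v) ((X k - X l) * R)) =O[𝓝[≠] 0]
      fun s => s ^ (N + 1)) :
    (fun s : ℂ => MvPolynomial.eval (ζ + s • v) R) =O[𝓝[≠] 0] fun s => s ^ N := by
  refine div_isBigO ζ v hv hkl (h.congr_left fun s => ?_)
  rw [map_mul, map_sub, MvPolynomial.eval_X, MvPolynomial.eval_X]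

lemma quad_aux (hρ : RealDiff ρ) (hP : GoodPoly ρ (bigOrder n E + 1) P) (j : Fin (n - 1))
    (d : MvPolynomial (Fin n) ℂ)
    (hd : (X (lo j) - X (hi j)) * d =
      diffPoly P (lo j) (hi j) - rename (simpleRefl j) (diffPoly P (lo j) (hi j))) :
    act ρ (diffPoly P (lo j) (hi j) + rename (simpleRefl j) (diffPoly P (lo j) (hi j)) +
      (Real.log q : ℂ) • d) = algebraMap ℂ _ ((q : ℂ) + 1) := by
  rw [rename_diffPoly, rename_simpleRefl_lo, rename_simpleRefl_hi] at hd ⊢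
  have hC : ∀ c : ℂ, act ρ (C c) = algebraMap ℂ _ c := fun c => (act ρ).commutes c
  rw [← sub_eq_zero, ← hC, ← map_sub]
  refine act_congr hρ fun ζ hζ v hv => isBigO_of_mul hv (lo_ne_hi j) ?_
  have h1 := hP.represents (lo_ne_hi j) ζ hζ v hv
  have h2 := hP.represents (lo_ne_hi j).symm ζ hζ v hv
  have hlin : Represents ρ (bigOrder n E + 1) (fun z => z (lo j) - z (hi j))
      (X (lo j) - X (hi j)) := fun ζ hζ v hv => by simpa using isBigO_zero _ _
  refine (transfer (m := 3) (by omega)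
    (fun p => p 2 * (p 0 + p 1 - (q + 1)) + Real.log q * (p 0 - p 1)) (by fun_prop)
    (fun s => ![MvPolynomial.eval (ζ + s • v) (diffPoly P (lo j) (hi j)),
      MvPolynomial.eval (ζ + s • v) (diffPoly P (hi j) (lo j)),
      MvPolynomial.eval (ζ + s • v) (X (lo j) - X (hi j))])
    (fun s => ![lusztigFactor q ((ζ + s • v) (lo j) - (ζ + s • v) (hi j)),
      lusztigFactor q ((ζ + s • v) (hi j) - (ζ + s • v) (lo j)),
      (ζ + s • v) (lo j) - (ζ + s • v) (hi j)]) ?_ ?_ ?_).congr_left ?_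
  · intro i
    fin_cases i <;> exact continuous_path_eval _ _ _
  · intro i
    fin_cases i
    · exact h1
    · exact h2
    · exact hlin ζ hζ v hv
  · filter_upwards [real_path_ne hv (lo_ne_hi j) (hζ.2 _ _),
      path_ne ζ v hv (lo_ne_hi j) (-Real.log q), path_ne ζ v hv (lo_ne_hi j) (Real.log q)]
      with s e2 e3 e4
    have := factor_quad (q := q) _ e2 (fun h => e3 (by linear_combination h))
      (fun h => e4 (by linear_combination -h))
    simpa using this
  · intro s
    have : (X (lo j) - X (hi j)) * (diffPoly P (lo j) (hi j) + diffPoly P (hi j) (lo j) +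
        (Real.log q : ℂ) • d - C ((q : ℂ) + 1)) =
        (X (lo j) - X (hi j)) * (diffPoly P (lo j) (hi j) + diffPoly P (hi j) (lo j) -
          C ((q : ℂ) + 1)) +
        C (Real.log q : ℂ) * (diffPoly P (lo j) (hi j) - diffPoly P (hi j) (lo j)) := by
      rw [MvPolynomial.smul_eq_C_mul]
      linear_combination C (Real.log q : ℂ) * hd
    rw [this]
    simp

lemma lusztigT_quad (hq : 1 < q) (hρ : RealDiff ρ) (j : Fin (n - 1)) :
    (lusztigT ρ j + 1) * (lusztigT ρ j - algebraMap ℂ _ (q : ℂ)) = 0 := by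
  obtain ⟨P, hP⟩ := exists_goodPoly ρ hq hρ (bigOrder n E + 1)
  rw [lusztigT_eq hP (by omega)]
  obtain ⟨d, hd⟩ := exists_divided_difference j (diffPoly P (lo j) (hi j))
  have h1 := sandwich ρ j _ d hd
  rw [quad_aux hρ hP j d hd] at h1
  have h2 : ∀ B : Module.End ℂ E, (B - 1 + 1) * (B - 1 - algebraMap ℂ _ (q : ℂ)) =
      B * B - algebraMap ℂ _ ((q : ℂ) + 1) * B := by
    intro B
    rw [map_add, map_one, sub_add_cancel, mul_sub, mul_sub, ← Algebra.commutes (q : ℂ) B]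
    noncomm_ring
  rw [h2, ← mul_assoc, h1, mul_assoc (tOp ρ j + 1), Algebra.commutes, sub_eq_zero,
    ← mul_assoc, Algebra.commutes]

lemma noncomm_aux {R : Type*} [Ring R] (b b' p r S H : R) (h1 : p * (b' * r) = b' * S + H)
    (h2 : S * b = b * S) : b * p * (b' * r) * (b * p) = (b * b' * b * S + b * H * b) * p := by
  have e1 : b * p * (b' * r) * (b * p) = b * (p * (b' * r)) * b * p := by noncomm_ring
  have e2 : b * (b' * S + H) * b * p = (b * b' * (S * b) + b * H * b) * p := by noncomm_ring
  rw [e1, h1, e2, h2, ← mul_assoc]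

/-- A computation that is used on both sides of the braid relation. -/
lemma braid_aux (hρ : RealDiff ρ) (hP : GoodPoly ρ (bigOrder n E + 3) P) (j k : Fin (n - 1))
    (a b : Fin n) (hab : a ≠ b)
    (hadd : (X (lo j) - X (hi j)) + (X (lo k) - X (hi k)) = (X a - X b : MvPolynomial (Fin n) ℂ))
    (hj1 : diffPoly P (simpleRefl j (lo k)) (simpleRefl j (hi k)) = diffPoly P a b)
    (hj2 : diffPoly P (simpleRefl j a) (simpleRefl j b) = diffPoly P (lo k) (hi k))
    (hk1 : diffPoly P (simpleRefl k (lo j)) (simpleRefl k (hi j)) = diffPoly P a b)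
    (hj3 : rename (simpleRefl j) (X (lo k) - X (hi k) : MvPolynomial (Fin n) ℂ) = X a - X b) :
    (tOp ρ j + 1) * act ρ (diffPoly P (lo j) (hi j)) *
        ((tOp ρ k + 1) * act ρ (diffPoly P (lo k) (hi k))) *
        ((tOp ρ j + 1) * act ρ (diffPoly P (lo j) (hi j))) -
      algebraMap ℂ _ (q : ℂ) * ((tOp ρ j + 1) * act ρ (diffPoly P (lo j) (hi j))) =
    ((tOp ρ j + 1) * (tOp ρ k + 1) * (tOp ρ j + 1) - (tOp ρ j + 1)) *
      act ρ (diffPoly P a b * diffPoly P (lo k) (hi k) * diffPoly P (lo j) (hi j)) := by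
  have hC : ∀ c : ℂ, act ρ (C c) = algebraMap ℂ _ c := fun c => (act ρ).commutes c
  obtain ⟨D, hD⟩ := exists_divided_difference k (diffPoly P (lo j) (hi j))
  have hD' := act_tOp ρ k _ D hD
  rw [rename_diffPoly, hk1] at hD hD'
  set h : MvPolynomial (Fin n) ℂ :=
    (diffPoly P (lo j) (hi j) - diffPoly P a b + (Real.log q : ℂ) • D) *
      diffPoly P (lo k) (hi k) with hh
  obtain ⟨d, hd⟩ := exists_divided_difference j h
  have hS : rename (simpleRefl j) (diffPoly P a b * diffPoly P (lo k) (hi k)) =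
      diffPoly P a b * diffPoly P (lo k) (hi k) := by
    rw [map_mul, rename_diffPoly, rename_diffPoly, hj1, hj2, mul_comm]
  have hS' := act_tOp_of_symm ρ j _ hS
  -- the scalar identity
  have key : act ρ (diffPoly P a b * diffPoly P (lo k) (hi k) +
      (h + rename (simpleRefl j) h + (Real.log q : ℂ) • d)) = algebraMap ℂ _ (q : ℂ) := by
    rw [← sub_eq_zero, ← hC, ← map_sub]
    have hDs : (X a - X b) * rename (simpleRefl j) D =
        diffPoly P (hi j) (lo j) - diffPoly P (lo k) (hi k) := by
      have := congrArg (rename (simpleRefl j)) hD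
      rw [map_mul, map_sub (rename (simpleRefl j)) (diffPoly P _ _), hj3, rename_diffPoly,
        rename_diffPoly, hj2, rename_simpleRefl_lo, rename_simpleRefl_hi] at this
      exact this
    have hhs : rename (simpleRefl j) h =
        (diffPoly P (hi j) (lo j) - diffPoly P (lo k) (hi k) +
          (Real.log q : ℂ) • rename (simpleRefl j) D) * diffPoly P a b := by
      rw [hh, map_mul, map_add, map_sub, map_smul, rename_diffPoly, rename_diffPoly,
        rename_diffPoly, hj1, hj2, rename_simpleRefl_lo, rename_simpleRefl_hi]
    refine act_congr hρ fun ζ hζ v hv => isBigO_of_mul hv (lo_ne_hi j)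
      (isBigO_of_mul hv (lo_ne_hi k) (isBigO_of_mul hv hab ?_))
    have hlin : ∀ x y : Fin n, (fun s : ℂ => ((ζ + s • v) x - (ζ + s • v) y) -
        MvPolynomial.eval (ζ + s • v) (X x - X y)) =O[𝓝[≠] 0]
          fun s => s ^ (bigOrder n E + 3) := fun x y => by simpa using isBigO_zero _ _
    have hsum : ∀ z : Fin n → ℂ, z a - z b = (z (lo j) - z (hi j)) + (z (lo k) - z (hi k)) := by
      intro z
      have := congrArg (MvPolynomial.eval z) hadd
      simp only [map_add, map_sub, MvPolynomial.eval_X] at this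
      exact this.symm
    refine (transfer (m := 6) (by omega)
      (fun p => p 4 * p 5 * (p 4 + p 5) * (p 0 * p 1 - q) +
        (p 4 + Real.log q) * (p 4 + p 5) * (p 5 + Real.log q) * (p 2 - p 0) * p 1 +
        (p 4 - Real.log q) * p 5 * (p 4 + p 5 + Real.log q) * (p 3 - p 1) * p 0) (by fun_prop)
      (fun s => ![MvPolynomial.eval (ζ + s • v) (diffPoly P a b),
        MvPolynomial.eval (ζ + s • v) (diffPoly P (lo k) (hi k)),
        MvPolynomial.eval (ζ + s • v) (diffPoly P (lo j) (hi j)),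
        MvPolynomial.eval (ζ + s • v) (diffPoly P (hi j) (lo j)),
        MvPolynomial.eval (ζ + s • v) (X (lo j) - X (hi j)),
        MvPolynomial.eval (ζ + s • v) (X (lo k) - X (hi k))])
      (fun s => ![lusztigFactor q ((ζ + s • v) a - (ζ + s • v) b),
        lusztigFactor q ((ζ + s • v) (lo k) - (ζ + s • v) (hi k)),
        lusztigFactor q ((ζ + s • v) (lo j) - (ζ + s • v) (hi j)),
        lusztigFactor q ((ζ + s • v) (hi j) - (ζ + s • v) (lo j)),
        (ζ + s • v) (lo j) - (ζ + s • v) (hi j),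
        (ζ + s • v) (lo k) - (ζ + s • v) (hi k)]) ?_ ?_ ?_).congr_left ?_
    · intro i
      fin_cases i <;> exact continuous_path_eval _ _ _
    · intro i
      fin_cases i
      · exact hP.represents hab ζ hζ v hv
      · exact hP.represents (lo_ne_hi k) ζ hζ v hv
      · exact hP.represents (lo_ne_hi j) ζ hζ v hv
      · exact hP.represents (lo_ne_hi j).symm ζ hζ v hv
      · exact hlin _ _
      · exact hlin _ _
    · filter_upwards [real_path_ne hv (lo_ne_hi j) (hζ.2 _ _),
        real_path_ne hv (lo_ne_hi k) (hζ.2 _ _), real_path_ne hv hab (hζ.2 _ _),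
        path_ne ζ v hv (lo_ne_hi j) (-Real.log q), path_ne ζ v hv (lo_ne_hi k) (-Real.log q),
        path_ne ζ v hv hab (-Real.log q), path_ne ζ v hv (lo_ne_hi j) (Real.log q)]
        with s e1 e2 e3 e4 e5 e6 e7
      rw [hsum] at e3 e6
      have := factor_braid (q := q) _ _ e1 e2 e3 (fun h => e4 (by linear_combination h))
        (fun h => e5 (by linear_combination h)) (fun h => e6 (by linear_combination h))
        (fun h => e7 (by linear_combination -h))
      simp only [hsum (ζ + s • v)]
      rw [neg_sub] at this
      simpa using this
    · intro s
      have : (X a - X b) * ((X (lo k) - X (hi k)) * ((X (lo j) - X (hi j)) *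
          (diffPoly P a b * diffPoly P (lo k) (hi k) +
            (h + rename (simpleRefl j) h + (Real.log q : ℂ) • d) - C (q : ℂ)))) =
          (X (lo j) - X (hi j)) * (X (lo k) - X (hi k)) *
            ((X (lo j) - X (hi j)) + (X (lo k) - X (hi k))) *
            (diffPoly P a b * diffPoly P (lo k) (hi k) - C (q : ℂ)) +
          ((X (lo j) - X (hi j)) + C (Real.log q : ℂ)) *
            ((X (lo j) - X (hi j)) + (X (lo k) - X (hi k))) *
            ((X (lo k) - X (hi k)) + C (Real.log q : ℂ)) *
            (diffPoly P (lo j) (hi j) - diffPoly P a b) * diffPoly P (lo k) (hi k) +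
          ((X (lo j) - X (hi j)) - C (Real.log q : ℂ)) * (X (lo k) - X (hi k)) *
            ((X (lo j) - X (hi j)) + (X (lo k) - X (hi k)) + C (Real.log q : ℂ)) *
            (diffPoly P (hi j) (lo j) - diffPoly P (lo k) (hi k)) * diffPoly P a b := by
        rw [hhs] at hd ⊢
        rw [hh] at hd ⊢
        rw [hadd]
        simp only [MvPolynomial.smul_eq_C_mul] at hd ⊢
        linear_combination (X a - X b) * (X (lo k) - X (hi k)) * C (Real.log q : ℂ) * hd +
          (X a - X b) * ((X (lo j) - X (hi j)) + C (Real.log q : ℂ)) * C (Real.log q : ℂ) *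
            diffPoly P (lo k) (hi k) * hD +
          (X (lo k) - X (hi k)) * ((X (lo j) - X (hi j)) - C (Real.log q : ℂ)) *
            C (Real.log q : ℂ) * diffPoly P a b * hDs
      rw [this]
      simp
  have e1 : act ρ (diffPoly P (lo j) (hi j)) * ((tOp ρ k + 1) * act ρ (diffPoly P (lo k) (hi k))) =
      (tOp ρ k + 1) * act ρ (diffPoly P a b * diffPoly P (lo k) (hi k)) + act ρ h := by
    rw [← mul_assoc, mul_add, hD', mul_one, hh, map_mul, map_mul, map_add, map_sub]
    noncomm_ring
  have e2 : act ρ (diffPoly P a b * diffPoly P (lo k) (hi k)) * (tOp ρ j + 1) =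
      (tOp ρ j + 1) * act ρ (diffPoly P a b * diffPoly P (lo k) (hi k)) := by
    rw [mul_add, hS', add_mul, mul_one, one_mul]
  have e3 := sandwich ρ j h d hd
  have e4 : (tOp ρ j + 1) * act ρ (diffPoly P (lo j) (hi j)) *
        ((tOp ρ k + 1) * act ρ (diffPoly P (lo k) (hi k))) *
        ((tOp ρ j + 1) * act ρ (diffPoly P (lo j) (hi j))) =
      ((tOp ρ j + 1) * (tOp ρ k + 1) * (tOp ρ j + 1) *
          act ρ (diffPoly P a b * diffPoly P (lo k) (hi k)) +
        (tOp ρ j + 1) * act ρ (h + rename (simpleRefl j) h + (Real.log q : ℂ) • d)) *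
        act ρ (diffPoly P (lo j) (hi j)) := by
    rw [← e3]
    exact noncomm_aux _ _ _ _ _ _ e1 e2
  rw [map_add] at key
  have e5 := eq_sub_of_add_eq' key
  rw [e4, e5, map_mul _ _ (diffPoly P (lo j) (hi j)), mul_sub, ← Algebra.commutes (q : ℂ)]
  noncomm_ring

lemma lusztigT_braid (hq : 1 < q) (hρ : RealDiff ρ) (j k : Fin (n - 1)) (h : j.1 + 1 = k.1) :
    lusztigT ρ j * lusztigT ρ k * lusztigT ρ j = lusztigT ρ k * lusztigT ρ j * lusztigT ρ k := by
  obtain ⟨P, hP⟩ := exists_goodPoly ρ hq hρ (bigOrder n E + 3)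
  have qj := lusztigT_quad hq hρ j
  have qk := lusztigT_quad hq hρ k
  rw [lusztigT_eq hP (by omega)] at qj qk ⊢
  rw [lusztigT_eq hP (by omega) k] 
  have h1 : lo k = hi j := (Fin.ext h).symm
  have h2 : lo j ≠ hi k := by simp [lo, hi, Fin.ext_iff]; omega
  have h3 := lo_ne_hi j
  have h4 := lo_ne_hi k
  rw [h1] at h4
  have j1 : simpleRefl j (lo j) = hi j := rename_simpleRefl_lo j
  have j2 : simpleRefl j (hi j) = lo j := rename_simpleRefl_hi j
  have j3 : simpleRefl j (hi k) = hi k := Equiv.swap_apply_of_ne_of_ne h2.symm h4.symm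
  have k1 : simpleRefl k (hi j) = hi k := by rw [← h1]; exact rename_simpleRefl_lo k
  have k2 : simpleRefl k (hi k) = hi j := by rw [← h1]; exact rename_simpleRefl_hi k
  have k3 : simpleRefl k (lo j) = lo j :=
    Equiv.swap_apply_of_ne_of_ne (by rw [h1]; exact h3) h2
  have e1 := braid_aux hρ hP j k (lo j) (hi k) h2 (by rw [h1]; ring) (by rw [h1, j2, j3])
    (by rw [j1, j3, h1]) (by rw [k3, k1]) (by rw [map_sub, MvPolynomial.rename_X,
      MvPolynomial.rename_X, h1, j2, j3])
  have e2 := braid_aux hρ hP k j (lo j) (hi k) h2 (by rw [h1]; ring) (by rw [k3, k1])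
    (by rw [k3, k2]) (by rw [h1, j2, j3]) (by rw [map_sub, MvPolynomial.rename_X,
      MvPolynomial.rename_X, k3, k1])
  have e3 : (tOp ρ j + 1) * (tOp ρ k + 1) * (tOp ρ j + 1) - (tOp ρ j + 1) =
      (tOp ρ k + 1) * (tOp ρ j + 1) * (tOp ρ k + 1) - (tOp ρ k + 1) := by
    have b := tOp_braid ρ j k h
    have sj := tOp_mul_self ρ j
    have sk := tOp_mul_self ρ k
    have x1 : ∀ u v : Module.End ℂ E, (u + 1) * (v + 1) * (u + 1) - (u + 1) =
        u * v * u + u * v + v * u + (u * u) + v + u := by intro u v; noncomm_ring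
    rw [x1, x1, b, sj, sk]
    abel
  rw [e3] at e1
  have e4 : diffPoly P (lo j) (hi k) * diffPoly P (lo k) (hi k) * diffPoly P (lo j) (hi j) =
      diffPoly P (lo j) (hi k) * diffPoly P (lo j) (hi j) * diffPoly P (lo k) (hi k) := by ring
  rw [e4, ← e2] at e1
  generalize (tOp ρ j + 1) * act ρ (diffPoly P (lo j) (hi j)) = B at *
  generalize (tOp ρ k + 1) * act ρ (diffPoly P (lo k) (hi k)) = B' at *
  have x2 : ∀ u : Module.End ℂ E, (u - 1 + 1) * (u - 1 - algebraMap ℂ _ (q : ℂ)) = 0 →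
      u * u = u + algebraMap ℂ _ (q : ℂ) * u := by
    intro u hu
    rw [Algebra.commutes]
    rw [← sub_eq_zero, ← hu]
    noncomm_ring
  have x3 : ∀ u v : Module.End ℂ E, (u - 1) * (v - 1) * (u - 1) =
      u * v * u - u * v - v * u - u * u + u + u + v - 1 := by intro u v; noncomm_ring
  rw [x3, x3, x2 B qj, x2 B' qk, sub_eq_iff_eq_add.1 e1]
  abel

lemma lusztigT_comm (hq : 1 < q) (hρ : RealDiff ρ) (j k : Fin (n - 1)) (h : j.1 + 1 < k.1) :
    lusztigT ρ j * lusztigT ρ k = lusztigT ρ k * lusztigT ρ j := by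
  obtain ⟨P, hP⟩ := exists_goodPoly ρ hq hρ (bigOrder n E)
  rw [lusztigT_eq hP le_rfl, lusztigT_eq hP le_rfl]
  have n1 : lo j ≠ lo k := by simp [lo, Fin.ext_iff]; omega
  have n2 : lo j ≠ hi k := by simp [lo, hi, Fin.ext_iff]; omega
  have n3 : hi j ≠ lo k := by simp [lo, hi, Fin.ext_iff]; omega
  have n4 : hi j ≠ hi k := by simp [hi, Fin.ext_iff]; omega
  have h1 : Commute (tOp ρ j) (tOp ρ k) := by
    have : Commute (simpleRefl j) (simpleRefl k) := by
      apply Equiv.Perm.Disjoint.commute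
      intro x
      by_cases hx : x = lo j ∨ x = hi j
      · right
        rcases hx with rfl | rfl
        · exact Equiv.swap_apply_of_ne_of_ne n1 n2
        · exact Equiv.swap_apply_of_ne_of_ne n3 n4
      · left
        push Not at hx
        exact Equiv.swap_apply_of_ne_of_ne hx.1 hx.2
    have := this.map (GradedHecke.tHom (q := q))
    exact this.map ρ
  have h2 : Commute (act ρ (diffPoly P (lo j) (hi j))) (tOp ρ k) :=
    act_tOp_of_symm ρ k _ (by
      rw [rename_diffPoly, simpleRefl, Equiv.swap_apply_of_ne_of_ne n1 n2,
        Equiv.swap_apply_of_ne_of_ne n3 n4])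
  have h3 : Commute (act ρ (diffPoly P (lo k) (hi k))) (tOp ρ j) :=
    act_tOp_of_symm ρ j _ (by
      rw [rename_diffPoly, simpleRefl, Equiv.swap_apply_of_ne_of_ne n1.symm n3.symm,
        Equiv.swap_apply_of_ne_of_ne n2.symm n4.symm])
  have h4 : Commute (act ρ (diffPoly P (lo j) (hi j))) (act ρ (diffPoly P (lo k) (hi k))) :=
    (Commute.all _ _).map (act ρ)
  have c1 : Commute (tOp ρ j + 1) ((tOp ρ k + 1) * act ρ (diffPoly P (lo k) (hi k)) - 1) :=
    (((h1.add_left (Commute.one_left _)).add_right (Commute.one_right _)).mul_right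
      (h3.symm.add_left (Commute.one_left _))).sub_right (Commute.one_right _)
  have c2 : Commute (act ρ (diffPoly P (lo j) (hi j)))
      ((tOp ρ k + 1) * act ρ (diffPoly P (lo k) (hi k)) - 1) :=
    ((h2.add_right (Commute.one_right _)).mul_right h4).sub_right (Commute.one_right _)
  exact (c1.mul_left c2).sub_left (Commute.one_left _)

end T

/-! Laurent polynomials -/

/-- The value of a Laurent polynomial at the point `(e^{z_1}, …, e^{z_n})`. -/
def evalExp (z : Fin n → ℂ) : Laurent n →ₐ[ℂ] ℂ :=
  AddMonoidAlgebra.lift ℂ ℂ (Fin n →₀ ℤ)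
    { toFun := fun x => Complex.exp (MvPolynomial.eval z (linForm x.toAdd))
      map_one' := by simp [linForm]
      map_mul' := fun x y => by
        rw [← Complex.exp_add]
        congr 1
        simp [linForm, add_mul, Finset.sum_add_distrib] }

lemma evalExp_single (z : Fin n → ℂ) (x : Fin n →₀ ℤ) (c : ℂ) :
    evalExp z (AddMonoidAlgebra.single x c) =
      c * Complex.exp (MvPolynomial.eval z (linForm x)) := by
  simp [evalExp, AddMonoidAlgebra.lift_single]

lemma evalExp_lx (z : Fin n → ℂ) (k : Fin n) : evalExp z (lx k) = Complex.exp (z k) := by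
  rw [lx, evalExp_single, one_mul]
  congr 1
  simp [linForm, Finsupp.single_apply]

lemma evalExp_lrename (z : Fin n → ℂ) (w : Equiv.Perm (Fin n)) (f : Laurent n) :
    evalExp z (lrename w f) = evalExp (z ∘ w) f := by
  induction f using AddMonoidAlgebra.induction_linear with
  | zero => simp
  | add f g hf hg => rw [map_add, map_add, map_add, hf, hg]
  | single x c =>
    rw [lrename, AddMonoidAlgebra.mapDomainAlgHom_apply, AddMonoidAlgebra.mapDomain_single,
      evalExp_single, evalExp_single]
    congr 2
    simp only [linForm, map_sum, map_mul, MvPolynomial.eval_X, MvPolynomial.eval_C]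
    rw [← Equiv.sum_comp w]
    refine Finset.sum_congr rfl fun k _ => ?_
    simp [Finsupp.mapDomain_apply w.injective]

lemma exists_lusztigX (M : ℕ) (hM : Module.finrank ℂ E ≤ M) (x : Fin n →₀ ℤ) :
    ∃ R, Represents ρ M (fun z => Complex.exp (MvPolynomial.eval z (linForm x))) R ∧
      lusztigX ρ x = act ρ R := by
  have h1 : ((fun ζ : Fin n → ℂ => MvPolynomial.eval ζ (linForm x)) '' points ρ).Finite :=
    (points_finite ρ).image _
  have h2 := finite_eigenvalues (ρ (GradedHecke.poly (linForm x)))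
  obtain ⟨p, hp⟩ := exists_interpolation (h1.union h2).toFinset M Complex.exp
    (fun z _ => Complex.differentiable_exp.analyticAt z)
  refine ⟨Polynomial.aeval (linForm x) p, fun ζ hζ v hv => ?_, ?_⟩
  · have hO := hp (MvPolynomial.eval ζ (linForm x)) (by
      rw [Set.Finite.mem_toFinset]; exact Or.inl ⟨ζ, hζ, rfl⟩)
    have ht := (continuous_path_eval ζ v (linForm x)).tendsto 0
    rw [zero_smul, add_zero] at ht
    have h3 := hO.comp_tendsto (ht.mono_left (nhdsWithin_le_nhds (s := {0}ᶜ)))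
    simp only [eval_aeval]
    refine h3.trans ?_
    have : ∀ s : ℂ, MvPolynomial.eval (ζ + s • v) (linForm x) - MvPolynomial.eval ζ (linForm x) =
        MvPolynomial.eval v (linForm x) * s := by
      intro s
      simp only [linForm, map_sum, map_mul, MvPolynomial.eval_X, MvPolynomial.eval_C, Pi.add_apply,
        Pi.smul_apply, smul_eq_mul, Finset.sum_mul, ← Finset.sum_sub_distrib]
      exact Finset.sum_congr rfl fun k _ => by ring
    simp only [Function.comp_def, this, mul_pow]
    exact isBigO_const_mul_self _ _ _
  · rw [lusztigX, opFun_eq hM (p := p)]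
    · exact Polynomial.aeval_algHom_apply (act ρ) _ _
    · intro z hz
      exact (hp z (by rw [Set.Finite.mem_toFinset]; exact Or.inr hz)).mono nhdsWithin_le_nhds

lemma represents_unique (hρ : RealDiff ρ) {F : (Fin n → ℂ) → ℂ} {R S : MvPolynomial (Fin n) ℂ}
    {M : ℕ} (hM : bigOrder n E ≤ M) (hR : Represents ρ M F R) (hS : Represents ρ M F S) :
    act ρ R = act ρ S := by
  rw [← sub_eq_zero, ← map_sub]
  refine act_eq_zero ρ hρ fun ζ hζ v hv => ?_
  have h1 := hR.sub ρ hS ζ hζ v hv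
  simp only [sub_self] at h1
  refine h1.trans ?_
  obtain ⟨e, rfl⟩ := Nat.exists_eq_add_of_le hM
  have h2 : (fun s : ℂ => s ^ e) =O[𝓝[≠] 0] fun _ => (1 : ℂ) :=
    (((continuous_pow e).tendsto 0).mono_left nhdsWithin_le_nhds).isBigO_one ℂ
  simpa [pow_add] using (isBigO_refl (fun s : ℂ => s ^ bigOrder n E) (𝓝[≠] 0)).mul h2

lemma lusztigX_add (hρ : RealDiff ρ) (x y : Fin n →₀ ℤ) :
    lusztigX ρ (x + y) = lusztigX ρ x * lusztigX ρ y := by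
  set M := bigOrder n E + Module.finrank ℂ E
  obtain ⟨R, hR, eR⟩ := exists_lusztigX ρ M (by omega) x
  obtain ⟨S, hS, eS⟩ := exists_lusztigX ρ M (by omega) y
  obtain ⟨U, hU, eU⟩ := exists_lusztigX ρ M (by omega) (x + y)
  rw [eR, eS, eU, ← map_mul]
  refine represents_unique ρ hρ (M := M) (by omega) hU fun ζ hζ v hv => ?_
  have hM : 1 ≤ M := by simp only [M, bigOrder]; omega
  have := transfer (m := 3) hM (fun p => p 0 - p 1 * p 2) (by fun_prop)
    (fun s => ![Complex.exp (MvPolynomial.eval (ζ + s • v) (linForm (x + y))),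
      MvPolynomial.eval (ζ + s • v) R, MvPolynomial.eval (ζ + s • v) S])
    (fun s => ![Complex.exp (MvPolynomial.eval (ζ + s • v) (linForm (x + y))),
      Complex.exp (MvPolynomial.eval (ζ + s • v) (linForm x)),
      Complex.exp (MvPolynomial.eval (ζ + s • v) (linForm y))]) ?_ ?_ ?_
  · refine this.congr_left fun s => ?_
    simp
  · intro i
    fin_cases i
    · exact Complex.continuous_exp.comp (continuous_path_eval _ _ _)
    · exact continuous_path_eval _ _ _
    · exact continuous_path_eval _ _ _
  · intro i
    fin_cases i
    · simpa using isBigO_zero _ _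
    · exact hR ζ hζ v hv
    · exact hS ζ hζ v hv
  · refine Eventually.of_forall fun s => ?_
    simp only [Matrix.cons_val_zero, Matrix.cons_val_one, Matrix.cons_val]
    rw [← Complex.exp_add, ← map_add, sub_eq_zero]
    congr 2
    simp [linForm, add_mul, Finset.sum_add_distrib]

lemma lusztigX_zero (hρ : RealDiff ρ) : lusztigX ρ 0 = 1 := by
  set M := bigOrder n E + Module.finrank ℂ E
  obtain ⟨R, hR, eR⟩ := exists_lusztigX ρ M (by omega) 0
  rw [eR, ← map_one (act ρ)]
  refine represents_unique ρ hρ (M := M) (by omega) hR fun ζ hζ v hv => ?_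
  simpa [linForm] using isBigO_zero _ _

/-- The action of Laurent polynomials, `θ_x` acting by the exponential of `x`. -/
def lusztigLaurent (hρ : RealDiff ρ) : Laurent n →ₐ[ℂ] Module.End ℂ E :=
  AddMonoidAlgebra.lift ℂ (Module.End ℂ E) (Fin n →₀ ℤ)
    { toFun := fun x => lusztigX ρ x.toAdd
      map_one' := lusztigX_zero ρ hρ
      map_mul' := fun x y => lusztigX_add ρ hρ x.toAdd y.toAdd }

lemma lusztigLaurent_single (hρ : RealDiff ρ) (x : Fin n →₀ ℤ) (c : ℂ) :
    lusztigLaurent ρ hρ (AddMonoidAlgebra.single x c) = c • lusztigX ρ x := by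
  simp [lusztigLaurent, AddMonoidAlgebra.lift_single]

lemma exists_lusztigLaurent (hρ : RealDiff ρ) (M : ℕ) (hM : Module.finrank ℂ E ≤ M)
    (f : Laurent n) :
    ∃ R, Represents ρ M (fun z => evalExp z f) R ∧ lusztigLaurent ρ hρ f = act ρ R := by
  induction f using AddMonoidAlgebra.induction_linear with
  | zero => exact ⟨0, fun ζ hζ v hv => by simpa using isBigO_zero _ _, by simp⟩
  | add f g hf hg =>
    obtain ⟨R, hR, eR⟩ := hf
    obtain ⟨S, hS, eS⟩ := hg
    refine ⟨R + S, ?_, by rw [map_add, map_add, eR, eS]⟩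
    simpa only [map_add] using hR.add ρ hS
  | single x c =>
    obtain ⟨R, hR, eR⟩ := exists_lusztigX ρ M hM x
    refine ⟨c • R, ?_, by rw [lusztigLaurent_single, map_smul, eR]⟩
    simpa only [evalExp_single] using hR.smul ρ c

lemma lusztig_cross (hq : 1 < q) (hρ : RealDiff ρ) (j : Fin (n - 1)) (f g : Laurent n)
    (h : (lx (lo j) - lx (hi j)) * g = f - lrename (simpleRefl j) f) :
    lusztigT ρ j * lusztigLaurent ρ hρ f -
        lusztigLaurent ρ hρ (lrename (simpleRefl j) f) * lusztigT ρ j =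
      ((q : ℂ) - 1) • lusztigLaurent ρ hρ (lx (lo j) * g) := by
  set M := bigOrder n E + Module.finrank ℂ E + 1
  obtain ⟨P, hP⟩ := exists_goodPoly ρ hq hρ M
  obtain ⟨R, hR, eR⟩ := exists_lusztigLaurent ρ hρ M (by omega) f
  obtain ⟨G, hG, eG⟩ := exists_lusztigLaurent ρ hρ M (by omega) (lx (lo j) * g)
  obtain ⟨R', hR', eR'⟩ := exists_lusztigLaurent ρ hρ M (by omega) (lrename (simpleRefl j) f)
  have hRs := hR.rename ρ (simpleRefl j)
  simp only [← evalExp_lrename] at hRs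
  rw [represents_unique ρ hρ (by omega) hR' hRs] at eR'
  obtain ⟨d, hd⟩ := exists_divided_difference j R
  set R'' := MvPolynomial.rename (simpleRefl j) R with hR''
  have hd' : (X (lo j) - X (hi j)) * (-d) = R'' - MvPolynomial.rename (simpleRefl j) R'' := by
    have : MvPolynomial.rename (simpleRefl j) R'' = R := by
      rw [hR'', MvPolynomial.rename_rename, ← Equiv.Perm.coe_mul, simpleRefl_mul_self,
        Equiv.Perm.coe_one, MvPolynomial.rename_id_apply]
    rw [this]
    linear_combination -hd
  have h1 := act_tOp ρ j R'' (-d) hd'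
  have h1' : MvPolynomial.rename (simpleRefl j) R'' = R := by
    rw [hR'', MvPolynomial.rename_rename, ← Equiv.Perm.coe_mul, simpleRefl_mul_self,
      Equiv.Perm.coe_one, MvPolynomial.rename_id_apply]
  rw [h1'] at h1
  set Q := diffPoly P (lo j) (hi j) with hQ
  rw [lusztigT_eq hP (by omega), eR, eR', eG, ← map_smul, ← hQ]
  have key : act ρ ((Q - 1) * (R - R'') + C (Real.log q : ℂ) * (d * Q) -
      C ((q : ℂ) - 1) * G) = 0 := by
    refine act_congr hρ fun ζ hζ v hv => isBigO_of_mul hv (lo_ne_hi j) ?_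
    have := transfer (m := 5) (M := M) (by omega)
      (fun p => p 4 * ((p 0 - 1) * (p 1 - p 2) - (q - 1) * p 3) +
        Real.log q * ((p 1 - p 2) * p 0)) (by fun_prop)
      (fun s => ![MvPolynomial.eval (ζ + s • v) Q, MvPolynomial.eval (ζ + s • v) R,
        MvPolynomial.eval (ζ + s • v) R'', MvPolynomial.eval (ζ + s • v) G,
        MvPolynomial.eval (ζ + s • v) (X (lo j) - X (hi j))])
      (fun s => ![lusztigFactor q ((ζ + s • v) (lo j) - (ζ + s • v) (hi j)),
        evalExp (ζ + s • v) f, evalExp (ζ + s • v) (lrename (simpleRefl j) f),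
        evalExp (ζ + s • v) (lx (lo j) * g),
        (ζ + s • v) (lo j) - (ζ + s • v) (hi j)]) ?_ ?_ ?_
    · have h2 : (fun s : ℂ => s ^ M) =O[𝓝[≠] 0] fun s : ℂ => s ^ (bigOrder n E + 1) := by
        have h3 : (fun s : ℂ => s ^ Module.finrank ℂ E) =O[𝓝[≠] 0] fun _ => (1 : ℂ) :=
          (((continuous_pow _).tendsto 0).mono_left nhdsWithin_le_nhds).isBigO_one ℂ
        have h4 := (isBigO_refl (fun s : ℂ => s ^ (bigOrder n E + 1)) (𝓝[≠] 0)).mul h3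
        refine h4.congr (fun s => ?_) (fun s => mul_one _)
        rw [← pow_add]; congr 1; omega
      refine (this.trans h2).congr_left fun s => ?_
      have e : (X (lo j) - X (hi j)) * ((Q - 1) * (R - R'') + C (Real.log q : ℂ) * (d * Q) -
          C ((q : ℂ) - 1) * G) =
          (X (lo j) - X (hi j)) * ((Q - 1) * (R - R'') - C ((q : ℂ) - 1) * G) +
            C (Real.log q : ℂ) * ((R - R'') * Q) := by
        linear_combination C (Real.log q : ℂ) * Q * hd
      rw [e]
      simp
    · intro i
      fin_cases i <;> exact continuous_path_eval _ _ _
    · intro i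
      fin_cases i
      · exact hP.represents (lo_ne_hi j) ζ hζ v hv
      · exact hR ζ hζ v hv
      · exact hRs ζ hζ v hv
      · exact hG ζ hζ v hv
      · simpa using isBigO_zero _ _
    · filter_upwards [path_ne ζ v hv (lo_ne_hi j) 0, real_path_ne hv (lo_ne_hi j) (hζ.2 _ _),
        path_ne ζ v hv (lo_ne_hi j) (-Real.log q)] with s e1 e2 e3
      have e4 := congrArg (evalExp (ζ + s • v)) h
      rw [map_mul, map_sub, map_sub, evalExp_lx, evalExp_lx] at e4
      have := factor_cross (q := q) _ _ _ _ _ e1 e2 (fun h => e3 (by linear_combination h)) e4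
      have e5 : evalExp (ζ + s • v) (lx (lo j) * g) =
          Complex.exp ((ζ + s • v) (lo j)) * evalExp (ζ + s • v) g := by
        rw [map_mul, evalExp_lx]
      simp only [e5]
      simpa using this
  have hC : ∀ c : ℂ, act ρ (C c) = algebraMap ℂ _ c := fun c => (act ρ).commutes c
  have e6 : ((tOp ρ j + 1) * act ρ Q - 1) * act ρ R - act ρ R'' * ((tOp ρ j + 1) * act ρ Q - 1) =
      (tOp ρ j + 1) * act ρ (Q * R) - act ρ R - (act ρ R'' * tOp ρ j) * act ρ Q -
        act ρ (R'' * Q) + act ρ R'' := by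
    rw [map_mul, map_mul]; noncomm_ring
  rw [e6, h1, ← sub_eq_zero, ← key]
  simp only [MvPolynomial.smul_eq_C_mul, map_add, map_sub, map_mul, map_neg, map_one]
  rw [← map_mul (act ρ) Q R, mul_comm Q R, map_mul]
  have c2 : ∀ p p' : MvPolynomial (Fin n) ℂ, act ρ p * act ρ p' = act ρ p' * act ρ p :=
    fun p p' => by rw [← map_mul, mul_comm, map_mul]
  simp only [sub_mul, mul_sub, c2 Q]
  noncomm_ring

end relations
section hom

open MvPolynomial (X C rename)

variable {q : ℝ} {n : ℕ} {E : Type*} [AddCommGroup E] [Module ℂ E] [FiniteDimensional ℂ E]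

/-- The representation of the affine Hecke algebra that corresponds to a representation of the
graded Hecke algebra: `T_j` acts by `(t_j + 1) g(α_j)⁻¹ 𝒢(α_j) - 1` and `θ_x` acts by `e^x`. This
is the pullback by the map `j` of the completed algebras with `j(θ_x) = e^x` that sends the element
`(T_j + 1) 𝒢⁻¹ - 1`, with `𝒢 = (θ_α q - 1) / (θ_α - 1)`, to `(t_j + 1) g⁻¹ - 1`, with
`g = (α + log q) / α`. -/
def lusztigHom (hq : 1 < q) (ρ : GradedHecke q n →ₐ[ℂ] Module.End ℂ E) (hρ : RealDiff ρ) :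
    AffineHecke q n →ₐ[ℂ] Module.End ℂ E :=
  AffineHecke.lift (lusztigT ρ) (lusztigLaurent ρ hρ) (lusztigT_quad hq hρ)
    (lusztigT_braid hq hρ) (lusztigT_comm hq hρ) (lusztig_cross ρ hq hρ)

lemma lusztigHom_T (hq : 1 < q) (ρ : GradedHecke q n →ₐ[ℂ] Module.End ℂ E) (hρ : RealDiff ρ)
    (j : Fin (n - 1)) : lusztigHom hq ρ hρ (AffineHecke.T j) = lusztigT ρ j :=
  AffineHecke.lift_T _ _ _ _ _ _ j

lemma lusztigHom_poly (hq : 1 < q) (ρ : GradedHecke q n →ₐ[ℂ] Module.End ℂ E) (hρ : RealDiff ρ)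
    (f : Laurent n) : lusztigHom hq ρ hρ (AffineHecke.poly f) = lusztigLaurent ρ hρ f :=
  AffineHecke.lift_poly _ _ _ _ _ _ f

variable {E' : Type*} [AddCommGroup E'] [Module ℂ E'] [FiniteDimensional ℂ E']

lemma aeval_intertwine {E E' : Type*} [AddCommGroup E] [Module ℂ E] [AddCommGroup E'] [Module ℂ E']
    {A : Module.End ℂ E} {A' : Module.End ℂ E'} (f : E →ₗ[ℂ] E') (h : ∀ x, f (A x) = A' (f x))
    (p : Polynomial ℂ) (x : E) : f (Polynomial.aeval A p x) = Polynomial.aeval A' p (f x) := by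
  have hk : ∀ (k : ℕ) (x : E), f ((A ^ k) x) = (A' ^ k) (f x) := by
    intro k
    induction k with
    | zero => intro x; simp
    | succ k ih => intro x; rw [pow_succ, pow_succ, Module.End.mul_apply, Module.End.mul_apply, ih, h]
  induction p using Polynomial.induction_on' with
  | add p p' hp hp' => simp only [map_add, LinearMap.add_apply, hp, hp']
  | monomial k a => simp [Polynomial.aeval_monomial, hk]

lemma opFun_intertwine {F : ℂ → ℂ} {A : Module.End ℂ E} {A' : Module.End ℂ E'} (f : E →ₗ[ℂ] E')
    (h : ∀ x, f (A x) = A' (f x))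
    (hF : ∀ (D : Finset ℂ) (N : ℕ), (∀ z ∈ D, A.HasEigenvalue z ∨ A'.HasEigenvalue z) →
      ∃ p, ∀ z ∈ D, Agrees N F p z) (x : E) :
    f (opFun F A x) = opFun F A' (f x) := by
  obtain ⟨p, hp⟩ := hF ((finite_eigenvalues A).union (finite_eigenvalues A')).toFinset
    (Module.finrank ℂ E + Module.finrank ℂ E') (by intro z hz; simpa using hz)
  have e1 : opFun F A = Polynomial.aeval A p :=
    opFun_eq (N := Module.finrank ℂ E + Module.finrank ℂ E') (by omega)
      (fun z hz => hp z (by simp [hz]))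
  have e2 : opFun F A' = Polynomial.aeval A' p :=
    opFun_eq (N := Module.finrank ℂ E + Module.finrank ℂ E') (by omega)
      (fun z hz => hp z (by simp [hz]))
  rw [e1, e2]
  exact aeval_intertwine f h p x

lemma lusztigHom_intertwine (hq : 1 < q) (ρ : GradedHecke q n →ₐ[ℂ] Module.End ℂ E)
    (hρ : RealDiff ρ) (ρ' : GradedHecke q n →ₐ[ℂ] Module.End ℂ E') (hρ' : RealDiff ρ')
    (f : E →ₗ[ℂ] E') (hf : ∀ a x, f (ρ a x) = ρ' a (f x)) (h : AffineHecke q n) (x : E) :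
    f (lusztigHom hq ρ hρ h x) = lusztigHom hq ρ' hρ' h (f x) := by
  induction h using AffineHecke.induction generalizing x with
  | hT j =>
    rw [lusztigHom_T, lusztigHom_T]
    simp only [lusztigT, LinearMap.sub_apply, Module.End.mul_apply, LinearMap.add_apply,
      Module.End.one_apply, map_sub, map_add, hf]
    rw [opFun_intertwine f (hf _) (fun D N hD => exists_factor_interpolation hq D
      (fun z hz => (hD z hz).elim (hρ _ _ z) (hρ' _ _ z)) N)]
  | hp p =>
    rw [lusztigHom_poly, lusztigHom_poly]
    induction p using AddMonoidAlgebra.induction_linear with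
    | zero => simp
    | add p p' hp hp' => simp only [map_add, LinearMap.add_apply, hp, hp']
    | single y c =>
      rw [lusztigLaurent_single, lusztigLaurent_single, LinearMap.smul_apply, LinearMap.smul_apply,
        map_smul]
      congr 1
      refine opFun_intertwine f (hf _) (fun D N _ => ?_) x
      obtain ⟨p, hp⟩ := exists_interpolation D N Complex.exp
        (fun z _ => Complex.differentiable_exp.analyticAt z)
      exact ⟨p, fun z hz => (hp z hz).mono nhdsWithin_le_nhds⟩
  | hadd a b ha hb => simp only [map_add, LinearMap.add_apply, ha, hb]
  | hmul a b ha hb => simp only [map_mul, Module.End.mul_apply, ha, hb]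

end hom

/-! ### Modules with real central characters -/

/-- The point `ζ` is real for the root system: `ζ_k - ζ_l` is real for all `k`, `l`. -/
def IsRealPoint {n : ℕ} (ζ : Fin n → ℂ) : Prop := ∀ k l, (ζ k - ζ l).im = 0

/-- The maximal ideal, at the orbit of `ζ`, of the algebra of symmetric polynomials: the symmetric
polynomials that vanish at `ζ`. -/
def centralIdeal {n : ℕ} (ζ : Fin n → ℂ) : Ideal (MvPolynomial.symmetricSubalgebra (Fin n) ℂ) :=
  RingHom.ker ((MvPolynomial.eval ζ).comp (MvPolynomial.symmetricSubalgebra (Fin n) ℂ).val.toRingHom)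

section real

open MvPolynomial (X C rename)
open scoped ModuleCat

variable {q : ℝ} {n : ℕ}

/-- The category of finite-dimensional `ℍ_n`-modules that are annihilated by a power of the maximal
ideal of the center at the orbit of `ζ`. -/
def CentralModule (q : ℝ) {n : ℕ} (ζ : Fin n → ℂ) :
    ObjectProperty (ModuleCat.{u} (GradedHecke q n)) := fun M =>
  Module.Finite ℂ M ∧ ∃ N : ℕ, ∀ z ∈ centralIdeal ζ ^ N, ∀ x : M,
    GradedHecke.poly (q := q) z.1 • x = 0

/-- The category of finite-dimensional `ℍ_n`-modules that are sums of submodules, each of which is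
annihilated by a power of the maximal ideal of the center at the orbit of some real `ζ`. -/
def RealModule (q : ℝ) (n : ℕ) : ObjectProperty (ModuleCat.{u} (GradedHecke q n)) := fun M =>
  Module.Finite ℂ M ∧
    sSup {S : Submodule (GradedHecke q n) M | ∃ ζ : Fin n → ℂ, IsRealPoint ζ ∧
      ∃ N : ℕ, ∀ z ∈ centralIdeal ζ ^ N, ∀ x ∈ S, GradedHecke.poly (q := q) z.1 • x = 0} = ⊤

lemma centralModule_le {ζ : Fin n → ℂ} (hζ : IsRealPoint ζ) :
    CentralModule.{u} q ζ ≤ RealModule.{u} q n := by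
  rintro M ⟨hM, N, hN⟩
  exact ⟨hM, top_le_iff.1 (le_sSup ⟨ζ, hζ, N, fun z hz x _ => hN z hz x⟩)⟩

/-- A module, as a representation on a complex vector space. -/
def rep (M : ModuleCat.{u} (GradedHecke q n)) : GradedHecke q n →ₐ[ℂ] Module.End ℂ M :=
  Algebra.lsmul ℂ ℂ M

lemma rep_apply (M : ModuleCat.{u} (GradedHecke q n)) (a : GradedHecke q n) (x : M) :
    rep M a x = a • x := rfl

/-- The orbit product `∏ (Y - (ε_{w k} - ε_{w l}))`. -/
def orbitPoly (n : ℕ) (k l : Fin n) : Polynomial (MvPolynomial (Fin n) ℂ) :=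
  ∏ w : Equiv.Perm (Fin n), (Polynomial.X - Polynomial.C (X (w k) - X (w l)))

lemma orbitPoly_coeff_mem (k l : Fin n) (i : ℕ) :
    (orbitPoly n k l).coeff i ∈ MvPolynomial.symmetricSubalgebra (Fin n) ℂ := by
  rw [MvPolynomial.mem_symmetricSubalgebra]
  intro σ
  have h : (orbitPoly n k l).map (rename σ : _ →ₐ[ℂ] MvPolynomial (Fin n) ℂ).toRingHom =
      orbitPoly n k l := by
    rw [orbitPoly, Polynomial.map_prod]
    rw [← Equiv.prod_comp (Equiv.mulLeft σ)
      (fun w : Equiv.Perm (Fin n) => Polynomial.X - Polynomial.C (X (w k) - X (w l)))]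
    refine Finset.prod_congr rfl fun w _ => ?_
    simp
  conv_rhs => rw [← h]
  rw [Polynomial.coeff_map]
  rfl

lemma orbitPoly_eval_mem (k l : Fin n) (ζ : Fin n → ℂ) :
    Polynomial.aeval (X k - X l) ((orbitPoly n k l).map (MvPolynomial.eval ζ)) ∈
      (centralIdeal ζ).map (MvPolynomial.symmetricSubalgebra (Fin n) ℂ).val.toRingHom := by
  have h0 : (orbitPoly n k l).eval (X k - X l) = 0 := by
    rw [orbitPoly, Polynomial.eval_prod]
    exact Finset.prod_eq_zero (Finset.mem_univ 1) (by simp)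
  have h1 : Polynomial.aeval (X k - X l) ((orbitPoly n k l).map (MvPolynomial.eval ζ)) =
      ∑ i ∈ Finset.range ((orbitPoly n k l).natDegree + 1),
        (C (MvPolynomial.eval ζ ((orbitPoly n k l).coeff i)) - (orbitPoly n k l).coeff i) *
          (X k - X l) ^ i := by
    rw [← sub_zero (Polynomial.aeval _ _), ← h0, Polynomial.eval_eq_sum_range,
      Polynomial.aeval_eq_sum_range' (n := (orbitPoly n k l).natDegree + 1)
        (Nat.lt_succ_of_le Polynomial.natDegree_map_le), ← Finset.sum_sub_distrib]
    refine Finset.sum_congr rfl fun i _ => ?_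
    rw [Polynomial.coeff_map, MvPolynomial.smul_eq_C_mul]
    ring
  rw [h1]
  refine Ideal.sum_mem _ fun i _ => Ideal.mul_mem_right _ _ ?_
  have h2 : (algebraMap ℂ (MvPolynomial.symmetricSubalgebra (Fin n) ℂ)
      (MvPolynomial.eval ζ ((orbitPoly n k l).coeff i)) - ⟨_, orbitPoly_coeff_mem k l i⟩) ∈
      centralIdeal ζ := by
    rw [centralIdeal, RingHom.mem_ker]
    simp
  exact Ideal.mem_map_of_mem (MvPolynomial.symmetricSubalgebra (Fin n) ℂ).val.toRingHom h2

lemma realDiff_of_realModule {M : ModuleCat.{u} (GradedHecke q n)} (hM : RealModule.{u} q n M) :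
    RealDiff (rep M) := by
  intro k l μ hμ
  obtain ⟨y, hy⟩ := hμ.exists_hasEigenvector
  have hy1 : GradedHecke.poly (q := q) (X k - X l) • y = μ • y := hy.apply_eq_smul
  have key : ∀ x : M, ∃ p : Polynomial ℂ, (∀ z, p.eval z = 0 → z.im = 0) ∧
      GradedHecke.poly (q := q) (Polynomial.aeval (X k - X l) p) • x = 0 := by
    intro x
    have hx : x ∈ (⊤ : Submodule (GradedHecke q n) M) := trivial
    rw [← hM.2, sSup_eq_iSup'] at hx
    induction hx using Submodule.iSup_induction' with
    | mem S x hx =>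
      obtain ⟨S, ζ, hζ, N, hN⟩ := S
      refine ⟨((orbitPoly n k l).map (MvPolynomial.eval ζ)) ^ N, fun z hz => ?_, ?_⟩
      · rw [Polynomial.eval_pow] at hz
        have h1 := eq_zero_of_pow_eq_zero hz
        rw [orbitPoly, Polynomial.map_prod, Polynomial.eval_prod, Finset.prod_eq_zero_iff] at h1
        obtain ⟨w, -, hw⟩ := h1
        simp only [Polynomial.map_sub, Polynomial.map_X, Polynomial.map_C, map_sub,
          MvPolynomial.eval_X, Polynomial.eval_sub, Polynomial.eval_X, Polynomial.eval_C] at hw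
        have h2 : z = ζ (w k) - ζ (w l) := by
          linear_combination hw
        rw [h2]
        exact hζ _ _
      · rw [map_pow]
        have h1 := Ideal.pow_mem_pow (orbitPoly_eval_mem k l ζ) N
        rw [← Ideal.map_pow, Ideal.map] at h1
        generalize Polynomial.aeval (X k - X l : MvPolynomial (Fin n) ℂ)
          ((orbitPoly n k l).map (MvPolynomial.eval ζ)) ^ N = p at h1
        induction h1 using Submodule.span_induction with
        | mem p hp =>
          obtain ⟨z, hz, rfl⟩ := hp
          exact hN z hz x hx
        | zero => rw [← GradedHecke.polyHom_apply, map_zero, zero_smul]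
        | add p p' _ _ hp hp' => rw [GradedHecke.poly_add, add_smul, hp, hp', add_zero]
        | smul a p _ hp => rw [smul_eq_mul, GradedHecke.poly_mul, mul_smul, hp, smul_zero]
    | zero => exact ⟨1, by simp, by simp⟩
    | add x x' _ _ hx hx' =>
      obtain ⟨p, h1, h2⟩ := hx
      obtain ⟨p', h1', h2'⟩ := hx'
      refine ⟨p * p', fun z hz => ?_, ?_⟩
      · rw [Polynomial.eval_mul] at hz
        exact (mul_eq_zero.1 hz).elim (h1 z) (h1' z)
      · rw [smul_add, map_mul]
        have h3 : GradedHecke.poly (q := q) (Polynomial.aeval (X k - X l) p *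
            Polynomial.aeval (X k - X l) p') • x' = 0 := by
          rw [GradedHecke.poly_mul, mul_smul, h2', smul_zero]
        rw [h3, mul_comm, GradedHecke.poly_mul, mul_smul, h2, smul_zero, add_zero]
  obtain ⟨p, h1, h2⟩ := key y
  apply h1
  have h3 : Polynomial.aeval (rep M (GradedHecke.poly (X k - X l))) p y = 0 := by
    rw [← h2]
    have := Polynomial.aeval_algHom_apply ((rep M).comp GradedHecke.polyHom) (X k - X l) p
    exact LinearMap.congr_fun this y
  rw [Module.End.aeval_apply_of_hasEigenvector hy] at h3
  exact (smul_eq_zero.1 h3).resolve_right hy.2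

lemma poly_central {p : MvPolynomial (Fin n) ℂ} (hp : p.IsSymmetric) (a : GradedHecke q n) :
    GradedHecke.poly p * a = a * GradedHecke.poly p := by
  induction a using GradedHecke.induction with
  | ht w =>
    obtain ⟨L, rfl⟩ := exists_word w
    induction L with
    | nil => simp [GradedHecke.t_one]
    | cons j L ih =>
      rw [List.map_cons, List.prod_cons, GradedHecke.t_mul, ← mul_assoc,
        GradedHecke.poly_t j p 0 (by rw [hp]; ring), hp]
      rw [← GradedHecke.polyHom_apply 0, map_zero, smul_zero, add_zero, mul_assoc, ih, mul_assoc]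
  | hp f => rw [← GradedHecke.poly_mul, ← GradedHecke.poly_mul, mul_comm]
  | hadd a b ha hb => rw [mul_add, add_mul, ha, hb]
  | hmul a b ha hb => rw [← mul_assoc, ha, mul_assoc, hb, mul_assoc]

lemma realModule_of_realDiff {M : ModuleCat.{u} (GradedHecke q n)} (hfin : Module.Finite ℂ M)
    (hM : RealDiff (rep M)) : RealModule.{u} q n M := by
  refine ⟨hfin, ?_⟩
  set U := sSup {S : Submodule (GradedHecke q n) M | ∃ ζ : Fin n → ℂ, IsRealPoint ζ ∧
      ∃ N : ℕ, ∀ z ∈ centralIdeal ζ ^ N, ∀ x ∈ S, GradedHecke.poly (q := q) z.1 • x = 0}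
  have htop := Module.End.iSup_iInf_maxGenEigenspace_eq_top_of_forall_mapsTo
    (fun k : Fin n => act (rep M) (X k))
    (fun i j φ => Module.End.mapsTo_maxGenEigenspace_of_comm
      ((Commute.all (X j : MvPolynomial (Fin n) ℂ) (X i)).map (act (rep M))) φ)
    (fun i => Module.End.iSup_maxGenEigenspace_eq_top _)
  have hle : (⊤ : Submodule ℂ M) ≤ U.restrictScalars ℂ := by
    rw [← htop]
    refine iSup_le fun ζ x hx => ?_
    rw [Submodule.mem_iInf] at hx
    rw [Submodule.restrictScalars_mem]
    by_cases h0 : x = 0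
    · rw [h0]; exact Submodule.zero_mem _
    have hζ : IsRealPoint ζ := (mem_points (rep M) hM ⟨x, h0, hx⟩).2
    -- the polynomials that annihilate `x`
    let I : Ideal (MvPolynomial (Fin n) ℂ) :=
      { carrier := {p | act (rep M) p x = 0}
        zero_mem' := by simp
        add_mem' := fun {a b} ha hb => by
          simp only [Set.mem_ofPred_eq] at ha hb ⊢
          rw [map_add, LinearMap.add_apply, ha, hb, add_zero]
        smul_mem' := fun c p hp => by
          simp only [Set.mem_ofPred_eq] at hp ⊢
          rw [smul_eq_mul, map_mul, Module.End.mul_apply, hp, map_zero] }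
    have hI : ∀ k, X k - C (ζ k) ∈ I.radical := by
      intro k
      refine ⟨Module.finrank ℂ M, ?_⟩
      have h1 := pow_finrank_apply (hx k)
      have h2 : act (rep M) (C (ζ k)) = algebraMap ℂ _ (ζ k) := (act (rep M)).commutes _
      change act (rep M) ((X k - C (ζ k)) ^ _) x = 0
      rw [map_pow, map_sub, h2]
      exact h1
    have hI2 : RingHom.ker (MvPolynomial.eval ζ) ≤ I.radical := by
      intro p hp
      have h1 : Ideal.Quotient.mkₐ ℂ I.radical =
          (Algebra.ofId ℂ (MvPolynomial (Fin n) ℂ ⧸ I.radical)).comp (MvPolynomial.aeval ζ) := by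
        refine MvPolynomial.algHom_ext fun k => ?_
        rw [AlgHom.comp_apply, MvPolynomial.aeval_X]
        exact (Ideal.Quotient.mk_eq_mk_iff_sub_mem _ _).2 (hI k)
      have h2 := DFunLike.congr_fun h1 p
      rw [AlgHom.comp_apply] at h2
      have h3 : MvPolynomial.aeval ζ p = 0 := by
        rw [RingHom.mem_ker] at hp
        exact hp
      rw [h3, map_zero] at h2
      exact Ideal.Quotient.eq_zero_iff_mem.1 h2
    obtain ⟨N, hN⟩ := Ideal.exists_pow_le_of_le_radical_of_fg hI2
      (IsNoetherian.noetherian _)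
    let S : Submodule (GradedHecke q n) M :=
      { carrier := {y | ∀ z ∈ centralIdeal ζ ^ N, GradedHecke.poly (q := q) z.1 • y = 0}
        zero_mem' := fun z _ => smul_zero _
        add_mem' := fun {a b} ha hb z hz => by rw [smul_add, ha z hz, hb z hz, add_zero]
        smul_mem' := fun c y hy z hz => by
          rw [← mul_smul, poly_central z.2, mul_smul, hy z hz, smul_zero] }
    have hS : S ≤ U := le_sSup ⟨ζ, hζ, N, fun z hz y hy => hy z hz⟩
    refine hS fun z hz => ?_
    have h1 : centralIdeal ζ ≤ (RingHom.ker (MvPolynomial.eval ζ)).comap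
        (MvPolynomial.symmetricSubalgebra (Fin n) ℂ).val.toRingHom := fun z hz => hz
    have h2 := (Ideal.pow_right_mono h1 N).trans (Ideal.le_comap_pow _ N) hz
    exact hN h2
  exact top_le_iff.1 fun x _ => hle (Submodule.mem_top : x ∈ (⊤ : Submodule ℂ M))

/-! ### Lusztig's functor -/

/-- The module `Λ(π)`: it is the vector space `π`, with the action of the affine Hecke algebra by
`lusztigHom`. -/
def lusztigModule (hq : 1 < q) (M : (RealModule.{u} q n).FullSubcategory) :
    ModuleCat.{u} (AffineHecke q n) :=
  haveI : Module.Finite ℂ M.obj := M.property.1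
  letI : Module (AffineHecke q n) M.obj :=
    Module.compHom M.obj (lusztigHom hq (rep M.obj) (realDiff_of_realModule M.property)).toRingHom
  ModuleCat.of (AffineHecke q n) M.obj

/-- Lusztig's functor `Λ`, which is the identity on the underlying maps. -/
def lusztigFunctor (hq : 1 < q) :
    (RealModule.{u} q n).FullSubcategory ⥤ ModuleCat.{u} (AffineHecke q n) where
  obj M := lusztigModule hq M
  map {M M'} f :=
    ModuleCat.ofHom (X := lusztigModule hq M) (Y := lusztigModule hq M')
      { toFun := fun x => f.hom.hom (show M.obj from x)
        map_add' := fun x y => map_add f.hom.hom _ _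
        map_smul' := fun h x => by
          have : Module.Finite ℂ M.obj := M.property.1
          have : Module.Finite ℂ M'.obj := M'.property.1
          exact lusztigHom_intertwine hq (rep M.obj) (realDiff_of_realModule M.property)
            (rep M'.obj) (realDiff_of_realModule M'.property)
            (f.hom.hom.restrictScalars ℂ) (fun a x => map_smul f.hom.hom a x) h x }

end real

/-! ### Bernstein-Zelevinsky derivatives -/

section commute

variable {q : ℝ} {n k l b : ℕ}

lemma block_disjoint (h : 0 + k ≤ n) (h' : b + l ≤ n) (hb : k ≤ b) (x : Fin k) (y : Fin l) :
    block h x ≠ block h' y := by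
  intro he
  have h1 : 0 + x.1 = b + y.1 := congrArg Fin.val he
  have hx := x.2
  omega

lemma AffineHecke.T_poly_comm (j : Fin (n - 1)) (f : Laurent n)
    (hf : lrename (simpleRefl j) f = f) :
    Commute (AffineHecke.T j : AffineHecke q n) (AffineHecke.poly f) := by
  have h := AffineHecke.T_cross (q := q) j f 0 (by rw [hf]; simp)
  rw [hf, mul_zero, ← AffineHecke.polyHom_apply 0, map_zero, smul_zero] at h
  exact sub_eq_zero.1 h

lemma lrename_simpleRefl_block (h : 0 + k ≤ n) (h' : b + l ≤ n) (hb : k ≤ b) :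
    (∀ (j : Fin (l - 1)) (f : Laurent k), lrename (simpleRefl (blockRefl h' j))
      (lrename (block h) f) = lrename (block h) f) ∧
    (∀ (j : Fin (k - 1)) (f : Laurent l), lrename (simpleRefl (blockRefl h j))
      (lrename (block h') f) = lrename (block h') f) := by
  constructor
  · intro j f
    rw [lrename_comp]
    congr 2
    funext x
    exact Equiv.swap_apply_of_ne_of_ne (block_disjoint h h' hb x (lo j))
      (block_disjoint h h' hb x (hi j))
  · intro j f
    rw [lrename_comp]
    congr 2
    funext x
    exact Equiv.swap_apply_of_ne_of_ne (block_disjoint h h' hb (lo j) x).symm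
      (block_disjoint h h' hb (hi j) x).symm

/-- The images of the Hecke algebras of two disjoint blocks commute. -/
lemma AffineHecke.levi_commute (h : 0 + k ≤ n) (h' : b + l ≤ n) (hb : k ≤ b)
    (x : AffineHecke q k) (y : AffineHecke q l) :
    Commute (AffineHecke.levi q h x) (AffineHecke.levi q h' y) := by
  have hT : ∀ {k a : ℕ} (h : a + k ≤ n) (j : Fin (k - 1)),
      AffineHecke.levi q h (AffineHecke.T j) = AffineHecke.T (blockRefl h j) :=
    fun h j => AffineHecke.lift_T _ _ _ _ _ _ j
  have hp : ∀ {k a : ℕ} (h : a + k ≤ n) (f : Laurent k),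
      AffineHecke.levi q h (AffineHecke.poly f) = AffineHecke.poly (lrename (block h) f) :=
    fun h f => AffineHecke.lift_poly _ _ _ _ _ _ f
  induction x using AffineHecke.induction with
  | hT i =>
    induction y using AffineHecke.induction with
    | hT j =>
      rw [hT, hT]
      refine AffineHecke.T_comm _ _ ?_
      have := i.2
      simp only [blockRefl]
      omega
    | hp f =>
      rw [hT, hp]
      exact AffineHecke.T_poly_comm _ _ ((lrename_simpleRefl_block h h' hb).2 i f)
    | hadd a b ha hb => rw [map_add]; exact ha.add_right hb
    | hmul a b ha hb => rw [map_mul]; exact ha.mul_right hb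
  | hp g =>
    induction y using AffineHecke.induction with
    | hT j =>
      rw [hT, hp]
      exact (AffineHecke.T_poly_comm _ _ ((lrename_simpleRefl_block h h' hb).1 j g)).symm
    | hp f =>
      rw [hp, hp]
      exact (Commute.all (lrename (block h) g) (lrename (block h') f)).map AffineHecke.polyHom
    | hadd a b ha hb => rw [map_add]; exact ha.add_right hb
    | hmul a b ha hb => rw [map_mul]; exact ha.mul_right hb
  | hadd a b ha hb => rw [map_add]; exact ha.add_left hb
  | hmul a b ha hb => rw [map_mul]; exact ha.mul_left hb

lemma GradedHecke.levi_t {a : ℕ} (h : a + k ≤ n) (w : Equiv.Perm (Fin k)) :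
    GradedHecke.levi q h (GradedHecke.t w) = GradedHecke.t (w.viaEmbedding (block h)) :=
  GradedHecke.lift_t _ _ _ w

lemma GradedHecke.levi_poly {a : ℕ} (h : a + k ≤ n) (f : MvPolynomial (Fin k) ℂ) :
    GradedHecke.levi q h (GradedHecke.poly f) =
      GradedHecke.poly (MvPolynomial.rename (block h) f) :=
  GradedHecke.lift_poly _ _ _ f

lemma GradedHecke.poly_t_comm (j : Fin (n - 1)) (f : MvPolynomial (Fin n) ℂ)
    (hf : MvPolynomial.rename (simpleRefl j) f = f) :
    Commute (GradedHecke.t (simpleRefl j) : GradedHecke q n) (GradedHecke.poly f) := by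
  have h := GradedHecke.poly_t (q := q) j f 0 (by rw [hf]; ring)
  rw [hf, ← GradedHecke.polyHom_apply 0, map_zero, smul_zero, add_zero] at h
  exact h.symm

lemma GradedHecke.levi_t_poly_comm {a a' : ℕ} (h : a + k ≤ n) (h' : a' + l ≤ n)
    (hd : ∀ x y, block h x ≠ block h' y) (w : Equiv.Perm (Fin k)) (f : MvPolynomial (Fin l) ℂ) :
    Commute (GradedHecke.levi q h (GradedHecke.t w)) (GradedHecke.levi q h' (GradedHecke.poly f)) := by
  obtain ⟨L, rfl⟩ := exists_word w
  induction L with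
  | nil =>
    rw [List.map_nil, List.prod_nil, GradedHecke.t_one, map_one]
    exact Commute.one_left _
  | cons j L ih =>
    rw [List.map_cons, List.prod_cons, GradedHecke.t_mul, map_mul]
    refine Commute.mul_left ?_ ih
    rw [GradedHecke.levi_t, GradedHecke.levi_poly, viaEmbedding_simpleRefl]
    refine GradedHecke.poly_t_comm _ _ ?_
    rw [MvPolynomial.rename_rename]
    congr 2
    funext x
    exact Equiv.swap_apply_of_ne_of_ne (hd (lo j) x).symm (hd (hi j) x).symm

/-- The images of the graded Hecke algebras of two disjoint blocks commute. -/
lemma GradedHecke.levi_commute (h : 0 + k ≤ n) (h' : b + l ≤ n) (hb : k ≤ b)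
    (x : GradedHecke q k) (y : GradedHecke q l) :
    Commute (GradedHecke.levi q h x) (GradedHecke.levi q h' y) := by
  have hd := block_disjoint h h' hb
  induction x using GradedHecke.induction with
  | ht v =>
    induction y using GradedHecke.induction with
    | ht w =>
      rw [GradedHecke.levi_t, GradedHecke.levi_t]
      have : Commute (v.viaEmbedding (block h)) (w.viaEmbedding (block h')) := by
        apply Equiv.Perm.Disjoint.commute
        intro x
        by_cases hx : x ∈ Set.range (block h)
        · right
          obtain ⟨x, rfl⟩ := hx
          refine Equiv.Perm.viaEmbedding_apply_of_notMem _ _ _ ?_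
          rintro ⟨y, hy⟩
          exact hd x y hy.symm
        · left
          exact Equiv.Perm.viaEmbedding_apply_of_notMem _ _ _ hx
      exact this.map (GradedHecke.tHom (q := q))
    | hp f => exact GradedHecke.levi_t_poly_comm h h' hd v f
    | hadd a b ha hb => rw [map_add]; exact ha.add_right hb
    | hmul a b ha hb => rw [map_mul]; exact ha.mul_right hb
  | hp g =>
    induction y using GradedHecke.induction with
    | ht w => exact (GradedHecke.levi_t_poly_comm h' h (fun x y => (hd y x).symm) w g).symm
    | hp f =>
      rw [GradedHecke.levi_poly, GradedHecke.levi_poly]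
      exact (Commute.all (MvPolynomial.rename (block h) g)
        (MvPolynomial.rename (block h') f)).map GradedHecke.polyHom
    | hadd a b ha hb => rw [map_add]; exact ha.add_right hb
    | hmul a b ha hb => rw [map_mul]; exact ha.mul_right hb
  | hadd a b ha hb => rw [map_add]; exact ha.add_left hb
  | hmul a b ha hb => rw [map_mul]; exact ha.mul_left hb

end commute

section image

/-- For a ring homomorphism `φ : A → B` and an element `e` of `B` that commutes with the image of
`φ`: the image `e(M)` of a `B`-module `M`, as a submodule of the restriction of `M` to `A`. -/
def imageSub {A B : Type} [Ring A] [Ring B] (φ : A →+* B) (e : B) (h : ∀ a, Commute (φ a) e)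
    (M : ModuleCat.{u} B) : Submodule A ((ModuleCat.restrictScalars φ).obj M) where
  carrier := {y | ∃ x : M, e • x = (show M from y)}
  zero_mem' := ⟨0, smul_zero e⟩
  add_mem' := by
    rintro y y' ⟨x, hx⟩ ⟨x', hx'⟩
    exact ⟨x + x', by rw [smul_add, hx, hx']; rfl⟩
  smul_mem' := by
    rintro a y ⟨x, hx⟩
    refine ⟨φ a • x, ?_⟩
    rw [← mul_smul, ← (h a).eq, mul_smul, hx]
    rfl

/-- The functor `M ↦ e(M)`. -/
def imageFunctor {A B : Type} [Ring A] [Ring B] (φ : A →+* B) (e : B)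
    (h : ∀ a, Commute (φ a) e) : ModuleCat.{u} B ⥤ ModuleCat.{u} A where
  obj M := ModuleCat.of A (imageSub φ e h M)
  map {M M'} f := ModuleCat.ofHom
    (LinearMap.restrict ((ModuleCat.restrictScalars φ).map f).hom (by
      rintro y ⟨x, hx⟩
      refine ⟨f.hom x, ?_⟩
      rw [← map_smul, hx]
      rfl))

variable {q : ℝ} {n i : ℕ}

/-- The Bernstein-Zelevinsky derivative `BZ_i`: for an `H_n`-module `σ`, the `H_{n-i}`-module
`S_i^n(σ)`, where `S_i^n` is the image of `1 ⊗ S_i` under `H_{n-i} ⊗ H_i → H_n`, and `S_i` is the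
sign projector of `H_i`. -/
def BZDeriv (q : ℝ) {n i : ℕ} (hi : i ≤ n) :
    ModuleCat.{u} (AffineHecke q n) ⥤ ModuleCat.{u} (AffineHecke q (n - i)) :=
  imageFunctor
    (AffineHecke.levi q (k := n - i) (a := 0) (n := n) (by omega)).toRingHom
    (AffineHecke.levi q (k := i) (a := n - i) (n := n) (by omega) (AffineHecke.signProj q i))
    (fun a => AffineHecke.levi_commute _ _ le_rfl a _)

/-- The functor `π ↦ s_i^n(π)` on all `ℍ_n`-modules, where `s_i^n` is the image of `1 ⊗ s_i` under
`ℍ_{n-i} ⊗ ℍ_i → ℍ_n`, and `s_i` is the sign projector of `ℍ_i`. -/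
def gBZAll (q : ℝ) {n i : ℕ} (hi : i ≤ n) :
    ModuleCat.{u} (GradedHecke q n) ⥤ ModuleCat.{u} (GradedHecke q (n - i)) :=
  imageFunctor
    (GradedHecke.levi q (k := n - i) (a := 0) (n := n) (by omega)).toRingHom
    (GradedHecke.levi q (k := i) (a := n - i) (n := n) (by omega) (GradedHecke.signProj q i))
    (fun a => GradedHecke.levi_commute _ _ le_rfl a _)

open scoped ModuleCat in
lemma gBZAll_real (hi : i ≤ n) (M : ModuleCat.{u} (GradedHecke q n))
    (hM : RealModule.{u} q n M) : RealModule.{u} q (n - i) ((gBZAll q hi).obj M) := by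
  have hfin : Module.Finite ℂ M := hM.1
  have hreal := realDiff_of_realModule hM
  let φ := GradedHecke.levi q (k := n - i) (a := 0) (n := n) (by omega)
  let f : ((gBZAll q hi).obj M) →ₗ[ℂ] M :=
    { toFun := fun x => (show M from x.1)
      map_add' := fun x y => rfl
      map_smul' := fun c x => by
        change φ (algebraMap ℂ _ c) • (show M from x.1) = _
        rw [AlgHom.commutes, algebraMap_smul]
        rfl }
  have hf : Function.Injective f := fun x y hxy => Subtype.ext hxy
  have hfa : ∀ (a : GradedHecke q (n - i)) (x : (gBZAll q hi).obj M), f (a • x) = φ a • f x :=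
    fun a x => rfl
  refine realModule_of_realDiff (Module.Finite.of_injective f hf) fun k l z hz => ?_
  obtain ⟨y, hy⟩ := hz.exists_hasEigenvector
  have h1 : GradedHecke.poly (q := q) (MvPolynomial.X k - MvPolynomial.X l) • y = z • y :=
    hy.apply_eq_smul
  have h2 := congrArg f h1
  rw [hfa, map_smul, GradedHecke.levi_poly, map_sub, MvPolynomial.rename_X,
    MvPolynomial.rename_X] at h2
  refine hreal (block _ k) (block _ l) z (Module.End.hasEigenvalue_of_hasEigenvector (x := f y)
    ⟨Module.End.mem_eigenspace_iff.2 h2, fun h0 => hy.2 (hf (by rw [h0, map_zero]))⟩)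

/-- The Bernstein-Zelevinsky derivative `gBZ_i`, `π ↦ s_i^n(π)`, on finite-dimensional modules with
real central characters. -/
def gBZDeriv (q : ℝ) {n i : ℕ} (hi : i ≤ n) :
    (RealModule.{u} q n).FullSubcategory ⥤ (RealModule.{u} q (n - i)).FullSubcategory :=
  (RealModule.{u} q (n - i)).lift ((RealModule.{u} q n).ι ⋙ gBZAll q hi)
    (fun M => gBZAll_real hi M.obj M.property)

end image


end BZ

end

noncomputable section

namespace BZ

open Filter Topology Asymptotics

/-! ### Reduced words in the symmetric group -/

/-! Write `F = 𝒢 / g`, the function `lusztigFactor q`. On `Λ(π)` the definition of the action reads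
`T_j + 1 = (t_j + 1) F(α_j)`, so in rank one the operator `F(α)` carries the vectors on which `T`
acts by `-1` to those on which `t` acts by `-1`. In higher rank one operator has to do this for all
simple reflections of the last `i` indices at once. The product `Φ` of the `F(α)` over all positive
roots `α` of this block does it: `s_j` permutes the positive roots other than `α_j`, so the product
`Φ_j` over these is invariant under `s_j` and commutes with `t_j`, whence `(t_j + 1) Φ = Φ_j (t_j +
1) F(α_j) = Φ_j (T_j + 1)`. With its singularities removed, `F(z)` is the quotient of the values of
`(e^z - 1) / z` at `z + log q` and at `z`, and this entire function has no real zeros. As the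
operators `ε_k - ε_l` have real eigenvalues, `Φ` and `Φ_j` are invertible. Hence `T_j x = -x` if and
only if `t_j Φ x = -Φ x` (`exists_add_one_mul_signIntertwiner`, `isUnit_signIntertwiner`,
`signIntertwiner_mem_iff`).

Both derivatives are joint `-1` eigenspaces of this kind. For the graded algebra this is the usual
antisymmetrization in a group algebra. For the affine algebra `T_w` is a product along a chosen
shortest word, and Matsumoto's theorem is needed to know that `T_j T_w = T_{s_j w}` when the length
grows. The terms of the projector then fall into pairs `{w, s_j w}`, and the quadratic relation
makes `T_j + 1` kill each pair; conversely, the normalized projector fixes every vector on which all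
`T_j` act by `-1`. So `Φ` restricts to a bijection from `BZ_i(Λ(π))` onto `gBZ_i(π)`.

Linearity and naturality come from the functoriality of the passage from graded to affine actions
(`lusztigHom_intertwine`) and its compatibility with blocks (`lusztigHom_levi`). The operator `Φ` is
a polynomial in the last `i` of the `ε_k`, so it commutes with `ℍ_{n-i}`; by functoriality it
commutes with `H_{n-i}` too. The inclusion of `gBZ_i(π)` into `π` is also a map of
`ℍ_{n-i}`-modules, which identifies the action on `Λ(gBZ_i(π))` with the restricted one. Finally, a
morphism intertwines the `ε_k - ε_l`, hence the functions of these operators, hence `Φ`. -/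

lemma lo_lt_hi {n : ℕ} (j : Fin (n - 1)) : lo j < hi j :=
  Fin.lt_def.2 (Nat.lt_succ_self _)

lemma simpleRefl_apply_self {n : ℕ} (j : Fin (n - 1)) (x : Fin n) :
    simpleRefl j (simpleRefl j x) = x :=
  Equiv.swap_apply_self _ _ _

lemma simpleRefl_inv {n : ℕ} (j : Fin (n - 1)) : (simpleRefl j)⁻¹ = simpleRefl j :=
  Equiv.swap_inv _ _

lemma simpleRefl_mul_cancel {n : ℕ} (j : Fin (n - 1)) (w : Equiv.Perm (Fin n)) :
    simpleRefl j * (simpleRefl j * w) = w := by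
  rw [← mul_assoc, simpleRefl_mul_self, one_mul]

/-- A simple reflection preserves the order of all pairs except the one it exchanges. -/
lemma simpleRefl_lt {n : ℕ} (j : Fin (n - 1)) {x y : Fin n} (h : x < y)
    (hne : ¬(x = lo j ∧ y = hi j)) : simpleRefl j x < simpleRefl j y := by
  have hj := j.2
  simp only [simpleRefl, Equiv.swap_apply_def]
  simp only [lo, hi, Fin.lt_def, Fin.ext_iff] at h hne ⊢
  split_ifs <;> first | omega | (dsimp only; omega)

/-- The inversions of `w⁻¹`. -/
def inversions {n : ℕ} (w : Equiv.Perm (Fin n)) : Finset (Fin n × Fin n) :=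
  Finset.univ.filter fun p => p.1 < p.2 ∧ w⁻¹ p.2 < w⁻¹ p.1

/-- The simple reflection `s_j` is a left descent of `w`. -/
def LeftDescent {n : ℕ} (j : Fin (n - 1)) (w : Equiv.Perm (Fin n)) : Prop :=
  w⁻¹ (hi j) < w⁻¹ (lo j)

lemma simpleRefl_mul_inv_apply {n : ℕ} (j : Fin (n - 1)) (w : Equiv.Perm (Fin n)) (x : Fin n) :
    (simpleRefl j * w)⁻¹ x = w⁻¹ (simpleRefl j x) := by
  rw [mul_inv_rev, simpleRefl_inv, Equiv.Perm.mul_apply]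

lemma leftDescent_simpleRefl_mul {n : ℕ} (j : Fin (n - 1)) (w : Equiv.Perm (Fin n)) :
    LeftDescent j (simpleRefl j * w) ↔ ¬LeftDescent j w := by
  rw [LeftDescent, LeftDescent, simpleRefl_mul_inv_apply, simpleRefl_mul_inv_apply,
    rename_simpleRefl_lo, rename_simpleRefl_hi, not_lt]
  exact ⟨le_of_lt, fun h => lt_of_le_of_ne h fun e => lo_ne_hi j (w⁻¹.injective e)⟩

/-- Applying `s_j` to both entries carries the inversions of `w` to those of `s_j w`, as `s_j` keeps
the order of every pair but `(lo j, hi j)`. That pair is not an inversion of `w` and becomes the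
single new one. -/
lemma card_inversions_simpleRefl_mul {n : ℕ} {j : Fin (n - 1)} {w : Equiv.Perm (Fin n)}
    (h : ¬LeftDescent j w) :
    (inversions (simpleRefl j * w)).card = (inversions w).card + 1 := by
  have e : inversions (simpleRefl j * w) = insert (lo j, hi j)
      ((inversions w).map ((simpleRefl j).prodCongr (simpleRefl j)).toEmbedding) := by
    ext ⟨x, y⟩
    rw [Finset.mem_insert, Finset.mem_map_equiv]
    have hs : (simpleRefl j).symm = simpleRefl j := simpleRefl_inv j
    simp only [inversions, Finset.mem_filter, Finset.mem_univ, true_and, Equiv.prodCongr_symm,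
      Equiv.prodCongr_apply, Prod.map_apply, simpleRefl_mul_inv_apply, hs, Prod.mk.injEq]
    constructor
    · rintro ⟨h1, h2⟩
      by_cases hp : x = lo j ∧ y = hi j
      · exact Or.inl hp
      · exact Or.inr ⟨simpleRefl_lt j h1 hp, h2⟩
    · rintro (⟨rfl, rfl⟩ | ⟨h1, h2⟩)
      · rw [← simpleRefl_mul_inv_apply, ← simpleRefl_mul_inv_apply]
        exact ⟨lo_lt_hi j, (leftDescent_simpleRefl_mul j w).2 h⟩
      · refine ⟨?_, h2⟩
        -- If the reflected pair were the exceptional one, `h2` would say that `j` is a left descent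
        -- of `w`.
        have h3 := simpleRefl_lt j h1 fun hp => h (by rw [LeftDescent, ← hp.1, ← hp.2]; exact h2)
        rwa [simpleRefl_apply_self, simpleRefl_apply_self] at h3
  rw [e, Finset.card_insert_of_notMem, Finset.card_map]
  -- The added pair is really new: it would have to come from `(hi j, lo j)`, which is not
  -- increasing.
  rw [Finset.mem_map_equiv]
  have hs : (simpleRefl j).symm = simpleRefl j := simpleRefl_inv j
  simp only [inversions, Finset.mem_filter, Finset.mem_univ, true_and, Equiv.prodCongr_symm,
    Equiv.prodCongr_apply, Prod.map_apply, hs, rename_simpleRefl_lo, rename_simpleRefl_hi]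
  exact fun hp => (lo_lt_hi j).asymm hp.1

lemma LeftDescent.card_inversions {n : ℕ} {j : Fin (n - 1)} {w : Equiv.Perm (Fin n)}
    (h : LeftDescent j w) :
    (inversions w).card = (inversions (simpleRefl j * w)).card + 1 := by
  have := card_inversions_simpleRefl_mul (j := j) (w := simpleRefl j * w)
    (by rwa [leftDescent_simpleRefl_mul, not_not])
  rwa [simpleRefl_mul_cancel] at this

/-- Without descents `w⁻¹` increases at each step, so it is an order automorphism of a finite chain,
and the identity is the only one. -/
lemma eq_one_of_forall_not_leftDescent {n : ℕ} {w : Equiv.Perm (Fin n)}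
    (h : ∀ j, ¬LeftDescent j w) : w = 1 := by
  rcases n with _ | n
  · exact Subsingleton.elim _ _
  have hm : StrictMono (w⁻¹ : Equiv.Perm (Fin (n + 1))) := by
    rw [Fin.strictMono_iff_lt_succ]
    intro j
    exact lt_of_le_of_ne (not_lt.1 (h j)) fun e => lo_ne_hi (n := n + 1) j (w⁻¹.injective e)
  have h1 : (hm.orderIsoOfSurjective _ w⁻¹.surjective) = OrderIso.refl _ := Subsingleton.elim _ _
  rw [← inv_eq_one]
  ext1 x
  exact DFunLike.congr_fun h1 x

lemma inversions_one (n : ℕ) : inversions (1 : Equiv.Perm (Fin n)) = ∅ := by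
  rw [inversions, Finset.filter_eq_empty_iff]
  rintro p - ⟨h1, h2⟩
  exact h1.asymm h2

/-- `L` is a reduced expression of `w`. -/
def IsReducedWord {n : ℕ} (L : List (Fin (n - 1))) (w : Equiv.Perm (Fin n)) : Prop :=
  (L.map simpleRefl).prod = w ∧ (inversions w).card = L.length

/-- Each letter changes the number of inversions by exactly one, up or down. -/
lemma card_inversions_le {n : ℕ} (L : List (Fin (n - 1))) :
    (inversions (L.map simpleRefl).prod).card ≤ L.length := by
  induction L with
  | nil => simp [inversions_one]
  | cons j L ih =>
    rw [List.map_cons, List.prod_cons, List.length_cons]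
    by_cases h : LeftDescent j (L.map simpleRefl).prod
    · have := h.card_inversions
      omega
    · have := card_inversions_simpleRefl_mul h
      omega

lemma IsReducedWord.cons {n : ℕ} {j : Fin (n - 1)} {L : List (Fin (n - 1))}
    {w : Equiv.Perm (Fin n)} (hL : IsReducedWord L (simpleRefl j * w)) (h : LeftDescent j w) :
    IsReducedWord (j :: L) w := by
  refine ⟨?_, ?_⟩
  · rw [List.map_cons, List.prod_cons, hL.1, simpleRefl_mul_cancel]
  · rw [h.card_inversions, hL.2, List.length_cons]

/-- The tail has too few letters to produce all inversions of `w`, so the first letter must add one.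
This makes it a left descent of `w` and leaves no slack in the tail. -/
lemma IsReducedWord.of_cons {n : ℕ} {j : Fin (n - 1)} {L : List (Fin (n - 1))}
    {w : Equiv.Perm (Fin n)} (hL : IsReducedWord (j :: L) w) :
    LeftDescent j w ∧ IsReducedWord L (simpleRefl j * w) := by
  obtain ⟨rfl, h⟩ := hL
  rw [List.map_cons, List.prod_cons, List.length_cons] at *
  have h1 := card_inversions_le L
  by_cases hd : LeftDescent j (L.map simpleRefl).prod
  · have := hd.card_inversions
    omega
  · have := card_inversions_simpleRefl_mul hd
    rw [leftDescent_simpleRefl_mul, simpleRefl_mul_cancel]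
    exact ⟨hd, rfl, by omega⟩

/-- Descents are removed one after another; each removal lowers the number of inversions by one, and
only the identity has no descent. -/
lemma exists_isReducedWord {n : ℕ} (w : Equiv.Perm (Fin n)) : ∃ L, IsReducedWord L w := by
  induction hN : (inversions w).card generalizing w with
  | zero =>
    refine ⟨[], ?_, hN⟩
    refine (eq_one_of_forall_not_leftDescent fun j hj => ?_).symm
    have := hj.card_inversions
    omega
  | succ N ih =>
    by_cases h : ∃ j, LeftDescent j w
    · obtain ⟨j, hj⟩ := h
      have := hj.card_inversions
      obtain ⟨L, hL⟩ := ih (simpleRefl j * w) (by omega)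
      exact ⟨j :: L, hL.cons hj⟩
    · push Not at h
      rw [eq_one_of_forall_not_leftDescent h, inversions_one] at hN
      simp at hN

/-- This ties the length defined by minimality to the count of inversions: the count bounds every
word from below, and some word attains it. -/
lemma isReducedWord_shortestWord {n : ℕ} (w : Equiv.Perm (Fin n)) :
    IsReducedWord (shortestWord w) w := by
  obtain ⟨h1, h2⟩ := (exists_shortest_word w).choose_spec
  refine ⟨h1, le_antisymm ?_ ?_⟩
  · have := card_inversions_le (shortestWord w)
    rwa [shortestWord, h1] at this
  · obtain ⟨L, hL, hc⟩ := exists_isReducedWord w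
    rw [hc]
    exact h2 L hL

lemma len_eq_card_inversions {n : ℕ} (w : Equiv.Perm (Fin n)) : len w = (inversions w).card :=
  (isReducedWord_shortestWord w).2.symm

/-! ### Matsumoto's theorem -/

section matsumoto

variable {n : ℕ} {M : Type*} [Monoid M] (t : Fin (n - 1) → M)

/-- The case of different first letters. Both `j` and `k` are left descents of `w`, so `w` has
reduced words that begin with either expression of the longest element of the group generated by
`s_j` and `s_k`, followed by a common word `U`. The induction hypothesis replaces the two given
tails, and one braid or commutation relation joins the two words. -/
lemma isReducedWord_prod_eq_aux
    (braid : ∀ j k : Fin (n - 1), j.1 + 1 = k.1 → t j * t k * t j = t k * t j * t k)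
    (comm : ∀ j k : Fin (n - 1), j.1 + 1 < k.1 → t j * t k = t k * t j) {N : ℕ}
    (ih : ∀ (L L' : List (Fin (n - 1))) (w : Equiv.Perm (Fin n)), L.length = N →
      IsReducedWord L w → IsReducedWord L' w → (L.map t).prod = (L'.map t).prod)
    {j k : Fin (n - 1)} (hjk : j < k) {L L' : List (Fin (n - 1))} {w : Equiv.Perm (Fin n)}
    (hN : L.length = N) (hL : IsReducedWord (j :: L) w) (hL' : IsReducedWord (k :: L') w) :
    ((j :: L).map t).prod = ((k :: L').map t).prod := by
  obtain ⟨dj, rj⟩ := hL.of_cons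
  obtain ⟨dk, rk⟩ := hL'.of_cons
  have hN' : L'.length = N := by
    have h1 := hL.2
    have h2 := hL'.2
    simp only [List.length_cons] at h1 h2
    omega
  have n1 : lo j ≠ lo k := fun h => hjk.ne (Fin.ext (by simpa [lo] using h))
  have n2 : lo j ≠ hi k := by
    have := Fin.lt_def.1 hjk
    simp [lo, hi, Fin.ext_iff]; omega
  have n4 : hi j ≠ hi k := fun h => hjk.ne (Fin.ext (by simpa [hi] using h))
  rw [List.map_cons, List.prod_cons, List.map_cons, List.prod_cons]
  rcases (Nat.succ_le_of_lt (Fin.lt_def.1 hjk)).eq_or_lt with h | h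
  -- Adjacent letters. The two descents say that `w⁻¹` decreases along the three indices `lo j`, `hi
  -- j = lo k`, `hi k`. Hence removing `j`, `k`, `j` in turn, or `k`, `j`, `k`, removes one
  -- inversion each time.
  · have e : hi j = lo k := Fin.ext h
    have dj' : w⁻¹ (lo k) < w⁻¹ (lo j) := e ▸ dj
    have dk' : w⁻¹ (hi k) < w⁻¹ (lo k) := dk
    have jlk : simpleRefl j (lo k) = lo j := by rw [← e, rename_simpleRefl_hi]
    have jhk : simpleRefl j (hi k) = hi k := Equiv.swap_apply_of_ne_of_ne n2.symm n4.symm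
    have klj : simpleRefl k (lo j) = lo j := Equiv.swap_apply_of_ne_of_ne n1 n2
    have khj : simpleRefl k (hi j) = hi k := by rw [e, rename_simpleRefl_lo]
    have eu : simpleRefl j * (simpleRefl k * (simpleRefl j * w)) =
        simpleRefl k * (simpleRefl j * (simpleRefl k * w)) := by
      -- Both triple products are the transposition of the outer indices `lo j` and `hi k`.
      have hb : simpleRefl j * simpleRefl k * simpleRefl j =
          simpleRefl k * simpleRefl j * simpleRefl k := by
        have e1 := Equiv.swap_mul_swap_mul_swap (x := lo j) (y := hi j) (z := hi k) (lo_ne_hi j) n2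
        have e2 := Equiv.swap_mul_swap_mul_swap (x := hi k) (y := lo k) (z := lo j)
          (lo_ne_hi k).symm n2.symm
        rw [Equiv.swap_comm (hi k) (lo k), Equiv.swap_comm (lo k) (lo j), ← e] at e2
        unfold simpleRefl
        rw [← e, e1, e2, Equiv.swap_comm]
      simp only [← mul_assoc, hb]
    obtain ⟨U, hU⟩ := exists_isReducedWord (simpleRefl j * (simpleRefl k * (simpleRefl j * w)))
    have a1 : IsReducedWord (k :: j :: U) (simpleRefl j * w) := by
      refine (hU.cons ?_).cons ?_
      · simp only [LeftDescent, simpleRefl_mul_inv_apply, khj, klj, jhk, rename_simpleRefl_lo]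
        rwa [e]
      · simp only [LeftDescent, simpleRefl_mul_inv_apply, jhk, jlk]
        exact dk'.trans dj'
    -- By the braid relation of permutations, the same `U` is the common end of both words.
    rw [eu] at hU
    have a2 : IsReducedWord (j :: k :: U) (simpleRefl k * w) := by
      refine (hU.cons ?_).cons ?_
      · simp only [LeftDescent, simpleRefl_mul_inv_apply, jhk, jlk, klj, rename_simpleRefl_hi]
        exact dj'
      · simp only [LeftDescent, simpleRefl_mul_inv_apply, khj, klj]
        exact dk'.trans dj'
    rw [ih _ _ _ hN rj a1, ih _ _ _ hN' rk a2]
    simp only [List.map_cons, List.prod_cons, ← mul_assoc, braid j k h]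
  -- Distant letters: the two transpositions have disjoint supports, so one letter of each kind is
  -- removed, in either order.
  · have n3 : hi j ≠ lo k := by simp [lo, hi, Fin.ext_iff]; omega
    have jlk : simpleRefl j (lo k) = lo k := Equiv.swap_apply_of_ne_of_ne n1.symm n3.symm
    have jhk : simpleRefl j (hi k) = hi k := Equiv.swap_apply_of_ne_of_ne n2.symm n4.symm
    have klj : simpleRefl k (lo j) = lo j := Equiv.swap_apply_of_ne_of_ne n1 n2
    have khj : simpleRefl k (hi j) = hi j := Equiv.swap_apply_of_ne_of_ne n3 n4
    have eu : simpleRefl k * (simpleRefl j * w) = simpleRefl j * (simpleRefl k * w) := by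
      rw [← mul_assoc, ← mul_assoc]
      congr 1
      change simpleRefl k * Equiv.swap (lo j) (hi j) = _
      -- Conjugation by `s_k` replaces the entries of the transposition `s_j` by their images, and
      -- both are fixed.
      rw [Equiv.mul_swap_eq_swap_mul, klj, khj]
      rfl
    obtain ⟨U, hU⟩ := exists_isReducedWord (simpleRefl k * (simpleRefl j * w))
    have a1 : IsReducedWord (k :: U) (simpleRefl j * w) := by
      refine hU.cons ?_
      simp only [LeftDescent, simpleRefl_mul_inv_apply, jhk, jlk]
      exact dk
    rw [eu] at hU
    have a2 : IsReducedWord (j :: U) (simpleRefl k * w) := by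
      refine hU.cons ?_
      simp only [LeftDescent, simpleRefl_mul_inv_apply, khj, klj]
      exact dj
    rw [ih _ _ _ hN rj a1, ih _ _ _ hN' rk a2]
    simp only [List.map_cons, List.prod_cons, ← mul_assoc, comm j k h]

/-- **Matsumoto's theorem** for the symmetric group: in a monoid whose elements `t j` satisfy the
braid relations, all reduced expressions of a permutation have the same product. -/
theorem IsReducedWord.prod_map_eq
    (braid : ∀ j k : Fin (n - 1), j.1 + 1 = k.1 → t j * t k * t j = t k * t j * t k)
    (comm : ∀ j k : Fin (n - 1), j.1 + 1 < k.1 → t j * t k = t k * t j)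
    {L L' : List (Fin (n - 1))} {w : Equiv.Perm (Fin n)} (hL : IsReducedWord L w)
    (hL' : IsReducedWord L' w) : (L.map t).prod = (L'.map t).prod := by
  induction hN : L.length generalizing L L' w with
  | zero =>
    -- Both words have as many letters as `w` has inversions, so the second one is empty too.
    have h1 := hL.2
    rw [hL'.2, hN] at h1
    rw [List.length_eq_zero_iff.1 hN, List.length_eq_zero_iff.1 h1]
  | succ N ih =>
    have h1 := hL.2
    rw [hL'.2, hN] at h1
    obtain ⟨j, L, rfl⟩ := List.exists_cons_of_length_eq_add_one hN
    obtain ⟨k, L', rfl⟩ := List.exists_cons_of_length_eq_add_one h1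
    have ih' : ∀ (L L' : List (Fin (n - 1))) (w : Equiv.Perm (Fin n)), L.length = N →
        IsReducedWord L w → IsReducedWord L' w → (L.map t).prod = (L'.map t).prod :=
      fun L L' w hN hL hL' => ih hL hL' hN
    rw [List.length_cons, add_left_inj] at hN h1
    rcases lt_trichotomy j k with h | rfl | h
    · exact isReducedWord_prod_eq_aux t braid comm ih' h hN hL hL'
    · rw [List.map_cons, List.map_cons, List.prod_cons, List.prod_cons,
        ih' _ _ _ hN hL.of_cons.2 hL'.of_cons.2]
    · exact (isReducedWord_prod_eq_aux t braid comm ih' h h1 hL' hL).symm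

end matsumoto

/-! ### The sign projectors -/

/-! ### The sign projector of the affine Hecke algebra -/

namespace AffineHecke

variable {q : ℝ} {n : ℕ}

/-- Putting `j` in front of the chosen word of `w` gives a reduced word of `s_j w`, in general not
the chosen one. Matsumoto's theorem removes the difference. -/
lemma T_mul_Tw {j : Fin (n - 1)} {w : Equiv.Perm (Fin n)} (h : ¬LeftDescent j w) :
    (T j * Tw w : AffineHecke q n) = Tw (simpleRefl j * w) := by
  have h1 : IsReducedWord (j :: shortestWord w) (simpleRefl j * w) := by
    refine IsReducedWord.cons ?_ ((leftDescent_simpleRefl_mul j w).2 h)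
    rw [simpleRefl_mul_cancel]
    exact isReducedWord_shortestWord w
  have h2 := h1.prod_map_eq (T (q := q)) T_braid T_comm
    (isReducedWord_shortestWord (simpleRefl j * w))
  rwa [List.map_cons, List.prod_cons] at h2

/-- With `l = l(w)`, the two terms add up to `(-1/q)^l (T_w - q⁻¹ T_j T_w) = (-1/q)^(l+1) (T_j - q)
T_w`, and the quadratic relation applies. -/
lemma T_add_one_mul_pair (hq : q ≠ 0) {j : Fin (n - 1)} {w : Equiv.Perm (Fin n)}
    (h : ¬LeftDescent j w) :
    ((T j + 1) * ((-1 / (q : ℂ)) ^ len w • Tw w + (-1 / (q : ℂ)) ^ len (simpleRefl j * w) •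
      Tw (simpleRefl j * w)) : AffineHecke q n) = 0 := by
  have hq' : (q : ℂ) ≠ 0 := by exact_mod_cast hq
  rw [len_eq_card_inversions (simpleRefl j * w), card_inversions_simpleRefl_mul h,
    ← len_eq_card_inversions, ← T_mul_Tw h, pow_succ, mul_smul, ← smul_add, mul_smul_comm]
  have h1 : (Tw w + (-1 / (q : ℂ)) • (T j * Tw w) : AffineHecke q n) =
      (-1 / (q : ℂ)) • ((T j - algebraMap ℂ (AffineHecke q n) (q : ℂ)) * Tw w) := by
    rw [sub_mul, smul_sub, ← Algebra.smul_def, smul_smul, div_mul_cancel₀ _ hq', neg_one_smul]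
    abel
  rw [h1, mul_smul_comm, ← mul_assoc, T_quad, zero_mul, smul_zero, smul_zero]

/-- The symmetric group splits into pairs `{w, s_j w}`, and `T_j + 1` kills the contribution of each
pair. -/
lemma T_add_one_mul_signProj (hq : q ≠ 0) (j : Fin (n - 1)) :
    (T j + 1) * signProj q n = 0 := by
  have h1 : ∑ w : Equiv.Perm (Fin n), (T j + 1) * ((-1 / (q : ℂ)) ^ len w • Tw w +
      (-1 / (q : ℂ)) ^ len (simpleRefl j * w) • Tw (simpleRefl j * w) : AffineHecke q n) = 0 := by
    refine Finset.sum_eq_zero fun w _ => ?_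
    by_cases h : LeftDescent j w
    · have h2 := T_add_one_mul_pair hq (j := j) (w := simpleRefl j * w)
        (by rwa [leftDescent_simpleRefl_mul, not_not])
      rwa [simpleRefl_mul_cancel, add_comm (_ • Tw _)] at h2
    · exact T_add_one_mul_pair hq h
  have h2 := Equiv.sum_comp (Equiv.mulLeft (simpleRefl j))
    (fun w => (-1 / (q : ℂ)) ^ len w • (Tw w : AffineHecke q n))
  simp only [Equiv.coe_mulLeft] at h2
  -- The sum over all `w` meets each pair twice, so it is twice the unnormalized projector; the
  -- factor `2` is cancelled.
  rw [← Finset.mul_sum, Finset.sum_add_distrib, h2, ← two_smul ℂ, mul_smul_comm] at h1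
  rw [signProj, mul_smul_comm, (smul_eq_zero.1 h1).resolve_left two_ne_zero, smul_zero]

variable {E : Type*} [AddCommGroup E] [Module ℂ E] (σ : AffineHecke q n →ₐ[ℂ] Module.End ℂ E)

lemma Tw_apply_of_forall {x : E} (hx : ∀ j, σ (T j) x = -x) (w : Equiv.Perm (Fin n)) :
    σ (Tw w) x = (-1 : ℂ) ^ len w • x := by
  rw [Tw, len]
  induction shortestWord w with
  | nil => simp
  | cons j L ih =>
    rw [List.map_cons, List.prod_cons, map_mul, Module.End.mul_apply, ih, map_smul, hx,
      List.length_cons, pow_succ]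
    simp

/-- The image of the sign projector is the space on which all `T_j` act by `-1`. -/
lemma mem_range_signProj (hq : 0 < q) (x : E) :
    (∃ y, σ (signProj q n) y = x) ↔ ∀ j, σ (T j) x = -x := by
  constructor
  · rintro ⟨y, rfl⟩ j
    have h := congrArg (fun a => σ a y) (T_add_one_mul_signProj (q := q) (n := n) hq.ne' j)
    simp only [map_mul, map_add, map_one, map_zero, Module.End.mul_apply, LinearMap.add_apply,
      Module.End.one_apply, LinearMap.zero_apply] at h
    exact eq_neg_of_add_eq_zero_left h
  · intro hx
    -- Such a vector is its own preimage: the projector fixes it.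
    refine ⟨x, ?_⟩
    have h0 : (∑ w : Equiv.Perm (Fin n), (1 / (q : ℂ)) ^ len w) ≠ 0 := by
      -- The normalizing sum is nonzero because it is a sum of positive real numbers; this is where
      -- positivity of `q` enters.
      have : 0 < ∑ w : Equiv.Perm (Fin n), (1 / q) ^ len w :=
        Finset.sum_pos (fun w _ => by positivity) Finset.univ_nonempty
      exact_mod_cast this.ne'
    rw [signProj, map_smul, map_sum, LinearMap.smul_apply, LinearMap.sum_apply, inv_smul_eq_iff₀ h0,
      Finset.sum_smul]
    refine Finset.sum_congr rfl fun w _ => ?_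
    rw [map_smul, LinearMap.smul_apply, Tw_apply_of_forall σ hx, smul_smul, ← mul_pow]
    -- The signs cancel: `(-1/q)^l (-1)^l = (1/q)^l`, the corresponding term of the normalizing sum.
    congr 2
    ring

end AffineHecke

/-! ### The sign projector of the graded Hecke algebra -/

namespace GradedHecke

variable {q : ℝ} {n : ℕ}

/-- Left multiplication by `s_j` permutes the terms of the sum and reverses their signs. -/
lemma t_mul_signProj (j : Fin (n - 1)) :
    t (simpleRefl j) * signProj q n = -signProj q n := by
  rw [signProj, mul_smul_comm, ← smul_neg, Finset.mul_sum, ← Finset.sum_neg_distrib,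
    ← Equiv.sum_comp (Equiv.mulLeft (simpleRefl j))]
  congr 1
  refine Finset.sum_congr rfl fun w _ => ?_
  rw [Equiv.coe_mulLeft, mul_smul_comm, ← t_mul, simpleRefl_mul_cancel, Equiv.Perm.sign_mul,
    simpleRefl, Equiv.Perm.sign_swap (lo_ne_hi j)]
  simp

variable {E : Type*} [AddCommGroup E] [Module ℂ E] (ρ : GradedHecke q n →ₐ[ℂ] Module.End ℂ E)

lemma t_apply_of_forall {x : E} (hx : ∀ j, ρ (t (simpleRefl j)) x = -x)
    (w : Equiv.Perm (Fin n)) : ρ (t w) x = ((Equiv.Perm.sign w : ℤ) : ℂ) • x := by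
  obtain ⟨L, rfl⟩ := exists_word w
  induction L with
  | nil => simp [t_one]
  | cons j L ih =>
    rw [List.map_cons, List.prod_cons, t_mul, map_mul, Module.End.mul_apply, ih, map_smul, hx,
      Equiv.Perm.sign_mul, simpleRefl, Equiv.Perm.sign_swap (lo_ne_hi j)]
    simp

/-- The image of the sign projector is the space on which all simple reflections act by `-1`. -/
lemma mem_range_signProj (x : E) :
    (∃ y, ρ (signProj q n) y = x) ↔ ∀ j, ρ (t (simpleRefl j)) x = -x := by
  constructor
  · rintro ⟨y, rfl⟩ j
    rw [← Module.End.mul_apply, ← map_mul, t_mul_signProj, map_neg, LinearMap.neg_apply]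
  · intro hx
    refine ⟨x, ?_⟩
    have h0 : (Fintype.card (Equiv.Perm (Fin n)) : ℂ) ≠ 0 := by
      exact_mod_cast Fintype.card_ne_zero
    rw [signProj, map_smul, map_sum, LinearMap.smul_apply, LinearMap.sum_apply, inv_smul_eq_iff₀ h0]
    -- Each term acts by the square of a sign, so the sum is as many copies of `x` as there are
    -- permutations.
    have h1 : ∀ w ∈ (Finset.univ : Finset (Equiv.Perm (Fin n))),
        ρ (((Equiv.Perm.sign w : ℤ) : ℂ) • t w) x = x := by
      intro w _
      rw [map_smul, LinearMap.smul_apply, t_apply_of_forall ρ hx, smul_smul]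
      rcases Int.units_eq_one_or (Equiv.Perm.sign w) with h | h <;> simp [h]
    rw [Finset.sum_congr rfl h1, Finset.sum_const, Finset.card_univ, Nat.cast_smul_eq_nsmul]

end GradedHecke

/-! ### The intertwining operator between the two sign spaces -/

section factor

open MvPolynomial (X C rename)

/-- The singularities at `0` and `-log q` are removed by writing the function as a quotient of two
values of `expQuot`, which is continuous at a real point because the denominator does not vanish
there. A limit is needed, as the value of `lusztigFactor` at a removable singularity carries no
information. -/
lemma lusztigFactor_tendsto {q : ℝ} (hq : 1 < q) (z : ℂ) (hz : z.im = 0) :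
    Tendsto (lusztigFactor q) (𝓝[≠] z) (𝓝 (expQuot (z + Real.log q) / expQuot z)) := by
  have h1 : ∀ a : ℂ, ∀ᶠ w in 𝓝[≠] z, w ≠ a := by
    intro a
    by_cases ha : a = z
    · rw [ha]; exact self_mem_nhdsWithin
    · exact nhdsWithin_le_nhds (isOpen_ne.mem_nhds (Ne.symm ha))
  have h2 : ContinuousAt (fun z => expQuot (z + Real.log q) / expQuot z) z := by
    refine ContinuousAt.div ?_ (expQuot_analytic z).continuousAt (expQuot_ne_zero hz)
    exact ContinuousAt.comp (f := fun w : ℂ => w + Real.log q) (expQuot_analytic _).continuousAt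
      (by fun_prop)
  refine (h2.tendsto.mono_left nhdsWithin_le_nhds).congr' ?_
  filter_upwards [h1 0, h1 (-Real.log q)] with w hw hw'
  rw [lusztigFactor_eq hq hw (fun h => hw' (eq_neg_of_add_eq_zero_left h))]

/-- Agreement to a positive order forces `P` to take at `z` the limit of the factor. This limit is a
quotient of two values of `expQuot` at real points, neither of which is zero. -/
lemma Agrees.eval_ne_zero {q : ℝ} (hq : 1 < q) {P : Polynomial ℂ} {N : ℕ} (hN : N ≠ 0) {z : ℂ}
    (hz : z.im = 0) (h : Agrees N (lusztigFactor q) P z) : P.eval z ≠ 0 := by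
  have h1 : Tendsto (fun w : ℂ => (w - z) ^ N) (𝓝[≠] z) (𝓝 0) := by
    have : Continuous fun w : ℂ => (w - z) ^ N := by fun_prop
    have h5 := this.tendsto z
    simp only [sub_self, zero_pow hN] at h5
    exact h5.mono_left nhdsWithin_le_nhds
  have h2 := (lusztigFactor_tendsto hq z hz).sub (h.trans_tendsto h1)
  simp only [sub_sub_cancel, sub_zero] at h2
  have h3 : Tendsto (fun w : ℂ => P.eval w) (𝓝[≠] z) (𝓝 (P.eval z)) :=
    (P.continuous.tendsto z).mono_left nhdsWithin_le_nhds
  rw [tendsto_nhds_unique h3 h2]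
  exact div_ne_zero (expQuot_ne_zero (by simp [hz])) (expQuot_ne_zero hz)

/-- A polynomial without zeros at the eigenvalues of an operator takes an invertible value at it. -/
lemma isUnit_aeval {E : Type*} [AddCommGroup E] [Module ℂ E] [FiniteDimensional ℂ E]
    (A : Module.End ℂ E) (p : Polynomial ℂ) (h : ∀ z, A.HasEigenvalue z → p.eval z ≠ 0) :
    IsUnit (Polynomial.aeval A p) := by
  -- The spectral mapping theorem is used in a form that needs a nonempty spectrum, so the zero
  -- space is treated apart.
  rcases subsingleton_or_nontrivial E with _ | _
  · exact isUnit_of_subsingleton _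
  rw [← spectrum.zero_notMem_iff ℂ, spectrum.map_polynomial_aeval_of_nonempty _ _
    (spectrum.nonempty_of_isAlgClosed_of_finiteDimensional ℂ A)]
  rintro ⟨z, hz, h0⟩
  exact h z (Module.End.hasEigenvalue_iff_mem_spectrum.2 hz) h0

/-! ### The product over the positive roots and its intertwining relation -/

variable {q : ℝ} {n : ℕ} {E : Type*} [AddCommGroup E] [Module ℂ E]
  (ρ : GradedHecke q n →ₐ[ℂ] Module.End ℂ E)

/-- The pairs of indices `k < l`. -/
def increasingPairs (n : ℕ) : Finset (Fin n × Fin n) := Finset.univ.filter fun p => p.1 < p.2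

lemma mem_increasingPairs {p : Fin n × Fin n} : p ∈ increasingPairs n ↔ p.1 < p.2 := by
  simp [increasingPairs]

/-- The operator `𝒢(ε_k - ε_l) / g(ε_k - ε_l)`. -/
def factorOp (k l : Fin n) : Module.End ℂ E :=
  opFun (lusztigFactor q) (ρ (GradedHecke.poly (X k - X l)))

/-- The product of the operators `𝒢(α) / g(α)` over all positive roots `α`. -/
def signIntertwiner : Module.End ℂ E :=
  ((increasingPairs n).toList.map fun p => factorOp ρ p.1 p.2).prod

variable [FiniteDimensional ℂ E]

variable {ρ} in
-- One polynomial `P` serves all roots at once. The operators thereby become values of `act ρ` on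
-- polynomials in the `ε_k`, where permutations of the variables make sense and factors commute. The
-- default value `0` of `opFun` does not occur here.
lemma GoodPoly.factorOp_eq {P : Polynomial ℂ} (h : GoodPoly ρ (bigOrder n E) P) (k l : Fin n) :
    factorOp ρ k l = act ρ (diffPoly P k l) := by
  -- With `n ≥ 1`, the order `n * dim E + 1` is at least the dimension that `opFun_eq` asks for.
  have hn : 1 ≤ n := k.pos
  rw [factorOp, opFun_eq (N := bigOrder n E) (by unfold bigOrder; nlinarith) (h.eig k l)]
  exact Polynomial.aeval_algHom_apply (act ρ) _ _

/-- The eigenvalues of `ε_k - ε_l` are real, and `𝒢 / g` has no zero on the real line. -/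
lemma isUnit_factorOp (hq : 1 < q) (hρ : RealDiff ρ) (k l : Fin n) :
    IsUnit (factorOp ρ k l) := by
  obtain ⟨P, hP⟩ := exists_goodPoly ρ hq hρ (bigOrder n E)
  rw [hP.factorOp_eq, diffPoly, ← Polynomial.aeval_algHom_apply]
  exact isUnit_aeval _ _ fun z hz => (hP.eig k l z hz).eval_ne_zero hq (Nat.succ_ne_zero _)
    (hρ k l z hz)

lemma isUnit_signIntertwiner (hq : 1 < q) (hρ : RealDiff ρ) : IsUnit (signIntertwiner ρ) := by
  rw [signIntertwiner, ← IsUnit.mem_submonoid_iff]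
  refine list_prod_mem fun A hA => ?_
  obtain ⟨p, -, rfl⟩ := List.mem_map.1 hA
  exact isUnit_factorOp ρ hq hρ _ _

variable {ρ} in
-- The product is taken along a list because endomorphisms do not commute in general. All its
-- factors come from the commutative polynomial ring, so the chosen order is immaterial.
lemma GoodPoly.signIntertwiner_eq {P : Polynomial ℂ} (h : GoodPoly ρ (bigOrder n E) P) :
    signIntertwiner ρ = act ρ (∏ p ∈ increasingPairs n, diffPoly P p.1 p.2) := by
  rw [signIntertwiner, ← Finset.prod_map_toList, map_list_prod, List.map_map]
  congr 1
  exact List.map_congr_left fun p _ => h.factorOp_eq p.1 p.2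

lemma exists_signIntertwiner_eq (hq : 1 < q) (hρ : RealDiff ρ) :
    ∃ R, signIntertwiner ρ = act ρ R := by
  obtain ⟨P, hP⟩ := exists_goodPoly ρ hq hρ (bigOrder n E)
  exact ⟨_, hP.signIntertwiner_eq⟩

/-- A simple reflection permutes the positive roots other than its own simple root; this is the fact
that makes the intertwiner work. -/
lemma rename_prod_erase (P : Polynomial ℂ) (j : Fin (n - 1)) :
    rename (simpleRefl j) (∏ p ∈ (increasingPairs n).erase (lo j, hi j), diffPoly P p.1 p.2) =
      ∏ p ∈ (increasingPairs n).erase (lo j, hi j), diffPoly P p.1 p.2 := by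
  have hmem : ∀ p ∈ (increasingPairs n).erase (lo j, hi j),
      Prod.map (simpleRefl j) (simpleRefl j) p ∈ (increasingPairs n).erase (lo j, hi j) := by
    rintro ⟨x, y⟩ hp
    rw [Finset.mem_erase, mem_increasingPairs] at hp ⊢
    refine ⟨fun h => ?_, simpleRefl_lt j hp.2 fun h => hp.1 (Prod.ext h.1 h.2)⟩
    -- An increasing pair sent to `(lo j, hi j)` would be `(hi j, lo j)`, which is decreasing.
    simp only [Prod.map_apply, Prod.mk.injEq] at h
    have h1 := congrArg (simpleRefl j) h.1
    have h2 := congrArg (simpleRefl j) h.2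
    rw [simpleRefl_apply_self, rename_simpleRefl_lo] at h1
    rw [simpleRefl_apply_self, rename_simpleRefl_hi] at h2
    have h3 := hp.2
    simp only [h1, h2] at h3
    exact (lo_lt_hi j).asymm h3
  have hinv : ∀ p : Fin n × Fin n, Prod.map (simpleRefl j) (simpleRefl j)
      (Prod.map (simpleRefl j) (simpleRefl j) p) = p := fun p =>
    Prod.ext (simpleRefl_apply_self j _) (simpleRefl_apply_self j _)
  rw [map_prod]
  refine Finset.prod_nbij' (Prod.map (simpleRefl j) (simpleRefl j))
    (Prod.map (simpleRefl j) (simpleRefl j)) hmem hmem (fun p _ => hinv p) (fun p _ => hinv p)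
    fun p _ => ?_
  rw [rename_diffPoly]
  rfl

/-- `(t_j + 1) Φ = Φ_j (T_j + 1)`, where `Φ_j` is the product over the positive roots other than
`α_j`. -/
lemma exists_add_one_mul_signIntertwiner (hq : 1 < q) (hρ : RealDiff ρ) (j : Fin (n - 1)) :
    ∃ B, IsUnit B ∧ (tOp ρ j + 1) * signIntertwiner ρ = B * (lusztigT ρ j + 1) := by
  obtain ⟨P, hP⟩ := exists_goodPoly ρ hq hρ (bigOrder n E)
  set R := ∏ p ∈ (increasingPairs n).erase (lo j, hi j), diffPoly P p.1 p.2 with hR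
  have hmem : (lo j, hi j) ∈ increasingPairs n := mem_increasingPairs.2 (lo_lt_hi j)
  have h1 := act_tOp_of_symm ρ j R (rename_prod_erase P j)
  refine ⟨act ρ R, ?_, ?_⟩
  -- Each factor of `R` acts as one of the invertible operators `factorOp`.
  · rw [hR, ← Finset.prod_map_toList, map_list_prod, List.map_map, ← IsUnit.mem_submonoid_iff]
    refine list_prod_mem fun A hA => ?_
    obtain ⟨p, -, rfl⟩ := List.mem_map.1 hA
    rw [IsUnit.mem_submonoid_iff, Function.comp_apply, ← hP.factorOp_eq]
    exact isUnit_factorOp ρ hq hρ _ _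
  -- The factor of `α_j` is split off on the right, and `R`, which commutes with `t_j`, is moved to
  -- the left of `t_j + 1`. What remains on the right is `(t_j + 1) F(α_j) = T_j + 1`.
  · rw [hP.signIntertwiner_eq, ← Finset.prod_erase_mul _ _ hmem, ← hR, map_mul,
      lusztigT_eq hP le_rfl, sub_add_cancel, ← mul_assoc, ← mul_assoc, add_mul, mul_add, h1,
      one_mul, mul_one]

/-- The intertwiner maps the sign space of the operators `T_j` onto that of the operators `t_j`. -/
lemma signIntertwiner_mem_iff (hq : 1 < q) (hρ : RealDiff ρ) (j : Fin (n - 1)) (x : E) :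
    ρ (GradedHecke.t (simpleRefl j)) (signIntertwiner ρ x) = -signIntertwiner ρ x ↔
      lusztigT ρ j x = -x := by
  obtain ⟨B, hB, h⟩ := exists_add_one_mul_signIntertwiner ρ hq hρ j
  have h1 := LinearMap.congr_fun h x
  simp only [Module.End.mul_apply, LinearMap.add_apply, Module.End.one_apply] at h1
  have hB' : Function.Injective B := ((Module.End.isUnit_iff B).1 hB).injective
  rw [eq_neg_iff_add_eq_zero, eq_neg_iff_add_eq_zero]
  change tOp ρ j _ + _ = 0 ↔ _
  rw [h1, map_eq_zero_iff B hB']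

/-- Every factor is a function of an operator, and such functions commute with intertwining maps:
one polynomial can be chosen that interpolates at the eigenvalues on both sides. This gives
naturality in the module. -/
lemma signIntertwiner_intertwine (hq : 1 < q) (hρ : RealDiff ρ) {E' : Type*} [AddCommGroup E']
    [Module ℂ E'] [FiniteDimensional ℂ E'] (ρ' : GradedHecke q n →ₐ[ℂ] Module.End ℂ E')
    (hρ' : RealDiff ρ') (f : E →ₗ[ℂ] E') (hf : ∀ a x, f (ρ a x) = ρ' a (f x)) (x : E) :
    f (signIntertwiner ρ x) = signIntertwiner ρ' (f x) := by
  rw [signIntertwiner, signIntertwiner]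
  -- The list of roots depends on `n` only, so both products run over the same list.
  induction (increasingPairs n).toList with
  | nil => rfl
  | cons p L ih =>
    rw [List.map_cons, List.prod_cons, List.map_cons, List.prod_cons, Module.End.mul_apply,
      Module.End.mul_apply, ← ih]
    exact opFun_intertwine f (hf _) (fun D N hD => exists_factor_interpolation hq D
      (fun z hz => (hD z hz).elim (hρ _ _ z) (hρ' _ _ z)) N) _

end factor

/-! ### Compatibility of Lusztig's map with blocks -/

section levi

open MvPolynomial (X C rename)

variable {q : ℝ} {n k a : ℕ} {E : Type*} [AddCommGroup E] [Module ℂ E]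
  {ρ : GradedHecke q n →ₐ[ℂ] Module.End ℂ E}

lemma RealDiff.comp_levi (hρ : RealDiff ρ) (h : a + k ≤ n) :
    RealDiff (ρ.comp (GradedHecke.levi q h)) := by
  intro i j z hz
  rw [AlgHom.comp_apply, GradedHecke.levi_poly, map_sub, MvPolynomial.rename_X,
    MvPolynomial.rename_X] at hz
  exact hρ _ _ z hz

lemma rename_linForm (h : a + k ≤ n) (x : Fin k →₀ ℤ) :
    rename (block h) (linForm x) = linForm (Finsupp.mapDomain (block h) x) := by
  rw [linForm, linForm, map_sum, ← Finset.sum_subset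
    (Finset.subset_univ (Finset.univ.map (block h)))]
  · rw [Finset.sum_map]
    refine Finset.sum_congr rfl fun i _ => ?_
    rw [map_mul, MvPolynomial.rename_C, MvPolynomial.rename_X,
      Finsupp.mapDomain_apply (block h).injective]
  -- The indices outside the block have coefficient zero.
  · intro i _ hi
    rw [Finsupp.mapDomain_of_notMem_range]
    · simp
    · rintro ⟨j, rfl⟩
      exact hi (by simp)

variable [FiniteDimensional ℂ E]

/-- The formulas for the `T_j` and `x_k` of a block involve only the `t_w` and `ε_k` of that block,
and `opFun` sees only the operator and the space, which stay the same. Statements about a block thus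
reduce to statements about a whole, smaller algebra acting on the same space. -/
lemma lusztigHom_levi (hq : 1 < q) (hρ : RealDiff ρ) (h : a + k ≤ n) (y : AffineHecke q k) :
    lusztigHom hq ρ hρ (AffineHecke.levi q h y) =
      lusztigHom hq (ρ.comp (GradedHecke.levi q h)) (hρ.comp_levi h) y := by
  induction y using AffineHecke.induction with
  | hT j =>
    rw [AffineHecke.levi, AffineHecke.lift_T, lusztigHom_T, lusztigHom_T, lusztigT, lusztigT,
      AlgHom.comp_apply, AlgHom.comp_apply, GradedHecke.levi_t, GradedHecke.levi_poly,
      viaEmbedding_simpleRefl, map_sub, MvPolynomial.rename_X, MvPolynomial.rename_X]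
    rfl
  | hp f =>
    rw [AffineHecke.levi, AffineHecke.lift_poly, AlgHom.comp_apply, AffineHecke.polyHom_apply,
      lusztigHom_poly, lusztigHom_poly]
    induction f using AddMonoidAlgebra.induction_linear with
    | zero => simp
    | add f g hf hg => simp only [map_add, hf, hg]
    | single x c =>
      rw [lrename, AddMonoidAlgebra.mapDomainAlgHom_apply, AddMonoidAlgebra.mapDomain_single,
        lusztigLaurent_single, lusztigLaurent_single, lusztigX, lusztigX, AlgHom.comp_apply,
        GradedHecke.levi_poly, rename_linForm]
      rfl
  | hadd a b ha hb => rw [map_add, map_add, map_add, ha, hb]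
  | hmul a b ha hb => rw [map_mul, map_mul, map_mul, ha, hb]

variable {i b : ℕ}

/-- The intertwiner of a block commutes with the affine Hecke algebra of a disjoint block. -/
lemma signIntertwiner_lusztigHom_comm (hq : 1 < q) (hρ : RealDiff ρ) (h : 0 + k ≤ n)
    (h' : b + i ≤ n) (hb : k ≤ b) (y : AffineHecke q k) (x : E) :
    signIntertwiner (ρ.comp (GradedHecke.levi q h')) (lusztigHom hq ρ hρ (AffineHecke.levi q h y) x)
      = lusztigHom hq ρ hρ (AffineHecke.levi q h y)
        (signIntertwiner (ρ.comp (GradedHecke.levi q h')) x) := by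
  obtain ⟨R, hR⟩ := exists_signIntertwiner_eq _ hq (hρ.comp_levi h')
  rw [lusztigHom_levi]
  -- By functoriality, commuting with the graded action of the first block is enough. That holds
  -- because the intertwiner acts as a polynomial in the variables of the other block.
  refine lusztigHom_intertwine hq _ (hρ.comp_levi h) _ (hρ.comp_levi h) _ (fun a x => ?_) y x
  rw [hR]
  have := ((GradedHecke.levi_commute (q := q) h h' hb a (GradedHecke.poly R)).map ρ).eq
  exact (LinearMap.congr_fun this x).symm

/-- The intertwiner of a block maps the image of the sign projector of the affine Hecke algebra
onto the image of the sign projector of the graded Hecke algebra. -/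
lemma signIntertwiner_mem_range_iff (hq : 1 < q) (hρ : RealDiff ρ) (h' : b + i ≤ n) (x : E) :
    (∃ y, ρ (GradedHecke.levi q h' (GradedHecke.signProj q i)) y =
        signIntertwiner (ρ.comp (GradedHecke.levi q h')) x) ↔
      ∃ y, lusztigHom hq ρ hρ (AffineHecke.levi q h' (AffineHecke.signProj q i)) y = x := by
  rw [lusztigHom_levi, AffineHecke.mem_range_signProj _ (by linarith)]
  -- Both images are now joint `-1` eigenspaces, and they are compared one simple reflection at a
  -- time.
  refine (GradedHecke.mem_range_signProj (ρ.comp (GradedHecke.levi q h')) _).trans ?_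
  refine forall_congr' fun j => ?_
  rw [lusztigHom_T]
  exact signIntertwiner_mem_iff _ hq (hρ.comp_levi h') j x

end levi

/-! ### The derivatives and Lusztig's functor -/

section derivative

open scoped ModuleCat

variable {q : ℝ} {n i : ℕ}

/-- The inclusion of the derivative `gBZ_i(π)` into `π`. -/
def gBZIncl (q : ℝ) (hi : i ≤ n) (M : ModuleCat.{u} (GradedHecke q n)) :
    ((gBZAll q hi).obj M) →ₗ[ℂ] M where
  toFun x := (show M from x.1)
  map_add' _ _ := rfl
  map_smul' c x := by
    -- Complex scalars act on the derivative through the embedding of the first block, which is a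
    -- homomorphism of `ℂ`-algebras and so fixes them.
    change GradedHecke.levi q (k := n - i) (a := 0) (n := n) (by omega) (algebraMap ℂ _ c) •
      (show M from x.1) = _
    rw [AlgHom.commutes, algebraMap_smul]
    rfl

lemma gBZIncl_injective (hi : i ≤ n) (M : ModuleCat.{u} (GradedHecke q n)) :
    Function.Injective (gBZIncl q hi M) := fun _ _ h => Subtype.ext h

/-- The intertwiner of the last `i` indices on a module with real central characters. -/
def blockIntertwiner (hi : i ≤ n) (M : ModuleCat.{u} (GradedHecke q n)) : Module.End ℂ M :=
  signIntertwiner ((rep M).comp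
    (GradedHecke.levi q (k := i) (a := n - i) (n := n) (by omega)))

variable (hq : 1 < q) (hi : i ≤ n) (M : (RealModule.{u} q n).FullSubcategory)

/-- The left side uses functions of operators on the smaller space `gBZ_i(π)`, the right side those
on `π`. They agree because the inclusion intertwines the graded actions and the passage to affine
actions is functorial. -/
lemma gBZIncl_smul (a : AffineHecke q (n - i))
    (x : lusztigModule hq ((gBZDeriv q hi).obj M)) :
    haveI : Module.Finite ℂ M.obj := M.property.1
    gBZIncl q hi M.obj (a • x : lusztigModule hq ((gBZDeriv q hi).obj M)) =
      lusztigHom hq (rep M.obj) (realDiff_of_realModule M.property)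
        (AffineHecke.levi q (k := n - i) (a := 0) (n := n) (by omega) a)
        (gBZIncl q hi M.obj x) := by
  have : Module.Finite ℂ M.obj := M.property.1
  have : Module.Finite ℂ ((gBZDeriv q hi).obj M).obj := ((gBZDeriv q hi).obj M).property.1
  rw [lusztigHom_levi]
  exact lusztigHom_intertwine hq (rep ((gBZDeriv q hi).obj M).obj)
    (realDiff_of_realModule ((gBZDeriv q hi).obj M).property) _ _ (gBZIncl q hi M.obj)
    (fun _ _ => rfl) a x

/-- One direction makes the map between the derivatives well defined, the other makes it surjective.
-/
lemma blockIntertwiner_mem_iff (x : M.obj) :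
    (∃ y : M.obj, GradedHecke.levi q (k := i) (a := n - i) (n := n) (by omega)
        (GradedHecke.signProj q i) • y = blockIntertwiner hi M.obj x) ↔
      ∃ y : lusztigModule hq M, AffineHecke.levi q (k := i) (a := n - i) (n := n) (by omega)
        (AffineHecke.signProj q i) • y = (show lusztigModule hq M from x) := by
  have : Module.Finite ℂ M.obj := M.property.1
  exact signIntertwiner_mem_range_iff hq (realDiff_of_realModule M.property) _ x

/-- The isomorphism `BZ_i(Λ(π)) ≅ Λ(gBZ_i(π))` that is given by the intertwiner, as a linear map. -/
def derivativeHom : ((BZDeriv q hi).obj (lusztigModule hq M)) →ₗ[AffineHecke q (n - i)]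
    lusztigModule hq ((gBZDeriv q hi).obj M) where
  toFun x := (⟨blockIntertwiner hi M.obj (show M.obj from x.1),
    (blockIntertwiner_mem_iff hq hi M _).2 x.2⟩ : (gBZAll q hi).obj M.obj)
  map_add' x y := Subtype.ext (map_add (blockIntertwiner hi M.obj) _ _)
  map_smul' a x := by
    have : Module.Finite ℂ M.obj := M.property.1
    -- Equality is tested inside `π`, where both affine actions are given by `lusztigHom` of the
    -- full module.
    apply gBZIncl_injective hi M.obj
    refine Eq.trans ?_ (gBZIncl_smul hq hi M a _).symm
    exact signIntertwiner_lusztigHom_comm hq (realDiff_of_realModule M.property) _ _ le_rfl a _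

/-- The intertwiner is bijective on all of `π`, and a vector lies in the source exactly when its
image lies in the target. -/
lemma derivativeHom_bijective : Function.Bijective (derivativeHom hq hi M) := by
  have : Module.Finite ℂ M.obj := M.property.1
  have hΦ : Function.Bijective (blockIntertwiner hi M.obj) :=
    (Module.End.isUnit_iff _).1 (isUnit_signIntertwiner _ hq
      ((realDiff_of_realModule M.property).comp_levi _))
  constructor
  · intro x y h
    exact Subtype.ext (hΦ.1 (congrArg (gBZIncl q hi M.obj) h))
  · intro y
    obtain ⟨x, hx⟩ := hΦ.2 (gBZIncl q hi M.obj y)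
    refine ⟨⟨x, (blockIntertwiner_mem_iff hq hi M x).1 ?_⟩, gBZIncl_injective hi M.obj hx⟩
    rw [hx]
    exact y.2

/-- On finite-dimensional modules with real central characters, the derivatives `BZ_i` and `gBZ_i`
correspond to each other under Lusztig's functor. -/
def derivativeIso :
    lusztigFunctor.{u} hq ⋙ BZDeriv q hi ≅ gBZDeriv q hi ⋙ lusztigFunctor hq :=
  NatIso.ofComponents
    (fun M => (LinearEquiv.ofBijective (derivativeHom hq hi M)
      (derivativeHom_bijective hq hi M)).toModuleIso)
    (fun {M M'} f => by
      have : Module.Finite ℂ M.obj := M.property.1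
      have : Module.Finite ℂ M'.obj := M'.property.1
      ext x
      apply gBZIncl_injective hi M'.obj
      -- The functors do not change underlying maps, so naturality says that a morphism, seen as a
      -- map of representations of the last block, commutes with the intertwiners.
      exact (signIntertwiner_intertwine _ hq ((realDiff_of_realModule M.property).comp_levi _) _
        ((realDiff_of_realModule M'.property).comp_levi _) (f.hom.hom.restrictScalars ℂ)
        (fun a x => map_smul f.hom.hom _ x) _).symm)

end derivative

end BZ

end

/-- The isomorphism exists on all finite-dimensional modules with real central characters; it is
restricted along the inclusion of the modules that belong to the single real orbit of `ζ`. -/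
theorem theorem6p5 (q : ℝ) (hq : 1 < q) (n i : ℕ) (hi : i ≤ n) (ζ : Fin n → ℂ)
    (hζ : BZ.IsRealPoint ζ) :
    Nonempty
      ((ObjectProperty.ιOfLE (BZ.centralModule_le.{u} (q := q) hζ) ⋙
          BZ.lusztigFunctor hq ⋙ BZ.BZDeriv q hi) ≅
        (ObjectProperty.ιOfLE (BZ.centralModule_le.{u} (q := q) hζ) ⋙
          BZ.gBZDeriv q hi ⋙ BZ.lusztigFunctor hq)) :=
  ⟨Functor.isoWhiskerLeft _ (BZ.derivativeIso hq hi)⟩
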